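/- **Setting.** Let $(Z,d)$ be a metric space with a Borel (regular) measure $\mu$ such that every open ball has positive and finite measure, and suppose that for some constants $Q>0$, $C\ge 1$ one has $\mu(B(\xi,\lambda r))\le C\lambda^Q\mu(B(\xi,r))$ for all $\xi\in Z$, $r>0$, $\lambda\ge1$. $L^1_{\rm loc}(Z)$ is the space of complex functions that are integrable on every bounded measurable set. *Hyperbolic filling.* For every $n\in\mathbb Z$ let $\{\xi_x\}_{x\in X_n}$ be a maximal set of points of $Z$ with $d(\xi_x,\xi_{x'})\ge 2^{-n-1}$ for $x\ne x'$ in $X_n$, and put $B(x)=B(\xi_x,2^{-n})$ for $x\in X_n$. If $\operatorname{diam} Z=1$, it is also allowed to use only $n\ge 0$: then $X_n$ and $B(x)$ are as above for $n\ge1$, $X_0=\{\mathbf 0\}$ is a singleton, and $B(\mathbf 0)=Z$. Let $X=\bigsqcup_n X_n$, write $|x|=n$ for $x\in X_n$, and join $x\neq x'$ by an edge ($x\sim x'$) if and only if $||x|-|x'||\le1$ and $B(x)\cap B(x')\ne\emptyset$. Let $E$ be the set of edges, each with an orientation, such that an edge joining $x\sim x'$ with $|x'|>|x|$ is directed from $x$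 to $x'$; $e_{x,x'}$ denotes the edge directed from $x$ to $x'$. Let $(\psi_x)_{x\in X}$ be nonnegative Lipschitz functions on $Z$ such that $\psi_x$ vanishes outside $B(x)$, $\sum_{x\in X_n}\psi_x=1$ for every admitted level $n$, and $\operatorname{Lip}\psi_x\le L\,2^{|x|}$ with $L$ independent of $x$. *Spaces.* Let $0<s<\infty$, $0<p<\infty$, $0<q\le\infty$. For an edge $e$ joining $x$ and $x'$ let $|e|=\min(|x|,|x'|)$ and $B(e)=B(x)\cup B(x')$; $\mathcal J^s_{p,q}(E)$ is the space of $u:E\to\mathbb C$ with $$\|u\|_{\mathcal J^s_{p,q}(E)}=\Big(\int_Z\big\|\{2^{|e|s}|u(e)|\chi_{B(e)}(\xi)\}_{e\in E}\big\|_{\ell^q}^p\,d\mu(\xi)\Big)^{1/p}<\infty.$$ For $f\in L^1_{\rm loc}(Z)$ let $Pf(x)=\mu(B(x))^{-1}\int_{B(x)}f\,d\mu$ for $x\in X$, and for $v:X\to\mathbb C$ let $|dv|(x)=\big(\sum_{y\sim x}|v(y)-v(x)|^2\big)^{1/2}$ for $x\in X$, and $dv(e_{x,x'})=v(x')-v(x)$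 for $e_{x,x'}\in E$. $\dot{\mathcal F}^s_{p,q}(Z)$ is the space of $f\in L^1_{\rm loc}(Z)$ with $$\|f\|_{\dot{\mathcal F}^s_{p,q}(Z)}=\Big(\int_Z\big\|\{2^{|x|s}|d(Pf)|(x)\,:\,x\in X,\ \xi\in B(x)\}\big\|_{\ell^q}^p\,d\mu(\xi)\Big)^{1/p}<\infty,$$ modulo functions that are constant $\mu$-almost everywhere. **Proposition 6.3.** Suppose that $0<s<1$, $Q/(Q+s)<p<\infty$ and $Q/(Q+s)<q\le\infty$. Then there exist bounded linear operators $$S:\dot{\mathcal F}^s_{p,q}(Z)\to\mathcal J^s_{p,q}(E),\qquad R:\mathcal J^s_{p,q}(E)\to\dot{\mathcal F}^s_{p,q}(Z)$$ such that $R\circ S$ is the identity on $\dot{\mathcal F}^s_{p,q}(Z)$. More explicitly, they may be taken so that $S$ is $f\mapsto d(Pf)$ and, for every fixed $\xi_0\in Z$, $$Ru=\lim_{N\to\infty}\Big(\sum_{n=-N}^{N}I_nu(\cdot)-\sum_{n=-N}^{-1}I_nu(\xi_0)\Big)+\mathbb C,\qquad I_nu=\sum_{\substack{(y,y')\in X_n\times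 X_{n+1}\\ y\sim y'}}u(e_{y,y'})\,\psi_y\psi_{y'},$$ where the limit exists both in $L^1_{\rm loc}(Z)$ and pointwise $\mu$-almost everywhere (and $I_nu=0$ if there are no edges from level $n$ to level $n+1$). -/

import Mathlib

open MeasureTheory Filter Topology Set
open scoped ENNReal NNReal

noncomputable section

set_option linter.unusedSectionVars false

/-! ### The metric measure space -/

/-- `μ` is a doubling measure with exponent `Q`: open balls have positive finite measure, and
`μ (B(ξ, t r)) ≤ C t ^ Q μ (B(ξ, r))` for `t ≥ 1`.  (A Borel measure in the sense of Mathlib is the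
same thing as a Borel regular outer measure restricted to the Borel sets.) -/
structure IsDoublingWith {Z : Type*} [MetricSpace Z] [MeasurableSpace Z]
    (μ : Measure Z) (Q : ℝ) : Prop where
  ball_pos : ∀ (ξ : Z) (r : ℝ), 0 < r → 0 < μ (Metric.ball ξ r)
  ball_lt_top : ∀ (ξ : Z) (r : ℝ), μ (Metric.ball ξ r) < ∞
  Q_pos : 0 < Q
  doubling : ∃ C : ℝ, 1 ≤ C ∧ ∀ (ξ : Z) (r t : ℝ), 0 < r → 1 ≤ t →
    μ (Metric.ball ξ (t * r)) ≤ ENNReal.ofReal (C * t ^ Q) * μ (Metric.ball ξ r)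

/-- The space of complex functions that are integrable on bounded measurable sets. -/
def L1loc {Z : Type*} [MetricSpace Z] [MeasurableSpace Z] (μ : Measure Z) :
    Submodule ℂ (Z → ℂ) where
  carrier := {f | ∀ A : Set Z, Bornology.IsBounded A → MeasurableSet A → IntegrableOn f A μ}
  zero_mem' := fun _ _ _ => integrableOn_zero
  add_mem' := fun hf hg A hA hm => (hf A hA hm).add (hg A hA hm)
  smul_mem' := fun c _ hf A hA hm => (hf A hA hm).smul c

/-! ### Hyperbolic fillings -/

/-- A hyperbolic filling of `Z` with vertex set `X`; `level x` is `|x|` and `center x` is `ξ_x`.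

There are two kinds.  If `rooted` is false, then for every integer `n` the centers of the vertices
of level `n` form a maximal family of points with mutual distances at least `2 ^ (-n - 1)`.
If `rooted` is true, then `diam Z = 1`, there are only levels `n ≥ 0`, the level `0` consists of one
vertex, and the previous condition is required for `n ≥ 1` only. -/
structure HyperbolicFilling (Z : Type*) [MetricSpace Z] (X : Type*) where
  rooted : Prop
  level : X → ℤ
  center : X → Z
  separated : ∀ x y, x ≠ y → level x = level y →
    (2 : ℝ) ^ (-level x - 1) ≤ dist (center x) (center y)
  /-- Given `separated`, this is maximality: no point of `Z` can be added. -/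
  maximal : ∀ n : ℤ, (rooted → 1 ≤ n) → ∀ ζ : Z,
    ∃ x, level x = n ∧ dist ζ (center x) < (2 : ℝ) ^ (-n - 1)
  ediam_eq_one : rooted → Metric.ediam (univ : Set Z) = 1
  level_nonneg : rooted → ∀ x, 0 ≤ level x
  root_unique : rooted → ∃! x, level x = 0

/-- The ranges `0 < s < ∞`, `0 < p < ∞`, `0 < q ≤ ∞` of the indices of the sequence spaces. -/
structure Indices where
  s : ℝ
  p : ℝ
  q : ℝ≥0∞
  s_pos : 0 < s
  p_pos : 0 < p
  q_pos : 0 < q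

/-! ### Mixed norms -/

/-- The `ℓ^q` quasi-norm, `0 < q ≤ ∞`, of a family of nonnegative numbers. -/
def lqNorm {ι : Type*} (q : ℝ≥0∞) (a : ι → ℝ≥0∞) : ℝ≥0∞ :=
  if q = ∞ then ⨆ k, a k else (∑' k, a k ^ q.toReal) ^ (1 / q.toReal)

/-- `(∫ ‖{2 ^ (|k| s) w(k) : k with ξ ∈ A(k)}‖_{ℓ^q} ^ p dμ(ξ)) ^ (1 / p)`, for a family `A` of
subsets of `Z` and a family `w` of weights, where `lev k` is `|k|`. -/
def jNorm {Z : Type*} [MeasurableSpace Z] {ι : Type*} (μ : Measure Z) (i : Indices)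
    (lev : ι → ℤ) (A : ι → Set Z) (w : ι → ℝ≥0∞) : ℝ≥0∞ :=
  (∫⁻ ξ, lqNorm i.q (fun k => (A k).indicator
    (fun _ => (2 : ℝ≥0∞) ^ ((lev k : ℝ) * i.s) * w k) ξ) ^ i.p ∂μ) ^ (1 / i.p)

theorem lqNorm_mono {ι : Type*} (q : ℝ≥0∞) {a b : ι → ℝ≥0∞} (h : ∀ k, a k ≤ b k) :
    lqNorm q a ≤ lqNorm q b := by
  unfold lqNorm
  split_ifs
  · exact iSup_mono h
  · gcongr with k
    exact h k

theorem ennreal_add_rpow_le {t : ℝ} (ht : 0 ≤ t) (a b : ℝ≥0∞) :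
    (a + b) ^ t ≤ 2 ^ t * (a ^ t + b ^ t) := by
  have h : ∀ c d : ℝ≥0∞, c ≤ d → (c + d) ^ t ≤ 2 ^ t * d ^ t := by
    intro c d hcd
    rw [← ENNReal.mul_rpow_of_nonneg _ _ ht, two_mul]
    gcongr
  rcases le_total a b with hab | hab
  · exact (h a b hab).trans (by gcongr; exact le_add_self)
  · rw [add_comm]
    exact (h b a hab).trans (by gcongr; exact le_self_add)

theorem lqNorm_add_le {ι : Type*} {q : ℝ≥0∞} (a b : ι → ℝ≥0∞) :
    lqNorm q (fun k => a k + b k) ≤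
      (1 + (2 * 2 ^ q.toReal) ^ (1 / q.toReal)) * (lqNorm q a + lqNorm q b) := by
  have hq : 0 ≤ q.toReal := ENNReal.toReal_nonneg
  have hq' : 0 ≤ 1 / q.toReal := by positivity
  unfold lqNorm
  split_ifs with h
  · calc (⨆ k, a k + b k) ≤ (⨆ k, a k) + ⨆ k, b k :=
          iSup_le fun k => add_le_add (le_iSup a k) (le_iSup b k)
      _ ≤ _ := le_mul_of_one_le_left zero_le le_self_add
  · calc (∑' k, (a k + b k) ^ q.toReal) ^ (1 / q.toReal)
        ≤ (∑' k, 2 ^ q.toReal * (a k ^ q.toReal + b k ^ q.toReal)) ^ (1 / q.toReal) := by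
          gcongr with k
          exact ennreal_add_rpow_le hq _ _
      _ = (2 ^ q.toReal) ^ (1 / q.toReal) *
            (∑' k, a k ^ q.toReal + ∑' k, b k ^ q.toReal) ^ (1 / q.toReal) := by
          rw [ENNReal.tsum_mul_left, ENNReal.tsum_add, ENNReal.mul_rpow_of_nonneg _ _ hq']
      _ ≤ (2 ^ q.toReal) ^ (1 / q.toReal) * (2 ^ (1 / q.toReal) *
            ((∑' k, a k ^ q.toReal) ^ (1 / q.toReal) +
              (∑' k, b k ^ q.toReal) ^ (1 / q.toReal))) := by
          gcongr
          exact ennreal_add_rpow_le hq' _ _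
      _ = (2 * 2 ^ q.toReal) ^ (1 / q.toReal) * _ := by
          rw [ENNReal.mul_rpow_of_nonneg _ _ hq', ← mul_assoc, mul_comm (2 ^ (1 / q.toReal))]
      _ ≤ _ := by gcongr; exact le_add_self

theorem lqNorm_const_mul {ι : Type*} {q : ℝ≥0∞} (hq : 0 < q) (c : ℝ≥0∞) (a : ι → ℝ≥0∞) :
    lqNorm q (fun k => c * a k) = c * lqNorm q a := by
  unfold lqNorm
  split_ifs with h
  · rw [ENNReal.mul_iSup]
  · have h0 : 0 < q.toReal := ENNReal.toReal_pos hq.ne' h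
    have h1 : ∀ k, (c * a k) ^ q.toReal = c ^ q.toReal * a k ^ q.toReal := fun k =>
      ENNReal.mul_rpow_of_nonneg _ _ h0.le
    simp_rw [h1]
    rw [ENNReal.tsum_mul_left, ENNReal.mul_rpow_of_nonneg _ _ (by positivity), ← ENNReal.rpow_mul,
      mul_one_div_cancel h0.ne', ENNReal.rpow_one]

section jNorm

variable {Z : Type*} [MeasurableSpace Z] {ι : Type*} {μ : Measure Z} {i : Indices}
  {lev : ι → ℤ} {A : ι → Set Z}

theorem jNorm_lt_top_iff {w : ι → ℝ≥0∞} : jNorm μ i lev A w < ∞ ↔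
    ∫⁻ ξ, lqNorm i.q (fun k => (A k).indicator
      (fun _ => (2 : ℝ≥0∞) ^ ((lev k : ℝ) * i.s) * w k) ξ) ^ i.p ∂μ < ∞ := by
  have := i.p_pos
  exact ENNReal.rpow_lt_top_iff_of_pos (by positivity)

theorem jNorm_mono {w w' : ι → ℝ≥0∞} (h : ∀ k, w k ≤ w' k) :
    jNorm μ i lev A w ≤ jNorm μ i lev A w' := by
  have := i.p_pos
  unfold jNorm
  gcongr with ξ
  refine lqNorm_mono _ fun k => ?_
  by_cases hk : ξ ∈ A k
  · simp only [indicator_of_mem hk]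
    gcongr
    exact h k
  · simp [indicator_of_notMem hk]

theorem jNorm_add_lt_top [Countable ι] (hA : ∀ k, MeasurableSet (A k)) {w w' : ι → ℝ≥0∞}
    (h : jNorm μ i lev A w < ∞) (h' : jNorm μ i lev A w' < ∞) :
    jNorm μ i lev A (fun k => w k + w' k) < ∞ := by
  have hp := i.p_pos
  have hq := i.q_pos
  rw [jNorm_lt_top_iff] at h h' ⊢
  set a : Z → ι → ℝ≥0∞ := fun ξ k => (A k).indicator
    (fun _ => (2 : ℝ≥0∞) ^ ((lev k : ℝ) * i.s) * w k) ξ with ha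
  set b : Z → ι → ℝ≥0∞ := fun ξ k => (A k).indicator
    (fun _ => (2 : ℝ≥0∞) ^ ((lev k : ℝ) * i.s) * w' k) ξ with hb
  have hmeas : Measurable fun ξ => lqNorm i.q (a ξ) ^ i.p := by
    have hm : ∀ k, Measurable fun ξ => a ξ k := fun k => measurable_const.indicator (hA k)
    refine Measurable.pow_const ?_ _
    unfold lqNorm
    split_ifs
    · exact Measurable.iSup hm
    · exact (Measurable.tsum fun k => (hm k).pow_const _).pow_const _
  set K : ℝ≥0∞ := 1 + (2 * 2 ^ i.q.toReal) ^ (1 / i.q.toReal) with hK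
  have hKtop : K ≠ ∞ := by
    refine ENNReal.add_ne_top.2 ⟨ENNReal.one_ne_top, ?_⟩
    refine ENNReal.rpow_ne_top_of_nonneg (by positivity) (ENNReal.mul_ne_top (by simp) ?_)
    exact ENNReal.rpow_ne_top_of_nonneg (by positivity) (by simp)
  calc _ = ∫⁻ ξ, lqNorm i.q (fun k => a ξ k + b ξ k) ^ i.p ∂μ := by
        congr 1; funext ξ; congr 2; funext k
        simp only [ha, hb]
        by_cases hk : ξ ∈ A k
        · simp only [indicator_of_mem hk, mul_add]
        · simp [indicator_of_notMem hk]
    _ ≤ ∫⁻ ξ, K ^ i.p * (2 ^ i.p * (lqNorm i.q (a ξ) ^ i.p + lqNorm i.q (b ξ) ^ i.p)) ∂μ := by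
        gcongr with ξ
        calc lqNorm i.q (fun k => a ξ k + b ξ k) ^ i.p
            ≤ (K * (lqNorm i.q (a ξ) + lqNorm i.q (b ξ))) ^ i.p := by
              gcongr; exact lqNorm_add_le _ _
          _ = K ^ i.p * (lqNorm i.q (a ξ) + lqNorm i.q (b ξ)) ^ i.p :=
              ENNReal.mul_rpow_of_nonneg _ _ hp.le
          _ ≤ _ := by gcongr; exact ennreal_add_rpow_le hp.le _ _
    _ = K ^ i.p * (2 ^ i.p * (∫⁻ ξ, lqNorm i.q (a ξ) ^ i.p ∂μ +
          ∫⁻ ξ, lqNorm i.q (b ξ) ^ i.p ∂μ)) := by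
        rw [lintegral_const_mul' _ _ (ENNReal.rpow_ne_top_of_nonneg hp.le hKtop),
          lintegral_const_mul' _ _ (ENNReal.rpow_ne_top_of_nonneg hp.le (by simp)),
          lintegral_add_left hmeas]
    _ < ∞ := by
        refine ENNReal.mul_lt_top (ENNReal.rpow_lt_top_of_nonneg hp.le hKtop) ?_
        refine ENNReal.mul_lt_top (ENNReal.rpow_lt_top_of_nonneg hp.le (by simp)) ?_
        exact ENNReal.add_lt_top.2 ⟨h, h'⟩

theorem jNorm_const_mul {c : ℝ≥0∞} (hc : c ≠ ∞) (w : ι → ℝ≥0∞) :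
    jNorm μ i lev A (fun k => c * w k) = c * jNorm μ i lev A w := by
  have hp := i.p_pos
  unfold jNorm
  have h1 : ∀ ξ, lqNorm i.q (fun k => (A k).indicator
      (fun _ => (2 : ℝ≥0∞) ^ ((lev k : ℝ) * i.s) * (c * w k)) ξ) ^ i.p =
      c ^ i.p * lqNorm i.q (fun k => (A k).indicator
      (fun _ => (2 : ℝ≥0∞) ^ ((lev k : ℝ) * i.s) * w k) ξ) ^ i.p := by
    intro ξ
    rw [← ENNReal.mul_rpow_of_nonneg _ _ hp.le, ← lqNorm_const_mul i.q_pos]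
    congr 2; funext k
    by_cases hk : ξ ∈ A k
    · simp only [indicator_of_mem hk]; ring
    · simp [indicator_of_notMem hk]
  simp_rw [h1]
  rw [lintegral_const_mul' _ _ (ENNReal.rpow_ne_top_of_nonneg hp.le hc),
    ENNReal.mul_rpow_of_nonneg _ _ (by positivity), ← ENNReal.rpow_mul,
    mul_one_div_cancel hp.ne', ENNReal.rpow_one]

theorem jNorm_zero : jNorm μ i lev A (fun _ => 0) = 0 := by
  have h := jNorm_const_mul (μ := μ) (i := i) (lev := lev) (A := A) (c := 0) (by simp) (fun _ => 0)
  simpa using h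

end jNorm

namespace HyperbolicFilling

variable {Z : Type*} [MetricSpace Z] {X : Type*} (F : HyperbolicFilling Z X)

/-- The set `B(x)`: the open ball `B(ξ_x, 2 ^ (-|x|))`, but all of `Z` for the root of a rooted
filling. -/
def B (x : X) : Set Z :=
  {ζ | (F.rooted ∧ F.level x = 0) ∨ dist ζ (F.center x) < (2 : ℝ) ^ (-F.level x)}

/-- The graph structure on `X`: different vertices are joined by an edge if and only if their levels
differ by at most one and the corresponding balls intersect. -/
def graph : SimpleGraph X where
  Adj x y := x ≠ y ∧ |F.level x - F.level y| ≤ 1 ∧ (F.B x ∩ F.B y).Nonempty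
  symm := ⟨fun x y h => ⟨h.1.symm, by rw [abs_sub_comm]; exact h.2.1, by
    rw [inter_comm]; exact h.2.2⟩⟩
  loopless := ⟨fun _ h => h.1 rfl⟩

/-- An orientation of the edges of the filling: each edge gets one of its two directions, and edges
between different levels point to the higher level. -/
structure Orientation where
  dir : X → X → Prop
  adj : ∀ {x y}, dir x y → F.graph.Adj x y
  total : ∀ {x y}, F.graph.Adj x y → dir x y ∨ dir y x
  asymm : ∀ {x y}, dir x y → ¬ dir y x
  upward : ∀ {x y}, F.graph.Adj x y → F.level x < F.level y → dir x y

/-- A Lipschitz partition of unity on each level of the filling. -/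
structure PartitionOfUnity where
  toFun : X → Z → ℝ
  nonneg : ∀ x ξ, 0 ≤ toFun x ξ
  support_subset : ∀ x, Function.support (toFun x) ⊆ F.B x
  hasSum_one : ∀ n : ℤ, (F.rooted → 0 ≤ n) → ∀ ξ,
    HasSum (fun x : {x : X // F.level x = n} => toFun x ξ) 1
  lipschitz : ∃ L : ℝ, 0 ≤ L ∧ ∀ x ξ η,
    |toFun x ξ - toFun x η| ≤ L * (2 : ℝ) ^ F.level x * dist ξ η

variable {F}

/-- The set `E` of oriented edges; `e.1.1` is the initial point and `e.1.2` the endpoint of `e`. -/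
def Orientation.Edge (o : F.Orientation) : Type _ := {e : X × X // o.dir e.1 e.2}

/-- The level `|e|` of an edge. -/
def Orientation.edgeLevel (o : F.Orientation) (e : o.Edge) : ℤ :=
  min (F.level e.1.1) (F.level e.1.2)

/-- The set `B(e)` of an edge. -/
def Orientation.edgeB (o : F.Orientation) (e : o.Edge) : Set Z := F.B e.1.1 ∪ F.B e.1.2

/-- The discrete derivative of a function on vertices, as a function on oriented edges. -/
def Orientation.d (o : F.Orientation) (v : X → ℂ) : o.Edge → ℂ := fun e => v e.1.2 - v e.1.1

variable (F)

/-- The pointwise norm `|du|(x) = (∑_{y ∼ x} |u(y) - u(x)| ^ 2) ^ (1 / 2)`. -/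
def dAbs (u : X → ℂ) (x : X) : ℝ≥0∞ :=
  (∑' y : {y : X // F.graph.Adj x y}, ‖u y - u x‖ₑ ^ (2 : ℝ)) ^ (1 / 2 : ℝ)

theorem dAbs_add_le : ∃ K : ℝ≥0∞, K ≠ ∞ ∧ ∀ (u v : X → ℂ) (x : X),
    F.dAbs (u + v) x ≤ K * (F.dAbs u x + F.dAbs v x) := by
  refine ⟨1 + (2 * 2 ^ (2 : ℝ)) ^ (1 / 2 : ℝ), by finiteness, fun u v x => ?_⟩
  have h := lqNorm_add_le (q := 2) (fun y : {y : X // F.graph.Adj x y} => ‖u y - u x‖ₑ)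
    (fun y => ‖v y - v x‖ₑ)
  simp only [lqNorm, ENNReal.ofNat_ne_top, if_false, ENNReal.toReal_ofNat] at h
  refine le_trans ?_ h
  unfold dAbs
  gcongr with y
  have : (u + v) y - (u + v) x = (u y - u x) + (v y - v x) := by simp; ring
  rw [this]
  exact enorm_add_le _ _

theorem dAbs_smul (c : ℂ) (u : X → ℂ) (x : X) : F.dAbs (c • u) x = ‖c‖ₑ * F.dAbs u x := by
  unfold dAbs
  have h : ∀ y : {y : X // F.graph.Adj x y}, ‖(c • u) y - (c • u) x‖ₑ ^ (2 : ℝ) =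
      ‖c‖ₑ ^ (2 : ℝ) * ‖u y - u x‖ₑ ^ (2 : ℝ) := by
    intro y
    rw [← ENNReal.mul_rpow_of_nonneg _ _ (by norm_num), ← enorm_mul]
    simp [mul_sub]
  simp_rw [h]
  rw [ENNReal.tsum_mul_left, ENNReal.mul_rpow_of_nonneg _ _ (by norm_num), ← ENNReal.rpow_mul]
  norm_num

theorem measurableSet_B [MeasurableSpace Z] [BorelSpace Z] (x : X) : MeasurableSet (F.B x) := by
  by_cases h : F.rooted ∧ F.level x = 0
  · have : F.B x = univ := by ext; simp [B, h]
    rw [this]; exact MeasurableSet.univ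
  · have : F.B x = Metric.ball (F.center x) ((2 : ℝ) ^ (-F.level x)) := by
      ext ζ; simp only [B, h, false_or, Metric.ball]
    rw [this]; exact measurableSet_ball

theorem isBounded_B (x : X) : Bornology.IsBounded (F.B x) := by
  by_cases h : F.rooted ∧ F.level x = 0
  · refine Bornology.IsBounded.subset ?_ (subset_univ _)
    rw [Metric.isBounded_iff_ediam_ne_top, F.ediam_eq_one h.1]
    simp
  · have : F.B x = Metric.ball (F.center x) ((2 : ℝ) ^ (-F.level x)) := by
      ext ζ; simp only [B, h, false_or, Metric.ball]
    rw [this]; exact Metric.isBounded_ball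

end HyperbolicFilling

section Measure

variable {Z : Type*} [MetricSpace Z] [MeasurableSpace Z] [BorelSpace Z]
  {μ : Measure Z} {Q : ℝ} {X : Type*}

theorem HyperbolicFilling.countable (F : HyperbolicFilling Z X) (hμ : IsDoublingWith μ Q) :
    Countable X := by
  rcases isEmpty_or_nonempty X with hX | ⟨⟨x₀⟩⟩
  · infer_instance
  have : SigmaFinite μ := ⟨⟨
    { set := fun n : ℕ => Metric.ball (F.center x₀) n
      set_mem := fun _ => trivial
      finite := fun n => hμ.ball_lt_top _ _
      spanning := Metric.iUnion_ball_nat _ }⟩⟩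
  have key : ∀ n : ℤ, Countable {x : X // F.level x = n} := by
    intro n
    have hdisj : Pairwise (Function.onFun Disjoint
        fun x : {x : X // F.level x = n} => Metric.ball (F.center x) ((2 : ℝ) ^ (-n - 2))) := by
      intro x y hxy
      refine Metric.ball_disjoint_ball ?_
      have h := F.separated x y (fun h => hxy (Subtype.ext h)) (x.2.trans y.2.symm)
      rw [x.2] at h
      refine le_trans (le_of_eq ?_) h
      rw [show -n - 1 = (-n - 2) + 1 by ring, zpow_add_one₀ (by norm_num)]
      ring
    have := Measure.countable_meas_pos_of_disjoint_iUnion (μ := μ)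
      (fun x : {x : X // F.level x = n} => measurableSet_ball) hdisj
    refine Set.countable_univ_iff.1 (this.mono fun x _ => ?_)
    exact hμ.ball_pos _ _ (by positivity)
  have : Countable (Σ n : ℤ, {x : X // F.level x = n}) := inferInstance
  exact Function.Injective.countable (f := fun x : X =>
    (⟨F.level x, x, rfl⟩ : Σ n : ℤ, {x : X // F.level x = n})) fun x y h => by
      have h2 := congrArg (fun t : Σ n : ℤ, {x : X // F.level x = n} => (t.2 : X)) h
      exact h2

namespace HyperbolicFilling

/-! ### The sequence space on the edges -/

/-- The quasi-norm of the sequence space `J^s_{p,q}(E)`. -/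
def Orientation.edgeNorm {F : HyperbolicFilling Z X} (o : F.Orientation) (μ : Measure Z)
    (i : Indices) (u : o.Edge → ℂ) : ℝ≥0∞ :=
  jNorm μ i o.edgeLevel o.edgeB (fun e => ‖u e‖ₑ)

/-- The sequence space `J^s_{p,q}(E)`. -/
def Orientation.edgeSpace {F : HyperbolicFilling Z X} (o : F.Orientation)
    (hμ : IsDoublingWith μ Q) (i : Indices) : Submodule ℂ (o.Edge → ℂ) where
  carrier := {u | o.edgeNorm μ i u < ∞}
  zero_mem' := by
    have h := jNorm_zero (μ := μ) (i := i) (lev := o.edgeLevel) (A := o.edgeB)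
    simp [Orientation.edgeNorm, h]
  add_mem' := by
    intro u v hu hv
    have : Countable X := F.countable hμ
    have : Countable o.Edge := Subtype.countable
    exact (jNorm_mono fun e => enorm_add_le (u e) (v e)).trans_lt
      (jNorm_add_lt_top (fun e => (F.measurableSet_B _).union (F.measurableSet_B _)) hu hv)
  smul_mem' := by
    intro c u hu
    have h : o.edgeNorm μ i (c • u) = ‖c‖ₑ * o.edgeNorm μ i u := by
      unfold Orientation.edgeNorm
      rw [← jNorm_const_mul (by simp)]
      simp
    change o.edgeNorm μ i (c • u) < ∞
    rw [h]
    exact ENNReal.mul_lt_top (by simp) hu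

/-! ### The Triebel-Lizorkin space -/

variable (F : HyperbolicFilling Z X)

/-- The Poisson extension of `f`. -/
def poisson (μ : Measure Z) (f : Z → ℂ) : X → ℂ := fun x => ⨍ η in F.B x, f η ∂μ

/-- The quasi-norm `‖d(Pf)‖_{J^s_{p,q}(X)}`. -/
def tlNorm (μ : Measure Z) (i : Indices) (f : Z → ℂ) : ℝ≥0∞ :=
  jNorm μ i F.level F.B (F.dAbs (F.poisson μ f))

theorem poisson_smul (c : ℂ) (f : Z → ℂ) :
    F.poisson μ (c • f) = c • F.poisson μ f := by
  funext x
  simp only [poisson, Pi.smul_apply, setAverage_eq, integral_smul]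
  rw [smul_comm]

theorem poisson_add {f g : Z → ℂ} (hf : f ∈ L1loc μ) (hg : g ∈ L1loc μ) :
    F.poisson μ (f + g) = F.poisson μ f + F.poisson μ g := by
  funext x
  simp only [poisson, Pi.add_apply, setAverage_eq]
  rw [integral_add (hf _ (F.isBounded_B x) (F.measurableSet_B x))
    (hg _ (F.isBounded_B x) (F.measurableSet_B x)), smul_add]

/-- The Triebel-Lizorkin space, as a space of functions. -/
def tlSpace (hμ : IsDoublingWith μ Q) (i : Indices) : Submodule ℂ (Z → ℂ) where
  carrier := {f | f ∈ L1loc μ ∧ F.tlNorm μ i f < ∞}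
  zero_mem' := by
    refine ⟨zero_mem _, ?_⟩
    have h : F.dAbs (F.poisson μ (0 : Z → ℂ)) = fun _ => 0 := by
      funext x
      have := F.dAbs_smul 0 0 x
      have h0 : F.poisson μ (0 : Z → ℂ) = 0 := by funext x; simp [poisson]
      simpa [h0] using this
    rw [tlNorm, h, jNorm_zero]
    simp
  add_mem' := by
    rintro f g ⟨hf, hf'⟩ ⟨hg, hg'⟩
    refine ⟨add_mem hf hg, ?_⟩
    have : Countable X := F.countable hμ
    rw [tlNorm, F.poisson_add hf hg]
    obtain ⟨K, hK, h⟩ := F.dAbs_add_le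
    refine (jNorm_mono (h _ _)).trans_lt ?_
    rw [jNorm_const_mul hK]
    exact ENNReal.mul_lt_top hK.lt_top (jNorm_add_lt_top F.measurableSet_B hf' hg')
  smul_mem' := by
    rintro c f ⟨hf, hf'⟩
    refine ⟨Submodule.smul_mem _ c hf, ?_⟩
    rw [tlNorm, F.poisson_smul]
    have h : F.dAbs (c • F.poisson μ f) = fun x => ‖c‖ₑ * F.dAbs (F.poisson μ f) x := by
      funext x; exact F.dAbs_smul _ _ x
    rw [h, jNorm_const_mul (by simp)]
    exact ENNReal.mul_lt_top (by simp) hf'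

/-- The elements of the Triebel-Lizorkin space that are constant almost everywhere. -/
def aeConst (hμ : IsDoublingWith μ Q) (i : Indices) : Submodule ℂ (F.tlSpace hμ i) where
  carrier := {f | ∃ c : ℂ, ∀ᵐ ξ ∂μ, (f : Z → ℂ) ξ = c}
  zero_mem' := ⟨0, by simp⟩
  add_mem' := by
    rintro f g ⟨c, hc⟩ ⟨c', hc'⟩
    refine ⟨c + c', ?_⟩
    filter_upwards [hc, hc'] with ξ h h'
    simp [h, h']
  smul_mem' := by
    rintro a f ⟨c, hc⟩
    refine ⟨a * c, ?_⟩
    filter_upwards [hc] with ξ h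
    simp [h]

/-- The quasi-normed space `F^s_{p,q}(Z)`: Triebel-Lizorkin functions modulo functions that are
constant almost everywhere. -/
abbrev TL (hμ : IsDoublingWith μ Q) (i : Indices) : Type _ :=
  F.tlSpace hμ i ⧸ F.aeConst hμ i

/-- The class of a Triebel-Lizorkin function. -/
abbrev tlClass (hμ : IsDoublingWith μ Q) (i : Indices) : F.tlSpace hμ i →ₗ[ℂ] F.TL hμ i :=
  (F.aeConst hμ i).mkQ

theorem tlNorm_congr (hμ : IsDoublingWith μ Q) (i : Indices) (f g : F.tlSpace hμ i)
    (h : f - g ∈ F.aeConst hμ i) : F.tlNorm μ i f = F.tlNorm μ i g := by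
  obtain ⟨c, hc⟩ := h
  have hP : ∀ x, F.poisson μ (f : Z → ℂ) x = F.poisson μ (g : Z → ℂ) x +
      ⨍ _ in F.B x, c ∂μ := by
    intro x
    have hB : μ (F.B x) ≠ ∞ := by
      obtain ⟨r, hr⟩ := (F.isBounded_B x).subset_ball (F.center x)
      exact ((measure_mono hr).trans_lt (hμ.ball_lt_top _ _)).ne
    simp only [poisson, setAverage_eq]
    rw [← smul_add, ← integral_add (g.2.1 _ (F.isBounded_B x) (F.measurableSet_B x))
      (integrableOn_const hB)]
    congr 1
    refine integral_congr_ae (ae_restrict_of_ae ?_)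
    filter_upwards [hc] with ξ hξ
    simp only [Submodule.coe_sub, Pi.sub_apply] at hξ
    rw [← hξ]; ring
  have hc' : ∀ x, (⨍ _ in F.B x, c ∂μ) = c := by
    intro x
    refine setAverage_const ?_ ?_ c
    · have : (Metric.ball (F.center x) ((2 : ℝ) ^ (-F.level x))) ⊆ F.B x := fun ζ hζ => Or.inr hζ
      exact ((hμ.ball_pos _ _ (by positivity)).trans_le (measure_mono this)).ne'
    · obtain ⟨r, hr⟩ := (F.isBounded_B x).subset_ball (F.center x)
      exact ((measure_mono hr).trans_lt (hμ.ball_lt_top _ _)).ne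
  have : F.dAbs (F.poisson μ (f : Z → ℂ)) = F.dAbs (F.poisson μ (g : Z → ℂ)) := by
    funext x
    simp only [dAbs, hP, hc', add_sub_add_right_eq_sub]
  rw [tlNorm, tlNorm, this]

/-- The quasi-norm on `F^s_{p,q}(Z)`. -/
def TLnorm (hμ : IsDoublingWith μ Q) (i : Indices) (a : F.TL hμ i) : ℝ≥0∞ :=
  Quotient.liftOn' a (fun f => F.tlNorm μ i f) fun f g h =>
    F.tlNorm_congr hμ i f g ((Submodule.quotientRel_def _).1 h)

end HyperbolicFilling

end Measure

namespace HyperbolicFilling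

variable {Z : Type*} [MetricSpace Z] {X : Type*} {F : HyperbolicFilling Z X}

/-- `I_n u = ∑ u(e_{y,y'}) ψ_y ψ_{y'}` over the edges from a vertex `y` of level `n` to a vertex
`y'` of level `n + 1`; at every point only finitely many terms are nonzero. -/
def levelSum (o : F.Orientation) (ψ : F.PartitionOfUnity) (u : o.Edge → ℂ) (n : ℤ) (ξ : Z) : ℂ :=
  ∑' e : {e : o.Edge // F.level e.1.1 = n ∧ F.level e.1.2 = n + 1},
    u e.1 * (ψ.toFun e.1.1.1 ξ : ℂ) * (ψ.toFun e.1.1.2 ξ : ℂ)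

/-- `∑_{n = -N}^{N} I_n u(ξ) - ∑_{n = -N}^{-1} I_n u(ξ₀)`. -/
def integralApprox (o : F.Orientation) (ψ : F.PartitionOfUnity) (ξ₀ : Z) (u : o.Edge → ℂ)
    (N : ℕ) (ξ : Z) : ℂ :=
  ∑ n ∈ Finset.Icc (-N : ℤ) N, levelSum o ψ u n ξ -
    ∑ n ∈ Finset.Icc (-N : ℤ) (-1), levelSum o ψ u n ξ₀

end HyperbolicFilling

end

noncomputable section

set_option linter.unusedSectionVars false

/-! ### Geometric weights -/

/-! Boundedness of `S` is elementary: on each ball making up `B(e)`, the value of `dv` at `e` is at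
most `|dv|` at the corresponding endpoint, and valence is bounded (`edgeNorm_d_le`).

For `R`, fix `r` with `Q/(Q+s) < r ≤ 1`, `r < p`, `r < q`; the lower bound means `Q(1/r - 1) < s`.
Let `b_n(ξ)` be the largest `|u(e)|` over edges `e` that go from a vertex `x` of level `n` with `ξ ∈
B(x)` to level `n + 1` (`levelSup` of `upWeight`). Then `|I_n u| ≤ b_n`, and `|I_n u(η) - I_n u(ζ)|`
is bounded by a constant times `2^n d(η,ζ) (b_n(η) + b_n(ζ))`. On a ball of radius about `2^(-m)`
the levels `n < m` therefore contribute to the oscillation, after multiplication by `2^(ms)`, at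
most `2^((n-m)(1-s))` times the size of `2^(ns) b_n`. The levels `n ≥ m` are estimated in mean.
Doubling bounds an average of `b_n` by an `r`-average at the cost `2^((n-m)Q(1/r-1))`, and the
factor `2^(-(n-m)s)` more than compensates for it. Hence `2^(ms) |d(P(Ru))|(x)` is controlled at
every point of `B(x)` by `oscSum`, a sum over `n` of terms `(M_{min(m,n)} (2^(ns) b_n)^r)^(1/r)`
with weights `2^(-ε|n-m|)`, where `M_k` is the maximal operator over enlarged balls of level `k`
(`dAbs_poisson_edgeIntegral_le`).

The norm of `oscSum` is estimated by a Fefferman-Stein inequality for the operators `M_k` with the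
exponents `p/r > 1` and `q/r > 1` (`lintegral_lqNorm_levelMax_le`). It follows from a Vitali
covering argument, duality and, when the integral exponent is the smaller one, a reweighting
combined with Hölder's inequality. The same local estimates give convergence of the integrated
series almost everywhere and in `L1loc`.

Finally, since the functions `ψ` sum to one on each level, `I_n (dv)` is the difference of the
interpolations of `v` on the levels `n + 1` and `n`. The partial sums telescope; for `v = Pf` the
fine end tends to `f` by Lebesgue differentiation, and the oscillation of the coarse end tends to
zero (`exists_edgeIntegral_d_poisson_eq`). -/

/-- The weight `2 ^ (-|k| ε)`. -/
def geomWeight (ε : ℝ) (k : ℤ) : ℝ≥0∞ := (2 : ℝ≥0∞) ^ (-(|k| : ℝ) * ε)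

theorem geomWeight_rpow (ε θ : ℝ) (k : ℤ) : geomWeight ε k ^ θ = geomWeight (ε * θ) k := by
  unfold geomWeight
  rw [← ENNReal.rpow_mul]; congr 1; ring

theorem geomWeight_mul (ε δ : ℝ) (k : ℤ) :
    geomWeight ε k * geomWeight δ k = geomWeight (ε + δ) k := by
  unfold geomWeight
  rw [← ENNReal.rpow_add _ _ (by simp) (by simp)]; congr 1; ring

theorem geomWeight_anti {ε δ : ℝ} (h : ε ≤ δ) (k : ℤ) : geomWeight δ k ≤ geomWeight ε k := by
  unfold geomWeight
  refine ENNReal.rpow_le_rpow_of_exponent_le (by norm_num) ?_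
  have : (0 : ℝ) ≤ |(k : ℝ)| := abs_nonneg _
  nlinarith

theorem tsum_geomWeight_ne_top {ε : ℝ} (hε : 0 < ε) : ∑' k : ℤ, geomWeight ε k ≠ ∞ := by
  have h1 : (2 : ℝ≥0∞) ^ (-ε) < 1 := by
    rw [ENNReal.rpow_neg]
    exact ENNReal.inv_lt_one.2 (ENNReal.one_lt_rpow (by norm_num) hε)
  have hg : ∑' n : ℕ, ((2 : ℝ≥0∞) ^ (-ε)) ^ n ≠ ∞ := by
    rw [ENNReal.tsum_geometric]
    exact ENNReal.inv_ne_top.2 (tsub_pos_of_lt h1).ne'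
  have e1 : ∀ n : ℕ, geomWeight ε (n : ℤ) = ((2 : ℝ≥0∞) ^ (-ε)) ^ n := by
    intro n
    rw [← ENNReal.rpow_natCast, ← ENNReal.rpow_mul]
    unfold geomWeight
    congr 1; simp; ring
  have e2 : ∀ n : ℕ, geomWeight ε (-((n : ℤ) + 1)) ≤ ((2 : ℝ≥0∞) ^ (-ε)) ^ n := by
    intro n
    rw [← e1]
    unfold geomWeight
    refine ENNReal.rpow_le_rpow_of_exponent_le (by norm_num) ?_
    push_cast
    rw [abs_neg, abs_of_nonneg (by positivity), abs_of_nonneg (by positivity)]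
    nlinarith
  rw [tsum_of_nat_of_neg_add_one ENNReal.summable ENNReal.summable]
  refine ENNReal.add_ne_top.2 ⟨?_, ?_⟩
  · simp_rw [e1]; exact hg
  · exact ne_top_of_le_ne_top hg (ENNReal.tsum_le_tsum e2)

theorem tsum_geomWeight_sub_ne_top {ε : ℝ} (hε : 0 < ε) (m : ℤ) :
    ∑' n : ℤ, geomWeight ε (n - m) ≠ ∞ := by
  rw [show ∑' n : ℤ, geomWeight ε (n - m) = ∑' n : ℤ, geomWeight ε n from
    (Equiv.subRight m).tsum_eq (geomWeight ε)]
  exact tsum_geomWeight_ne_top hε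

theorem iSup_rpow_le_tsum {ι : Type*} {θ : ℝ} (hθ : 0 < θ) (f : ι → ℝ≥0∞) :
    (⨆ k, f k) ^ θ ≤ ∑' k, f k ^ θ := by
  have : (⨆ k, f k) ≤ (∑' k, f k ^ θ) ^ θ⁻¹ := by
    refine iSup_le fun k => ?_
    rw [ENNReal.le_rpow_inv_iff hθ]
    exact ENNReal.le_tsum k
  rwa [ENNReal.le_rpow_inv_iff hθ] at this

/-- Half of the decay pays for the summation and half stays under the supremum. This exchange of sum
and supremum serves all powers `θ > 0` at once, with no distinction between `θ ≤ 1` and `θ ≥ 1`. -/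
theorem tsum_geomWeight_mul_le {ε : ℝ} (v : ℤ → ℝ≥0∞) :
    ∑' k, geomWeight ε k * v k ≤
      (∑' k, geomWeight (ε / 2) k) * ⨆ k, geomWeight (ε / 2) k * v k := by
  rw [← ENNReal.tsum_mul_right]
  refine ENNReal.tsum_le_tsum fun k => ?_
  have : geomWeight ε k = geomWeight (ε / 2) k * geomWeight (ε / 2) k := by
    rw [geomWeight_mul]; congr 1; ring
  rw [this, mul_assoc]
  gcongr
  exact le_iSup (fun k => geomWeight (ε / 2) k * v k) k

theorem tsum_geomWeight_mul_rpow_le {ε θ : ℝ} (hε : 0 < ε) (hθ : 0 < θ) :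
    ∃ C : ℝ≥0∞, C ≠ ∞ ∧ ∀ v : ℤ → ℝ≥0∞, (∑' k, geomWeight ε k * v k) ^ θ ≤
      C * ∑' k, geomWeight (ε / 2 * θ) k * v k ^ θ := by
  refine ⟨(∑' k, geomWeight (ε / 2) k) ^ θ,
    ENNReal.rpow_ne_top_of_nonneg hθ.le (tsum_geomWeight_ne_top (by positivity)), fun v => ?_⟩
  calc _ ≤ ((∑' k, geomWeight (ε / 2) k) * ⨆ k, geomWeight (ε / 2) k * v k) ^ θ := by
        gcongr; exact tsum_geomWeight_mul_le v
    _ = (∑' k, geomWeight (ε / 2) k) ^ θ * (⨆ k, geomWeight (ε / 2) k * v k) ^ θ :=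
        ENNReal.mul_rpow_of_nonneg _ _ hθ.le
    _ ≤ _ := by
        gcongr
        refine (iSup_rpow_le_tsum hθ _).trans_eq ?_
        congr 1; funext k
        rw [ENNReal.mul_rpow_of_nonneg _ _ hθ.le, geomWeight_rpow]

/-! ### Mixed norms -/

section lq

variable {ι κ : Type*} {q : ℝ≥0∞}

theorem le_lqNorm (hq : 0 < q) (a : ι → ℝ≥0∞) (k : ι) : a k ≤ lqNorm q a := by
  unfold lqNorm
  split_ifs with h
  · exact le_iSup a k
  · have h0 : 0 < q.toReal := ENNReal.toReal_pos hq.ne' h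
    rw [one_div, ENNReal.le_rpow_inv_iff h0]
    exact ENNReal.le_tsum (f := fun k => a k ^ q.toReal) k

theorem iSup_le_lqNorm (hq : 0 < q) (a : ι → ℝ≥0∞) : ⨆ k, a k ≤ lqNorm q a :=
  iSup_le (le_lqNorm hq a)

/-- A charging argument: every nonzero `a k` is charged to some `b j`, and no `j` is charged more
than `N` times. -/
theorem lqNorm_le_of_rel (hq : 0 < q) {a : ι → ℝ≥0∞} {b : κ → ℝ≥0∞} (r : ι → κ → Prop) {N : ℕ}
    (h : ∀ k, a k ≠ 0 → ∃ j, r k j ∧ a k ≤ b j)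
    (hN : ∀ j, {k | r k j}.encard ≤ N) :
    lqNorm q a ≤ (N : ℝ≥0∞) ^ (1 / q.toReal) * lqNorm q b := by
  classical
  unfold lqNorm
  split_ifs with hq'
  -- For `q = ∞` the conventions `∞.toReal = 0` and `1 / 0 = 0` turn the constant into `N ^ 0 = 1`.
  · simp only [hq', ENNReal.toReal_top, div_zero, ENNReal.rpow_zero, one_mul]
    refine iSup_le fun k => ?_
    by_cases hk : a k = 0
    · simp [hk]
    · obtain ⟨j, -, hj⟩ := h k hk
      exact hj.trans (le_iSup b j)
  · have h0 : 0 < q.toReal := ENNReal.toReal_pos hq.ne' hq'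
    rw [← ENNReal.mul_rpow_of_nonneg _ _ (by positivity)]
    gcongr
    calc ∑' k, a k ^ q.toReal ≤ ∑' k, ∑' j, {k | r k j}.indicator (fun _ => b j ^ q.toReal) k := by
          refine ENNReal.tsum_le_tsum fun k => ?_
          by_cases hk : a k = 0
          · simp [hk, ENNReal.zero_rpow_of_pos h0]
          · obtain ⟨j, hj, hj'⟩ := h k hk
            refine le_trans ?_ (ENNReal.le_tsum j)
            rw [indicator_of_mem (by exact hj)]
            gcongr
      _ = ∑' j, ∑' k, {k | r k j}.indicator (fun _ => b j ^ q.toReal) k := ENNReal.tsum_comm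
      _ ≤ ∑' j, N * b j ^ q.toReal := by
          refine ENNReal.tsum_le_tsum fun j => ?_
          rw [← tsum_subtype, ENNReal.tsum_set_const]
          gcongr
          have := hN j
          calc (({k | r k j}.encard : ℕ∞) : ℝ≥0∞) ≤ ((N : ℕ∞) : ℝ≥0∞) := by
                exact_mod_cast this
            _ = N := by simp
      _ = _ := ENNReal.tsum_mul_left

/-- The fibres of `φ` are disjoint and a supremum over a fibre is at most the sum, so no
multiplicity is lost. It serves to pass from edges to levels. -/
theorem lqNorm_iSup_fiber_le (hq : 0 < q) (φ : ι → κ) {a : κ → ℝ≥0∞} {c : ι → ℝ≥0∞}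
    (h : ∀ j, a j ≤ ⨆ (k : ι) (_ : φ k = j), c k) : lqNorm q a ≤ lqNorm q c := by
  unfold lqNorm
  split_ifs with hq'
  · exact iSup_le fun j => (h j).trans (iSup₂_le fun k _ => le_iSup c k)
  · have h0 : 0 < q.toReal := ENNReal.toReal_pos hq.ne' hq'
    gcongr
    calc ∑' j, a j ^ q.toReal ≤ ∑' j, ∑' k : {k // φ k = j}, c k ^ q.toReal := by
          refine ENNReal.tsum_le_tsum fun j => ?_
          refine le_trans ?_ (iSup_rpow_le_tsum h0 _)
          gcongr
          refine (h j).trans (iSup₂_le fun k hk => ?_)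
          exact le_iSup (fun k : {k // φ k = j} => c k) ⟨k, hk⟩
      _ = ∑' p : (Σ j, {k // φ k = j}), c p.2 ^ q.toReal :=
          (ENNReal.tsum_sigma fun j (k : {k // φ k = j}) => c k ^ q.toReal).symm
      _ = ∑' k, c k ^ q.toReal :=
          (Equiv.sigmaFiberEquiv φ).tsum_eq fun k => c k ^ q.toReal

/-- This rescaling replaces the exponents `p`, `q`, which may lie below 1, with `p/r`, `q/r > 1`,
for which maximal inequalities hold. -/
theorem lqNorm_rpow {r : ℝ} (hr : 0 < r) (a : ι → ℝ≥0∞) :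
    lqNorm q (fun k => a k ^ (1 / r)) = lqNorm (q / ENNReal.ofReal r) a ^ (1 / r) := by
  have hr0 : ENNReal.ofReal r ≠ 0 := by simpa using hr
  unfold lqNorm
  by_cases hq' : q = ∞
  · subst hq'
    simp only [if_true, ENNReal.top_div_of_ne_top ENNReal.ofReal_ne_top]
    exact ((ENNReal.orderIsoRpow (1 / r) (by positivity)).map_iSup a).symm
  · have : q / ENNReal.ofReal r ≠ ∞ := ENNReal.div_ne_top hq' hr0
    simp only [hq', this, if_false]
    rw [ENNReal.toReal_div, ENNReal.toReal_ofReal hr.le]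
    simp_rw [← ENNReal.rpow_mul]
    congr 1
    · congr 1; funext k; congr 1; ring
    · field_simp

theorem lqNorm_equiv (e : κ ≃ ι) (a : ι → ℝ≥0∞) : lqNorm q (fun k => a (e k)) = lqNorm q a := by
  unfold lqNorm
  split_ifs
  · exact e.iSup_comp (g := a)
  · rw [e.tsum_eq fun k => a k ^ q.toReal]

theorem measurable_lqNorm {Z : Type*} [MeasurableSpace Z] [Countable ι] {a : Z → ι → ℝ≥0∞}
    (ha : ∀ k, Measurable fun ξ => a ξ k) : Measurable fun ξ => lqNorm q (a ξ) := by
  unfold lqNorm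
  split_ifs
  · exact Measurable.iSup ha
  · exact (Measurable.tsum fun k => (ha k).pow_const _).pow_const _

/-- A geometrically weighted sum of sequences is controlled in the `ℓ^q` quasi-norm, raised to any
power. -/
theorem lqNorm_tsum_geomWeight_rpow_le (hq : 0 < q) {ε p : ℝ} (hε : 0 < ε) (hp : 0 < p) :
    ∃ C : ℝ≥0∞, C ≠ ∞ ∧ ∃ δ : ℝ, 0 < δ ∧ ∀ v : ℤ → ι → ℝ≥0∞,
      lqNorm q (fun m => ∑' k, geomWeight ε k * v k m) ^ p ≤
        C * ∑' k, geomWeight δ k * lqNorm q (v k) ^ p := by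
  by_cases hq' : q = ∞
  · obtain ⟨C, hC, h⟩ := tsum_geomWeight_mul_rpow_le hε hp
    refine ⟨C, hC, ε / 2 * p, by positivity, fun v => le_trans ?_ (h fun k => lqNorm q (v k))⟩
    gcongr
    unfold lqNorm
    simp only [hq', if_true]
    refine iSup_le fun m => ENNReal.tsum_le_tsum fun k => ?_
    gcongr
    exact le_iSup (v k) m
  · have h0 : 0 < q.toReal := ENNReal.toReal_pos hq.ne' hq'
    set ρ := q.toReal with hρ
    -- The scalar inequality is used twice: with power `ρ` for each index `m`, and, after the sums
    -- over `k` and `m` are interchanged, with power `p / ρ` outside.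
    obtain ⟨C, hC, h⟩ := tsum_geomWeight_mul_rpow_le hε h0
    obtain ⟨C', hC', h'⟩ := tsum_geomWeight_mul_rpow_le (ε := ε / 2 * ρ) (θ := p / ρ)
      (by positivity) (by positivity)
    refine ⟨C ^ (p / ρ) * C', ENNReal.mul_ne_top (ENNReal.rpow_ne_top_of_nonneg (by positivity) hC)
      hC', ε / 2 * ρ / 2 * (p / ρ), by positivity, fun v => ?_⟩
    calc lqNorm q (fun m => ∑' k, geomWeight ε k * v k m) ^ p
        = (∑' m, (∑' k, geomWeight ε k * v k m) ^ ρ) ^ (p / ρ) := by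
          unfold lqNorm
          rw [if_neg hq', ← ENNReal.rpow_mul, ← hρ]
          congr 1; ring
      _ ≤ (∑' m, C * ∑' k, geomWeight (ε / 2 * ρ) k * v k m ^ ρ) ^ (p / ρ) := by
          gcongr with m
          exact h fun k => v k m
      _ = C ^ (p / ρ) * (∑' k, geomWeight (ε / 2 * ρ) k * ∑' m, v k m ^ ρ) ^ (p / ρ) := by
          rw [ENNReal.tsum_mul_left, ENNReal.mul_rpow_of_nonneg _ _ (by positivity),
            ENNReal.tsum_comm]
          simp_rw [ENNReal.tsum_mul_left]
      _ ≤ C ^ (p / ρ) * (C' * ∑' k, geomWeight (ε / 2 * ρ / 2 * (p / ρ)) k *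
            (∑' m, v k m ^ ρ) ^ (p / ρ)) := by
          gcongr
          exact h' _
      _ = _ := by
          rw [mul_assoc]
          congr 3; funext k
          unfold lqNorm
          rw [if_neg hq', ← ENNReal.rpow_mul, ← hρ, one_div_mul_eq_div]

end lq

/-! ### Geometry of hyperbolic fillings -/

theorem two_zpow_mono {a b : ℤ} (h : a ≤ b) : (2 : ℝ) ^ a ≤ 2 ^ b :=
  zpow_le_zpow_right₀ (by norm_num) h

theorem two_zpow_add_one (a : ℤ) : (2 : ℝ) ^ (a + 1) = 2 * 2 ^ a := by
  rw [zpow_add_one₀ (by norm_num)]; ring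

theorem two_zpow_pos (a : ℤ) : (0 : ℝ) < 2 ^ a := by positivity

theorem two_zpow_neg_le {m n : ℤ} (h : m - 1 ≤ n) : (2 : ℝ) ^ (-n) ≤ 2 * 2 ^ (-m) := by
  rw [← two_zpow_add_one]; exact two_zpow_mono (by omega)

namespace HyperbolicFilling

variable {Z : Type*} [MetricSpace Z] {X : Type*} (F : HyperbolicFilling Z X)

/-- The ball with the center of `x` and `K` times the radius belonging to its level. -/
def ballAt (K : ℝ) (x : X) : Set Z := Metric.ball (F.center x) (K * (2 : ℝ) ^ (-F.level x))

theorem mem_ballAt {K : ℝ} {x : X} {ξ : Z} :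
    ξ ∈ F.ballAt K x ↔ dist ξ (F.center x) < K * (2 : ℝ) ^ (-F.level x) := Iff.rfl

theorem ballAt_mono {K K' : ℝ} (h : K ≤ K') (x : X) : F.ballAt K x ⊆ F.ballAt K' x :=
  Metric.ball_subset_ball (by have := two_zpow_pos (-F.level x); gcongr)

theorem ballAt_one_subset_B (x : X) : F.ballAt 1 x ⊆ F.B x := fun ζ hζ =>
  Or.inr (by simpa [mem_ballAt] using hζ)

theorem center_mem_B (x : X) : F.center x ∈ F.B x :=
  F.ballAt_one_subset_B x (by rw [mem_ballAt, dist_self, one_mul]; exact two_zpow_pos _)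

theorem dist_le_one_of_rooted (h : F.rooted) (ξ η : Z) : dist ξ η ≤ 1 := by
  have h1 : edist ξ η ≤ 1 := by
    rw [← F.ediam_eq_one h]; exact Metric.edist_le_ediam_of_mem (mem_univ _) (mem_univ _)
  rw [edist_dist] at h1
  simpa using ENNReal.ofReal_le_iff_le_toReal (by simp) |>.1 h1

/-- The factor 2 is for the root: its set is all of `Z`, which may contain points at distance
exactly 1 from the center. -/
theorem B_subset_ballAt_two (x : X) : F.B x ⊆ F.ballAt 2 x := by
  rintro ζ (⟨h, h0⟩ | h)
  · rw [mem_ballAt, h0]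
    have := F.dist_le_one_of_rooted h ζ (F.center x)
    norm_num; linarith
  · rw [mem_ballAt]
    have := two_zpow_pos (-F.level x)
    linarith

theorem isOpen_ballAt (K : ℝ) (x : X) : IsOpen (F.ballAt K x) := Metric.isOpen_ball

theorem isBounded_ballAt (K : ℝ) (x : X) : Bornology.IsBounded (F.ballAt K x) :=
  Metric.isBounded_ball

/-- The levels that occur in the filling. -/
def Admissible (n : ℤ) : Prop := F.rooted → 0 ≤ n

theorem admissible_level (x : X) : F.Admissible (F.level x) := fun h => F.level_nonneg h x

variable {F}

theorem Admissible.mono {m n : ℤ} (h : F.Admissible m) (hmn : m ≤ n) : F.Admissible n :=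
  fun hr => (h hr).trans hmn

theorem Admissible.exists_mem_B {n : ℤ} (h : F.Admissible n) (ξ : Z) :
    ∃ x, F.level x = n ∧ ξ ∈ F.B x := by
  by_cases h1 : F.rooted → 1 ≤ n
  · obtain ⟨x, hx, hd⟩ := F.maximal n h1 ξ
    refine ⟨x, hx, Or.inr (hd.trans_le ?_)⟩
    rw [hx]; exact two_zpow_mono (by omega)
  · push Not at h1
    have hn : n = 0 := by have := h h1.1; omega
    obtain ⟨x, hx, -⟩ := F.root_unique h1.1
    exact ⟨x, hx.trans hn.symm, Or.inl ⟨h1.1, hx⟩⟩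

/-- The dilation constants of the local estimates form a chain: `16 + 2 + 2 ≤ 28` here, and `28 + 2
+ 2 = 32` in the next lemma. Averages are therefore taken over `ballAt 32`. -/
theorem mem_ballAt_of_level_le {x y : X} {ξ η : Z} (h : F.level x ≤ F.level y) (hx : ξ ∈ F.B x)
    (hy : ξ ∈ F.B y) (hη : η ∈ F.ballAt 16 y) : η ∈ F.ballAt 28 x := by
  have h1 := F.B_subset_ballAt_two x hx
  have h2 := F.B_subset_ballAt_two y hy
  rw [mem_ballAt] at *
  have h3 : (2 : ℝ) ^ (-F.level y) ≤ 2 ^ (-F.level x) := two_zpow_mono (by omega)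
  have h4 := dist_triangle η (F.center y) (F.center x)
  have h5 := dist_triangle (F.center y) ξ (F.center x)
  rw [dist_comm (F.center y) ξ] at h5
  have h6 := two_zpow_pos (-F.level x)
  linarith

theorem B_subset_ballAt_of_level_le {x y : X} {η : Z} (h : F.level x ≤ F.level y)
    (hx : η ∈ F.ballAt 28 x) (hy : η ∈ F.B y) : F.B y ⊆ F.ballAt 32 x := by
  intro ζ hζ
  have h1 := F.B_subset_ballAt_two y hζ
  have h2 := F.B_subset_ballAt_two y hy
  rw [mem_ballAt] at *
  have h3 : (2 : ℝ) ^ (-F.level y) ≤ 2 ^ (-F.level x) := two_zpow_mono (by omega)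
  have h4 := dist_triangle ζ (F.center y) (F.center x)
  have h5 := dist_triangle (F.center y) η (F.center x)
  rw [dist_comm (F.center y) η] at h5
  linarith

/-- The ball of a neighbour may be twice as large, which gives `2 + 2 * (2 + 2) = 10 ≤ 16`. -/
theorem B_subset_ballAt_of_adj {x y : X} (h : F.graph.Adj x y) : F.B y ⊆ F.ballAt 16 x := by
  obtain ⟨-, hl, η, hx, hy⟩ := h
  intro ζ hζ
  have h1 := F.B_subset_ballAt_two y hζ
  have h2 := F.B_subset_ballAt_two y hy
  have h6 := F.B_subset_ballAt_two x hx
  rw [mem_ballAt] at *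
  have h3 : (2 : ℝ) ^ (-F.level y) ≤ 2 * 2 ^ (-F.level x) :=
    two_zpow_neg_le (by have := abs_le.1 hl; omega)
  have h4 := dist_triangle ζ (F.center y) (F.center x)
  have h5 := dist_triangle (F.center y) η (F.center x)
  have h7 := two_zpow_pos (-F.level x)
  rw [dist_comm (F.center y) η] at h5
  linarith

end HyperbolicFilling

/-! ### Consequences of doubling: comparison of balls and bounded overlap -/

section Measure

variable {Z : Type*} [MetricSpace Z] [MeasurableSpace Z] [BorelSpace Z]
  {μ : Measure Z} {Q : ℝ} {X : Type*}

/-- Doubling for balls with different centers: `dist z w < R` puts the ball at `z` inside the ball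
of radius `2R` at `w`. -/
theorem IsDoublingWith.measure_ball_le (hμ : IsDoublingWith μ Q) :
    ∃ C : ℝ≥0∞, C ≠ ∞ ∧ ∀ (z w : Z) (ρ R : ℝ), 0 < ρ → ρ ≤ R → dist z w < R →
      μ (Metric.ball z R) ≤ C * ENNReal.ofReal ((R / ρ) ^ Q) * μ (Metric.ball w ρ) := by
  obtain ⟨C, hC, h⟩ := hμ.doubling
  refine ⟨ENNReal.ofReal (C * 2 ^ Q), by simp, fun z w ρ R hρ hR hd => ?_⟩
  have hsub : Metric.ball z R ⊆ Metric.ball w (2 * (R / ρ) * ρ) := by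
    refine Metric.ball_subset_ball' ?_
    rw [mul_assoc, div_mul_cancel₀ _ hρ.ne']
    linarith
  have h1 : 1 ≤ R / ρ := (one_le_div hρ).2 hR
  refine (measure_mono hsub).trans ((h w ρ _ hρ (by linarith)).trans_eq ?_)
  rw [← ENNReal.ofReal_mul (by positivity), Real.mul_rpow (by norm_num) (by positivity), mul_assoc]

namespace HyperbolicFilling

variable (F : HyperbolicFilling Z X)

theorem measure_ballAt_pos (hμ : IsDoublingWith μ Q) {K : ℝ} (hK : 0 < K) (x : X) :
    0 < μ (F.ballAt K x) := hμ.ball_pos _ _ (by positivity)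

theorem measure_ballAt_lt_top (hμ : IsDoublingWith μ Q) (K : ℝ) (x : X) :
    μ (F.ballAt K x) < ∞ := hμ.ball_lt_top _ _

theorem measure_B_pos (hμ : IsDoublingWith μ Q) (x : X) : 0 < μ (F.B x) :=
  (F.measure_ballAt_pos hμ one_pos x).trans_le (measure_mono (F.ballAt_one_subset_B x))

theorem measure_B_lt_top (hμ : IsDoublingWith μ Q) (x : X) : μ (F.B x) < ∞ :=
  (measure_mono (F.B_subset_ballAt_two x)).trans_lt (F.measure_ballAt_lt_top hμ 2 x)

theorem measure_ballAt_le (hμ : IsDoublingWith μ Q) {K : ℝ} (hK : 1 ≤ K) :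
    ∃ C : ℝ≥0∞, C ≠ ∞ ∧ ∀ x y : X, F.level x ≤ F.level y →
      dist (F.center x) (F.center y) < K * (2 : ℝ) ^ (-F.level x) →
      μ (F.ballAt K x) ≤ C * (2 : ℝ≥0∞) ^ (((F.level y : ℝ) - F.level x) * Q) * μ (F.B y) := by
  obtain ⟨C, hC, h⟩ := hμ.measure_ball_le
  refine ⟨C * ENNReal.ofReal (K ^ Q), ENNReal.mul_ne_top hC (by simp), fun x y hl hd => ?_⟩
  have h1 : (2 : ℝ) ^ (-F.level y) ≤ 2 ^ (-F.level x) := two_zpow_mono (by omega)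
  have h2 := two_zpow_pos (-F.level x)
  have h3 := h (F.center x) (F.center y) ((2 : ℝ) ^ (-F.level y)) (K * (2 : ℝ) ^ (-F.level x))
    (by positivity) (by nlinarith) hd
  refine h3.trans ?_
  have h4 : Metric.ball (F.center y) ((2 : ℝ) ^ (-F.level y)) ⊆ F.B y := by
    have := F.ballAt_one_subset_B y
    rwa [ballAt, one_mul] at this
  refine mul_le_mul' (le_of_eq ?_) (measure_mono h4)
  have h5 : K * (2 : ℝ) ^ (-F.level x) / (2 : ℝ) ^ (-F.level y) =
      K * (2 : ℝ) ^ ((F.level y : ℝ) - F.level x) := by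
    rw [mul_div_assoc, ← zpow_sub₀ (by norm_num), ← Real.rpow_intCast]
    push_cast; congr 2; ring
  rw [h5, Real.mul_rpow (by positivity) (by positivity), ENNReal.ofReal_mul (by positivity),
    ← Real.rpow_mul (by norm_num), mul_assoc]
  congr 2
  rw [← ENNReal.ofReal_rpow_of_pos (by norm_num)]; simp

/-- The number of vertices of a given level near a given point is bounded. -/
theorem encard_near_le (hμ : IsDoublingWith μ Q) {K : ℝ} (hK : 1 ≤ K) :
    ∃ N : ℕ, ∀ (n : ℤ) (ξ : Z),
      {x : X | F.level x = n ∧ dist ξ (F.center x) < K * (2 : ℝ) ^ (-n)}.encard ≤ N := by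
  obtain ⟨C, hC, h⟩ := hμ.measure_ball_le
  -- Volume counting: balls of radius `2^(-n)/4` about the centers are disjoint by separation and
  -- lie in one ball of radius `(K+1) 2^(-n)`. Each of them has at least the fraction `1/D` of its
  -- measure, and `(K+1) * 4` is the ratio of the radii.
  set D : ℝ≥0∞ := C * ENNReal.ofReal (((K + 1) * 4) ^ Q) with hD
  have hDtop : D ≠ ∞ := ENNReal.mul_ne_top hC (by simp)
  obtain ⟨N, hN⟩ := ENNReal.exists_nat_gt hDtop
  refine ⟨N, fun n ξ => ?_⟩
  have hcount : Countable X := F.countable hμ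
  set s : Set X := {x : X | F.level x = n ∧ dist ξ (F.center x) < K * (2 : ℝ) ^ (-n)} with hs
  have hp := two_zpow_pos (-n)
  have hball : ∀ x : s, μ (Metric.ball ξ ((K + 1) * (2 : ℝ) ^ (-n))) ≤
      D * μ (Metric.ball (F.center x) ((2 : ℝ) ^ (-n) / 4)) := by
    intro x
    have := h ξ (F.center x) ((2 : ℝ) ^ (-n) / 4) ((K + 1) * (2 : ℝ) ^ (-n)) (by positivity)
      (by nlinarith) (x.2.2.trans (by nlinarith))
    convert this using 3
    field_simp
  have hdisj : Pairwise (Function.onFun Disjoint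
      fun x : s => Metric.ball (F.center x) ((2 : ℝ) ^ (-n) / 4)) := by
    intro x y hxy
    refine Metric.ball_disjoint_ball ?_
    have h := F.separated x y (fun h => hxy (Subtype.ext h)) (x.2.1.trans y.2.1.symm)
    rw [x.2.1] at h
    have h2 : (2 : ℝ) ^ (-n) = 2 * 2 ^ (-n - 1) := by
      rw [← two_zpow_add_one]; congr 1; ring
    linarith
  have hsum : ∑' x : s, μ (Metric.ball (F.center x) ((2 : ℝ) ^ (-n) / 4)) ≤
      μ (Metric.ball ξ ((K + 1) * (2 : ℝ) ^ (-n))) := by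
    rw [← measure_iUnion hdisj fun _ => measurableSet_ball]
    refine measure_mono (iUnion_subset fun x => Metric.ball_subset_ball' ?_)
    have := x.2.2
    rw [dist_comm] at this
    nlinarith
  have hpos := hμ.ball_pos ξ ((K + 1) * (2 : ℝ) ^ (-n)) (by positivity)
  have hfin := hμ.ball_lt_top ξ ((K + 1) * (2 : ℝ) ^ (-n))
  have key : (s.encard : ℝ≥0∞) * μ (Metric.ball ξ ((K + 1) * (2 : ℝ) ^ (-n))) ≤
      D * μ (Metric.ball ξ ((K + 1) * (2 : ℝ) ^ (-n))) := by
    rw [← ENNReal.tsum_set_const]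
    refine (ENNReal.tsum_le_tsum hball).trans ?_
    rw [ENNReal.tsum_mul_left]
    gcongr
  have key2 : (s.encard : ℝ≥0∞) ≤ D := (ENNReal.mul_le_mul_iff_left hpos.ne' hfin.ne).1 key
  have key3 : (s.encard : ℝ≥0∞) ≤ ((N : ℕ∞) : ℝ≥0∞) := by simpa using key2.trans hN.le
  exact_mod_cast key3

theorem encard_ballAt_le (hμ : IsDoublingWith μ Q) {K : ℝ} (hK : 1 ≤ K) :
    ∃ N : ℕ, ∀ (n : ℤ) (ξ : Z), {x : X | F.level x = n ∧ ξ ∈ F.ballAt K x}.encard ≤ N := by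
  obtain ⟨N, hN⟩ := F.encard_near_le hμ hK
  refine ⟨N, fun n ξ => le_trans (encard_le_encard ?_) (hN n ξ)⟩
  rintro x ⟨hx, hx'⟩
  exact ⟨hx, hx ▸ hx'⟩

theorem encard_mem_B_le (hμ : IsDoublingWith μ Q) :
    ∃ N : ℕ, ∀ (n : ℤ) (ξ : Z), {x : X | F.level x = n ∧ ξ ∈ F.B x}.encard ≤ N := by
  obtain ⟨N, hN⟩ := F.encard_ballAt_le hμ one_le_two
  refine ⟨N, fun n ξ => le_trans (encard_le_encard ?_) (hN n ξ)⟩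
  rintro x ⟨hx, hx'⟩
  exact ⟨hx, F.B_subset_ballAt_two x hx'⟩

/-- The filling has bounded valence. -/
theorem encard_adj_le (hμ : IsDoublingWith μ Q) :
    ∃ N : ℕ, ∀ x : X, {y | F.graph.Adj x y}.encard ≤ N := by
  -- A neighbour `y` of `x` has its center within `16 * 2^(-|x|) ≤ 32 * 2^(-|y|)`, and only three
  -- levels occur.
  obtain ⟨N, hN⟩ := F.encard_near_le hμ (K := 32) (by norm_num)
  refine ⟨N + N + N, fun x => ?_⟩
  set S : ℤ → Set X := fun n =>
    {y : X | F.level y = n ∧ dist (F.center x) (F.center y) < 32 * (2 : ℝ) ^ (-n)} with hS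
  have hsub : {y | F.graph.Adj x y} ⊆
      S (F.level x - 1) ∪ S (F.level x) ∪ S (F.level x + 1) := by
    intro y hy
    have hy' : F.graph.Adj x y := hy
    have hc := B_subset_ballAt_of_adj hy' (F.center_mem_B y)
    rw [mem_ballAt, dist_comm] at hc
    have hl := abs_le.1 hy'.2.1
    have h1 : (2 : ℝ) ^ (-F.level x) ≤ 2 * 2 ^ (-F.level y) := two_zpow_neg_le (by omega)
    have h2 : y ∈ S (F.level y) := ⟨rfl, by linarith⟩
    have h3 : F.level y = F.level x - 1 ∨ F.level y = F.level x ∨ F.level y = F.level x + 1 := by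
      omega
    rcases h3 with h3 | h3 | h3
    · exact Or.inl (Or.inl (h3 ▸ h2))
    · exact Or.inl (Or.inr (h3 ▸ h2))
    · exact Or.inr (h3 ▸ h2)
  refine (encard_le_encard hsub).trans ((encard_union_le _ _).trans ?_)
  push_cast
  exact add_le_add ((encard_union_le _ _).trans (add_le_add (hN _ _) (hN _ _))) (hN _ _)

theorem encard_edge_le (hμ : IsDoublingWith μ Q) (o : F.Orientation) :
    ∃ N : ℕ, ∀ x : X, {e : o.Edge | e.1.1 = x ∨ e.1.2 = x}.encard ≤ N := by
  obtain ⟨N, hN⟩ := F.encard_adj_le hμ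
  refine ⟨N + N, fun x => ?_⟩
  have h1 : {e : o.Edge | e.1.1 = x}.encard ≤ N := by
    refine le_trans ?_ (hN x)
    refine encard_le_encard_of_injOn (f := fun e : o.Edge => e.1.2) ?_ ?_
    · intro e he
      have he' : e.1.1 = x := he
      have := o.adj e.2
      rwa [he'] at this
    · intro e he e' he' h
      exact Subtype.ext (Prod.ext ((show e.1.1 = x from he).trans
        (show e'.1.1 = x from he').symm) h)
  have h2 : {e : o.Edge | e.1.2 = x}.encard ≤ N := by
    refine le_trans ?_ (hN x)
    refine encard_le_encard_of_injOn (f := fun e : o.Edge => e.1.1) ?_ ?_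
    · intro e he
      have he' : e.1.2 = x := he
      have := (o.adj e.2).symm
      rwa [he'] at this
    · intro e he e' he' h
      exact Subtype.ext (Prod.ext h ((show e.1.2 = x from he).trans
        (show e'.1.2 = x from he').symm))
  rw [ofPred_or]
  push_cast
  exact (encard_union_le _ _).trans (add_le_add h1 h2)

end HyperbolicFilling

end Measure

/-! ### Dyadic layer cake -/

/-- If `2^n < v ≤ 2^(n+1)`, the term `j = n` alone suffices; if `v = ∞`, infinitely many terms are
at least 1. -/
theorem rpow_le_tsum_dyadic {t : ℝ} (ht : 0 < t) (v : ℝ≥0∞) :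
    v ^ t ≤ ∑' j : ℤ, {w : ℝ≥0∞ | (2 : ℝ≥0∞) ^ (j : ℝ) < w}.indicator
      (fun _ => (2 : ℝ≥0∞) ^ (((j : ℝ) + 1) * t)) v := by
  rcases eq_or_ne v 0 with rfl | h0
  · simp [ENNReal.zero_rpow_of_pos ht]
  rcases eq_or_ne v ∞ with rfl | htop
  · refine le_of_le_of_eq le_top (Eq.symm (top_unique ?_))
    calc (∞ : ℝ≥0∞) = ∑' _ : ℕ, (1 : ℝ≥0∞) := (ENNReal.tsum_const_eq_top_of_ne_zero (by simp)).symm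
      _ ≤ ∑' n : ℕ, {w : ℝ≥0∞ | (2 : ℝ≥0∞) ^ (((n : ℤ)) : ℝ) < w}.indicator
            (fun _ => (2 : ℝ≥0∞) ^ (((((n : ℤ)) : ℝ) + 1) * t)) ∞ := by
          refine ENNReal.tsum_le_tsum fun n => ?_
          rw [indicator_of_mem]
          · exact ENNReal.one_le_rpow (by norm_num) (by push_cast; positivity)
          · exact ENNReal.rpow_lt_top_of_nonneg (by positivity) (by simp)
      _ ≤ _ := ENNReal.tsum_comp_le_tsum_of_injective Nat.cast_injective _
  obtain ⟨n, hn, hn'⟩ := ENNReal.exists_mem_Ioc_zpow h0 htop (y := 2) (by norm_num) (by simp)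
  refine le_trans ?_ (ENNReal.le_tsum n)
  rw [indicator_of_mem]
  · rw [ENNReal.rpow_mul]
    gcongr
    rw [← ENNReal.rpow_intCast] at hn'
    simpa using hn'
  · rw [← ENNReal.rpow_intCast] at hn
    exact hn

/-- Only the `j` with `2^(j-1) < v` contribute. As `t > 1`, the powers `2^(j(t-1))` form a geometric
series dominated by its largest term, which is of order `v^(t-1)`. -/
theorem tsum_dyadic_mul_le {t : ℝ} (ht : 1 < t) :
    ∃ C : ℝ≥0∞, C ≠ ∞ ∧ ∀ v : ℝ≥0∞,
      (∑' j : ℤ, {w : ℝ≥0∞ | (2 : ℝ≥0∞) ^ ((j : ℝ) - 1) < w}.indicator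
        (fun _ => (2 : ℝ≥0∞) ^ (((j : ℝ) + 1) * t + 1 - j)) v) * v ≤ C * v ^ t := by
  have ht0 : 0 < t - 1 := by linarith
  -- At the last index `j = n + 1` the exponent equals `n(t-1) + 2t`, whence the factor `2^(2t)`.
  -- The summand 1 keeps the constant nonzero for `v = ∞`.
  refine ⟨(2 : ℝ≥0∞) ^ (2 * t) * ∑' k : ℤ, geomWeight (t - 1) k + 1, ?_, fun v => ?_⟩
  · refine ENNReal.add_ne_top.2 ⟨ENNReal.mul_ne_top ?_ (tsum_geomWeight_ne_top ht0), by simp⟩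
    exact ENNReal.rpow_ne_top_of_nonneg (by positivity) (by simp)
  rcases eq_or_ne v 0 with rfl | h0
  · simp
  rcases eq_or_ne v ∞ with rfl | htop
  · rw [ENNReal.top_rpow_of_pos (by linarith)]
    exact le_top.trans_eq (ENNReal.mul_top (lt_of_lt_of_le one_pos le_add_self).ne').symm
  obtain ⟨n, hn, hn'⟩ := ENNReal.exists_mem_Ioc_zpow h0 htop (y := 2) (by norm_num) (by simp)
  rw [← ENNReal.rpow_intCast] at hn hn'
  have hv : v ^ t = v ^ (t - 1) * v := by
    nth_rewrite 3 [← ENNReal.rpow_one v]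
    rw [← ENNReal.rpow_add _ _ h0 htop]; congr 1; ring
  rw [hv, ← mul_assoc]
  gcongr
  calc _ ≤ ∑' j : ℤ, (2 : ℝ≥0∞) ^ (2 * t) * v ^ (t - 1) * geomWeight (t - 1) (j - (n + 1)) := by
        refine ENNReal.tsum_le_tsum fun j => ?_
        by_cases hj : (2 : ℝ≥0∞) ^ ((j : ℝ) - 1) < v
        · rw [indicator_of_mem (by exact hj)]
          have h1 : (2 : ℝ≥0∞) ^ ((j : ℝ) - 1) < (2 : ℝ≥0∞) ^ ((n + 1 : ℤ) : ℝ) := hj.trans_le hn'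
          have h2 : (j : ℝ) - 1 < ((n + 1 : ℤ) : ℝ) := by
            by_contra hcon
            exact absurd h1 (not_lt.2 (ENNReal.rpow_le_rpow_of_exponent_le (by norm_num)
              (not_lt.1 hcon)))
          have h3 : j ≤ n + 1 := by
            have : j - 1 < n + 1 := by exact_mod_cast h2
            omega
          have h4 : |((j - (n + 1) : ℤ) : ℝ)| = n + 1 - j := by
            rw [abs_of_nonpos (by exact_mod_cast (by omega))]; push_cast; ring
          calc (2 : ℝ≥0∞) ^ (((j : ℝ) + 1) * t + 1 - j)
              = (2 : ℝ≥0∞) ^ (2 * t) * ((2 : ℝ≥0∞) ^ (n : ℝ)) ^ (t - 1) *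
                  geomWeight (t - 1) (j - (n + 1)) := by
                unfold geomWeight
                rw [h4, ← ENNReal.rpow_mul, ← ENNReal.rpow_add _ _ (by simp) (by simp),
                  ← ENNReal.rpow_add _ _ (by simp) (by simp)]
                congr 1; ring
            _ ≤ _ := by gcongr
        · rw [indicator_of_notMem (by exact hj)]; exact zero_le
    _ = (2 : ℝ≥0∞) ^ (2 * t) * v ^ (t - 1) * ∑' k : ℤ, geomWeight (t - 1) k := by
        rw [ENNReal.tsum_mul_left]
        congr 1
        exact (Equiv.subRight (n + 1)).tsum_eq (geomWeight (t - 1))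
    _ = (2 : ℝ≥0∞) ^ (2 * t) * (∑' k : ℤ, geomWeight (t - 1) k) * v ^ (t - 1) := by ring
    _ ≤ _ := by gcongr; exact le_self_add

/-! ### The maximal function -/

section Measure

variable {Z : Type*} [MetricSpace Z] [MeasurableSpace Z] [BorelSpace Z]
  {μ : Measure Z} {Q : ℝ} {X : Type*}

namespace HyperbolicFilling

variable (F : HyperbolicFilling Z X)

/-- The average of a nonnegative function over an enlarged ball of a vertex. -/
def avg (μ : Measure Z) (f : Z → ℝ≥0∞) (x : X) : ℝ≥0∞ :=
  (∫⁻ η in F.ballAt 32 x, f η ∂μ) / μ (F.ballAt 32 x)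

/-- The maximal function over the enlarged balls of the vertices. -/
def maxFun (μ : Measure Z) (f : Z → ℝ≥0∞) (ξ : Z) : ℝ≥0∞ :=
  ⨆ x, (F.ballAt 32 x).indicator (fun _ => F.avg μ f x) ξ

/-- The maximal function over the enlarged balls of the vertices of level `n`. -/
def levelMax (μ : Measure Z) (n : ℤ) (f : Z → ℝ≥0∞) (ξ : Z) : ℝ≥0∞ :=
  ⨆ (x : X) (_ : F.level x = n), (F.ballAt 32 x).indicator (fun _ => F.avg μ f x) ξ

variable {F}

theorem avg_mono {f g : Z → ℝ≥0∞} (h : f ≤ g) (x : X) : F.avg μ f x ≤ F.avg μ g x := by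
  unfold avg; gcongr; exact h _

theorem avg_mono_ae {f g : Z → ℝ≥0∞} (h : f ≤ᵐ[μ] g) (x : X) : F.avg μ f x ≤ F.avg μ g x := by
  unfold avg
  exact ENNReal.div_le_div_right (lintegral_mono_ae (ae_restrict_of_ae h)) _

theorem avg_const (hμ : IsDoublingWith μ Q) (c : ℝ≥0∞) (x : X) : F.avg μ (fun _ => c) x = c := by
  unfold avg
  rw [setLIntegral_const, ENNReal.mul_div_cancel_right
    (F.measure_ballAt_pos hμ (by norm_num) x).ne' (F.measure_ballAt_lt_top hμ _ x).ne]

theorem avg_mul_measure (hμ : IsDoublingWith μ Q) (f : Z → ℝ≥0∞) (x : X) :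
    F.avg μ f x * μ (F.ballAt 32 x) = ∫⁻ η in F.ballAt 32 x, f η ∂μ :=
  ENNReal.div_mul_cancel (F.measure_ballAt_pos hμ (by norm_num) x).ne'
    (F.measure_ballAt_lt_top hμ _ x).ne

theorem avg_le_levelMax {x : X} {ξ : Z} (h : ξ ∈ F.ballAt 32 x) (f : Z → ℝ≥0∞) :
    F.avg μ f x ≤ F.levelMax μ (F.level x) f ξ := by
  unfold levelMax
  refine le_trans ?_ (le_iSup₂ (f := fun (y : X) (_ : F.level y = F.level x) =>
    (F.ballAt 32 y).indicator (fun _ => F.avg μ f y) ξ) x rfl)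
  rw [indicator_of_mem h]

theorem levelMax_le {n : ℤ} {f : Z → ℝ≥0∞} {ξ : Z} {c : ℝ≥0∞}
    (h : ∀ x, F.level x = n → ξ ∈ F.ballAt 32 x → F.avg μ f x ≤ c) : F.levelMax μ n f ξ ≤ c :=
  iSup₂_le fun x hx => by
    by_cases hξ : ξ ∈ F.ballAt 32 x
    · rw [indicator_of_mem hξ]; exact h x hx hξ
    · rw [indicator_of_notMem hξ]; exact zero_le

theorem avg_le_maxFun {x : X} {ξ : Z} (h : ξ ∈ F.ballAt 32 x) (f : Z → ℝ≥0∞) :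
    F.avg μ f x ≤ F.maxFun μ f ξ := by
  unfold maxFun
  refine le_trans ?_ (le_iSup _ x)
  rw [indicator_of_mem h]

theorem maxFun_le {f : Z → ℝ≥0∞} {ξ : Z} {c : ℝ≥0∞}
    (h : ∀ x, ξ ∈ F.ballAt 32 x → F.avg μ f x ≤ c) : F.maxFun μ f ξ ≤ c :=
  iSup_le fun x => by
    by_cases hξ : ξ ∈ F.ballAt 32 x
    · rw [indicator_of_mem hξ]; exact h x hξ
    · rw [indicator_of_notMem hξ]; exact zero_le

theorem levelMax_le_maxFun (n : ℤ) (f : Z → ℝ≥0∞) (ξ : Z) :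
    F.levelMax μ n f ξ ≤ F.maxFun μ f ξ :=
  levelMax_le fun _ _ h => avg_le_maxFun h f

theorem maxFun_mono {f g : Z → ℝ≥0∞} (h : f ≤ g) (ξ : Z) : F.maxFun μ f ξ ≤ F.maxFun μ g ξ :=
  maxFun_le fun x hx => (avg_mono h x).trans (avg_le_maxFun hx g)

theorem measurable_maxFun (hμ : IsDoublingWith μ Q) (f : Z → ℝ≥0∞) :
    Measurable (F.maxFun μ f) := by
  have := F.countable hμ
  exact Measurable.iSup fun x => measurable_const.indicator (F.isOpen_ballAt _ x).measurableSet

theorem measurable_levelMax (hμ : IsDoublingWith μ Q) (n : ℤ) (f : Z → ℝ≥0∞) :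
    Measurable (F.levelMax μ n f) := by
  have := F.countable hμ
  exact Measurable.iSup fun x => Measurable.iSup fun _ =>
    measurable_const.indicator (F.isOpen_ballAt _ x).measurableSet

variable (F)

/-- The weak type (1, 1) inequality. -/
theorem mul_measure_lt_maxFun_le (hμ : IsDoublingWith μ Q) :
    ∃ C : ℝ≥0∞, C ≠ ∞ ∧ ∀ (f : Z → ℝ≥0∞) (l : ℝ≥0∞),
      l * μ {ξ | l < F.maxFun μ f ξ} ≤ C * ∫⁻ ξ, f ξ ∂μ := by
  have := F.countable hμ
  obtain ⟨C, hC, hball⟩ := hμ.measure_ball_le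
  -- The closed balls enlarged by 5 in Vitali's lemma lie in open balls enlarged by 6.
  set D : ℝ≥0∞ := C * ENNReal.ofReal (6 ^ Q)
  refine ⟨D, ENNReal.mul_ne_top hC (by simp), fun f l => ?_⟩
  -- Vitali's lemma needs bounded radii, so only levels at least `-N` are admitted; continuity from
  -- below then lets `N` tend to infinity.
  set T : ℕ → Set X := fun N => {x | -(N : ℤ) ≤ F.level x ∧ l < F.avg μ f x} with hT
  have hU : {ξ | l < F.maxFun μ f ξ} = ⋃ N, ⋃ x ∈ T N, F.ballAt 32 x := by
    ext ξ
    simp only [mem_ofPred_eq, mem_iUnion, exists_prop, maxFun, lt_iSup_iff]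
    constructor
    · rintro ⟨x, hx⟩
      by_cases h : ξ ∈ F.ballAt 32 x
      · rw [indicator_of_mem h] at hx
        exact ⟨(-F.level x).toNat, x, ⟨by omega, hx⟩, h⟩
      · simp [h] at hx
    · rintro ⟨N, x, ⟨-, hx⟩, h⟩
      exact ⟨x, by rwa [indicator_of_mem h]⟩
  have hmono : Monotone fun N => ⋃ x ∈ T N, F.ballAt 32 x := by
    intro N M hNM
    refine biUnion_subset_biUnion_left fun x hx => ⟨?_, hx.2⟩
    have := hx.1
    omega
  rw [hU, hmono.measure_iUnion, ENNReal.mul_iSup]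
  refine iSup_le fun N => ?_
  obtain ⟨u, hu, hdisj, hcov⟩ := Vitali.exists_disjoint_subfamily_covering_enlargement_closedBall
    (T N) F.center (fun x => 32 * (2 : ℝ) ^ (-F.level x)) (32 * (2 : ℝ) ^ (N : ℤ))
    (fun x hx => by
      have h1 : -F.level x ≤ N := by have := hx.1; omega
      have := two_zpow_mono h1
      linarith) 5 (by norm_num)
  have hsub : ∀ x, F.ballAt 32 x ⊆ Metric.closedBall (F.center x) (32 * (2 : ℝ) ^ (-F.level x)) :=
    fun x => Metric.ball_subset_closedBall
  have hμu : ∀ x : u, l * μ (Metric.closedBall (F.center x) (5 * (32 * (2 : ℝ) ^ (-F.level x)))) ≤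
      D * ∫⁻ η in F.ballAt 32 x, f η ∂μ := by
    intro x
    have hp := two_zpow_pos (-F.level x)
    have h1 := hball (F.center x) (F.center x) (32 * (2 : ℝ) ^ (-F.level x))
      (6 * (32 * (2 : ℝ) ^ (-F.level x))) (by positivity) (by linarith) (by simp; positivity)
    rw [mul_div_cancel_right₀ _ (by positivity)] at h1
    have h2 : l * μ (F.ballAt 32 x) ≤ ∫⁻ η in F.ballAt 32 x, f η ∂μ :=
      ENNReal.mul_le_of_le_div (hu x.2).2.le
    calc _ ≤ l * (D * μ (F.ballAt 32 x)) := by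
          gcongr
          refine (measure_mono ?_).trans h1
          exact Metric.closedBall_subset_ball (by linarith)
      _ = D * (l * μ (F.ballAt 32 x)) := by ring
      _ ≤ _ := by gcongr
  calc l * μ (⋃ x ∈ T N, F.ballAt 32 x)
      ≤ l * μ (⋃ x : u, Metric.closedBall (F.center x) (5 * (32 * (2 : ℝ) ^ (-F.level x)))) := by
        gcongr
        refine iUnion₂_subset fun x hx => ?_
        obtain ⟨y, hy, hxy⟩ := hcov x hx
        exact (hsub x).trans (hxy.trans (subset_iUnion (fun y : u =>
          Metric.closedBall (F.center y) (5 * (32 * (2 : ℝ) ^ (-F.level y)))) ⟨y, hy⟩))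
    _ ≤ l * ∑' x : u, μ (Metric.closedBall (F.center x) (5 * (32 * (2 : ℝ) ^ (-F.level x)))) := by
        gcongr
        exact measure_iUnion_le _
    _ ≤ ∑' x : u, D * ∫⁻ η in F.ballAt 32 x, f η ∂μ := by
        rw [← ENNReal.tsum_mul_left]
        exact ENNReal.tsum_le_tsum hμu
    _ = D * ∫⁻ η in ⋃ x : u, F.ballAt 32 x, f η ∂μ := by
        rw [ENNReal.tsum_mul_left,
          lintegral_iUnion (fun x : u => (F.isOpen_ballAt _ _).measurableSet)]
        intro x y hxy
        exact (hdisj x.2 y.2 fun h => hxy (Subtype.ext h)).mono (hsub x) (hsub y)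
    _ ≤ D * ∫⁻ ξ, f ξ ∂μ := by gcongr; exact Measure.restrict_le_self

/-- Let `l = 2^(j-1)` and let `f'` be `f` where `f > l` and 0 elsewhere. Then `f ≤ f' + l` and
averages of the constant `l` are `l`, so the maximal function of `f'` exceeds `l` wherever that of
`f` exceeds `2l`. The weak type inequality is applied to `f'`. -/
theorem measure_lt_maxFun_le (hμ : IsDoublingWith μ Q) :
    ∃ C : ℝ≥0∞, C ≠ ∞ ∧ ∀ (f : Z → ℝ≥0∞) (j : ℤ),
      μ {ξ | (2 : ℝ≥0∞) ^ (j : ℝ) < F.maxFun μ f ξ} ≤ C * (2 : ℝ≥0∞) ^ (1 - (j : ℝ)) *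
        ∫⁻ ξ, {w : ℝ≥0∞ | (2 : ℝ≥0∞) ^ ((j : ℝ) - 1) < w}.indicator id (f ξ) ∂μ := by
  obtain ⟨C, hC, h⟩ := F.mul_measure_lt_maxFun_le hμ
  refine ⟨C, hC, fun f j => ?_⟩
  set l : ℝ≥0∞ := (2 : ℝ≥0∞) ^ ((j : ℝ) - 1) with hl
  set f' : Z → ℝ≥0∞ := fun ξ => {w : ℝ≥0∞ | l < w}.indicator id (f ξ) with hf'
  have hff' : ∀ ξ, f ξ ≤ f' ξ + l := by
    intro ξ
    by_cases hξ : l < f ξ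
    · simp [hf', hξ]
    · simpa [hf', hξ] using not_lt.1 hξ
  have hl0 : l ≠ 0 := by simp [hl]
  have hltop : l ≠ ∞ := by
    rw [hl]; exact (ENNReal.rpow_ne_top_of_ne_zero (by simp) (by simp))
  have hmax : ∀ ξ, F.maxFun μ f ξ ≤ F.maxFun μ f' ξ + l := by
    intro ξ
    refine maxFun_le fun x hx => ?_
    calc F.avg μ f x ≤ F.avg μ (fun ξ => f' ξ + l) x := avg_mono hff' x
      _ = F.avg μ f' x + F.avg μ (fun _ => l) x := by
          unfold avg
          rw [lintegral_add_right _ measurable_const, ENNReal.add_div]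
      _ ≤ _ := by
          rw [avg_const hμ]
          gcongr
          exact avg_le_maxFun hx f'
  have hj : (2 : ℝ≥0∞) ^ (j : ℝ) = l + l := by
    rw [← two_mul, hl]
    nth_rewrite 2 [← ENNReal.rpow_one 2]
    rw [← ENNReal.rpow_add _ _ (by simp) (by simp)]; congr 1; ring
  have hsub : {ξ | (2 : ℝ≥0∞) ^ (j : ℝ) < F.maxFun μ f ξ} ⊆ {ξ | l < F.maxFun μ f' ξ} := by
    intro ξ hξ
    have : l + l < F.maxFun μ f' ξ + l := by
      rw [← hj]; exact lt_of_lt_of_le hξ (hmax ξ)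
    exact lt_of_add_lt_add_right this
  have hinv : (2 : ℝ≥0∞) ^ (1 - (j : ℝ)) = l⁻¹ := by
    rw [hl, ← ENNReal.rpow_neg]; congr 1; ring
  calc _ ≤ μ {ξ | l < F.maxFun μ f' ξ} := measure_mono hsub
    _ = l⁻¹ * (l * μ {ξ | l < F.maxFun μ f' ξ}) := by
        rw [← mul_assoc, ENNReal.inv_mul_cancel hl0 hltop, one_mul]
    _ ≤ l⁻¹ * (C * ∫⁻ ξ, f' ξ ∂μ) := mul_le_mul_right (h f' l) _
    _ = _ := by rw [hinv]; ring

/-- The strong type inequality for the maximal function. -/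
theorem lintegral_maxFun_rpow_le (hμ : IsDoublingWith μ Q) {t : ℝ} (ht : 1 < t) :
    ∃ C : ℝ≥0∞, C ≠ ∞ ∧ ∀ f : Z → ℝ≥0∞, Measurable f →
      ∫⁻ ξ, F.maxFun μ f ξ ^ t ∂μ ≤ C * ∫⁻ ξ, f ξ ^ t ∂μ := by
  obtain ⟨C, hC, h⟩ := F.measure_lt_maxFun_le hμ
  obtain ⟨C', hC', h'⟩ := tsum_dyadic_mul_le ht
  have hS : ∀ l : ℝ≥0∞, MeasurableSet {w : ℝ≥0∞ | l < w} := fun l => measurableSet_Ioi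
  refine ⟨C * C', ENNReal.mul_ne_top hC hC', fun f hf => ?_⟩
  have hm : ∀ j : ℤ, Measurable fun ξ =>
      {w : ℝ≥0∞ | (2 : ℝ≥0∞) ^ ((j : ℝ) - 1) < w}.indicator id (f ξ) := fun j =>
    (measurable_id.indicator (hS _)).comp hf
  have hM : ∀ j : ℤ, Measurable fun ξ => {w : ℝ≥0∞ | (2 : ℝ≥0∞) ^ (j : ℝ) < w}.indicator
      (fun _ => (2 : ℝ≥0∞) ^ (((j : ℝ) + 1) * t)) (F.maxFun μ f ξ) := fun j =>
    (measurable_const.indicator (hS _)).comp (measurable_maxFun hμ f)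
  calc ∫⁻ ξ, F.maxFun μ f ξ ^ t ∂μ
      ≤ ∫⁻ ξ, ∑' j : ℤ, {w : ℝ≥0∞ | (2 : ℝ≥0∞) ^ (j : ℝ) < w}.indicator
        (fun _ => (2 : ℝ≥0∞) ^ (((j : ℝ) + 1) * t)) (F.maxFun μ f ξ) ∂μ :=
        lintegral_mono fun ξ => rpow_le_tsum_dyadic (by linarith) _
    _ = ∑' j : ℤ, (2 : ℝ≥0∞) ^ (((j : ℝ) + 1) * t) *
          μ {ξ | (2 : ℝ≥0∞) ^ (j : ℝ) < F.maxFun μ f ξ} := by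
        rw [lintegral_tsum fun j : ℤ => (hM j).aemeasurable]
        congr 1; funext j
        exact lintegral_indicator_const (measurable_maxFun hμ f (hS _)) _
    _ ≤ ∑' j : ℤ, C * ∫⁻ ξ, (2 : ℝ≥0∞) ^ (((j : ℝ) + 1) * t + 1 - j) *
          {w : ℝ≥0∞ | (2 : ℝ≥0∞) ^ ((j : ℝ) - 1) < w}.indicator id (f ξ) ∂μ := by
        refine ENNReal.tsum_le_tsum fun j => ?_
        rw [lintegral_const_mul _ (hm j)]
        calc _ ≤ (2 : ℝ≥0∞) ^ (((j : ℝ) + 1) * t) * (C * (2 : ℝ≥0∞) ^ (1 - (j : ℝ)) *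
            ∫⁻ ξ, {w : ℝ≥0∞ | (2 : ℝ≥0∞) ^ ((j : ℝ) - 1) < w}.indicator id (f ξ) ∂μ) := by
              gcongr; exact h f j
          _ = C * ((2 : ℝ≥0∞) ^ (((j : ℝ) + 1) * t) * (2 : ℝ≥0∞) ^ (1 - (j : ℝ)) *
            ∫⁻ ξ, {w : ℝ≥0∞ | (2 : ℝ≥0∞) ^ ((j : ℝ) - 1) < w}.indicator id (f ξ) ∂μ) := by ring
          _ = _ := by
              rw [← ENNReal.rpow_add _ _ (by simp) (by simp)]
              congr 3
              ring_nf
    _ = C * ∫⁻ ξ, ∑' j : ℤ, (2 : ℝ≥0∞) ^ (((j : ℝ) + 1) * t + 1 - j) *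
          {w : ℝ≥0∞ | (2 : ℝ≥0∞) ^ ((j : ℝ) - 1) < w}.indicator id (f ξ) ∂μ := by
        rw [ENNReal.tsum_mul_left, lintegral_tsum fun j => ((hm j).const_mul _).aemeasurable]
    -- The sum over dyadic heights is now evaluated at a fixed point; this is where `1 < t` is
    -- needed.
    _ ≤ C * ∫⁻ ξ, C' * f ξ ^ t ∂μ := by
        gcongr with ξ
        refine le_trans (le_of_eq ?_) (h' (f ξ))
        rw [← ENNReal.tsum_mul_right]
        congr 1; funext j
        by_cases hj : (2 : ℝ≥0∞) ^ ((j : ℝ) - 1) < f ξ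
        · simp [hj]
        · simp [hj]
    _ = C * C' * ∫⁻ ξ, f ξ ^ t ∂μ := by
        rw [lintegral_const_mul _ (hf.pow_const _), mul_assoc]

end HyperbolicFilling

end Measure

/-! ### Vector-valued maximal inequality -/

/-- The converse of Hölder's inequality. -/
theorem lintegral_rpow_le_of_forall_lintegral_mul_le {α : Type*} [MeasurableSpace α]
    {μ : Measure α} [SigmaFinite μ] {t t' : ℝ} (ht : t.HolderConjugate t') {f : α → ℝ≥0∞}
    (hf : Measurable f) {K : ℝ≥0∞} (hK : ∀ w : α → ℝ≥0∞, Measurable w →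
      ∫⁻ a, f a * w a ∂μ ≤ K * (∫⁻ a, w a ^ t' ∂μ) ^ (1 / t')) :
    ∫⁻ a, f a ^ t ∂μ ≤ K ^ t := by
  have ht0 : 0 < t := ht.pos
  set S := spanningSets μ with hS
  -- Truncation in height and to a set of finite measure makes `I = ∫ g^t` finite. Testing with
  -- `g^(t-1)` gives `I ≤ K I^(1/t')`, which may then be divided by `I^(1/t')`; monotone convergence
  -- removes the truncation.
  set g : ℕ → α → ℝ≥0∞ := fun j => (S j).indicator fun a => min (f a) j with hg
  have hgm : ∀ j, Measurable (g j) := fun j =>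
    (hf.min measurable_const).indicator (measurableSet_spanningSets μ j)
  have hgf : ∀ j a, g j a ≤ f a := fun j a => by
    by_cases h : a ∈ S j
    · simp [hg, h]
    · simp [hg, h]
  have hbound : ∀ j, ∫⁻ a, g j a ^ t ∂μ ≤ K ^ t := by
    intro j
    have hfin : ∫⁻ a, g j a ^ t ∂μ ≠ ∞ := by
      refine ne_top_of_le_ne_top (b := (j : ℝ≥0∞) ^ t * μ (S j)) ?_ ?_
      · exact ENNReal.mul_ne_top (ENNReal.rpow_ne_top_of_nonneg ht0.le (by simp))
          (measure_spanningSets_lt_top μ j).ne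
      · rw [← lintegral_indicator_const (measurableSet_spanningSets μ j)]
        refine lintegral_mono fun a => ?_
        by_cases h : a ∈ S j
        · rw [indicator_of_mem (by exact h)]
          simp only [hg, indicator_of_mem h]
          exact ENNReal.rpow_le_rpow (min_le_right _ _) ht0.le
        · have h' : a ∉ spanningSets μ j := hS ▸ h
          simp [hg, hS, h', ENNReal.zero_rpow_of_pos ht0]
    have h1 := hK (fun a => g j a ^ (t - 1)) ((hgm j).pow_const _)
    have h2 : ∀ a, (g j a ^ (t - 1)) ^ t' = g j a ^ t := fun a => by
      rw [← ENNReal.rpow_mul, ht.sub_one_mul_conj]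
    simp_rw [h2] at h1
    have h3 : ∫⁻ a, g j a ^ t ∂μ ≤ ∫⁻ a, f a * g j a ^ (t - 1) ∂μ := by
      refine lintegral_mono fun a => ?_
      calc g j a ^ t = g j a ^ (1 : ℝ) * g j a ^ (t - 1) := by
            rw [← ENNReal.rpow_add_of_nonneg _ _ (by norm_num) (by linarith [ht.lt])]
            congr 1; ring
        _ ≤ _ := by rw [ENNReal.rpow_one]; gcongr; exact hgf j a
    set I := ∫⁻ a, g j a ^ t ∂μ with hI
    have h4 : I ≤ K * I ^ (1 / t') := h3.trans h1
    rcases eq_or_ne I 0 with h0 | h0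
    · rw [h0]; exact zero_le
    have h5 : I = I ^ (1 / t) * I ^ (1 / t') := by
      rw [← ENNReal.rpow_add _ _ h0 hfin, one_div, one_div, ht.inv_add_inv_eq_one,
        ENNReal.rpow_one]
    have h6 : I ^ (1 / t) ≤ K := by
      have h0' : I ^ (1 / t') ≠ 0 := by simp [h0, hfin]
      have h7 : I ^ (1 / t') ≠ ∞ :=
        ENNReal.rpow_ne_top_of_nonneg (by have := ht.symm.pos; positivity) hfin
      exact (ENNReal.mul_le_mul_iff_left h0' h7).1 (h5.symm.trans_le h4)
    calc I = (I ^ (1 / t)) ^ t := by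
          rw [← ENNReal.rpow_mul, one_div_mul_cancel ht0.ne', ENNReal.rpow_one]
      _ ≤ _ := by gcongr
  have hlim : Tendsto (fun j => ∫⁻ a, g j a ^ t ∂μ) atTop (𝓝 (∫⁻ a, f a ^ t ∂μ)) := by
    refine lintegral_tendsto_of_tendsto_of_monotone (fun j => ((hgm j).pow_const _).aemeasurable)
      (Eventually.of_forall fun a => ?_) (Eventually.of_forall fun a => ?_)
    · intro j k hjk
      refine ENNReal.rpow_le_rpow ?_ ht0.le
      by_cases h : a ∈ S j
      · have h' : a ∈ S k := monotone_spanningSets μ hjk h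
        simp only [hg, indicator_of_mem h, indicator_of_mem h']
        gcongr
      · simp only [hg, indicator_of_notMem h]; exact zero_le
    · refine (ENNReal.continuous_rpow_const.tendsto _).comp ?_
      have h1 : Tendsto (fun j : ℕ => min (f a) (j : ℝ≥0∞)) atTop (𝓝 (min (f a) ∞)) :=
        tendsto_const_nhds.min ENNReal.tendsto_nat_nhds_top
      rw [min_eq_left le_top] at h1
      refine h1.congr' ?_
      filter_upwards [eventually_ge_atTop (spanningSetsIndex μ a)] with j hj
      have : a ∈ S j := monotone_spanningSets μ hj (mem_spanningSetsIndex μ a)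
      simp only [hg, indicator_of_mem this]
  exact le_of_tendsto' hlim hbound

section Measure

variable {Z : Type*} [MetricSpace Z] [MeasurableSpace Z] [BorelSpace Z]
  {μ : Measure Z} {Q : ℝ} {X : Type*}

theorem IsDoublingWith.sigmaFinite (hμ : IsDoublingWith μ Q) : SigmaFinite μ := by
  rcases isEmpty_or_nonempty Z with h | ⟨⟨z⟩⟩
  · rw [Measure.eq_zero_of_isEmpty μ]; infer_instance
  · exact ⟨⟨
      { set := fun n : ℕ => Metric.ball z n
        set_mem := fun _ => trivial
        finite := fun n => hμ.ball_lt_top _ _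
        spanning := Metric.iUnion_ball_nat _ }⟩⟩

namespace HyperbolicFilling

variable {F : HyperbolicFilling Z X}

theorem avg_eq_lintegral (f : Z → ℝ≥0∞) (x : X) : F.avg μ f x =
    ∫⁻ η, f η ∂((μ (F.ballAt 32 x))⁻¹ • μ.restrict (F.ballAt 32 x)) := by
  rw [lintegral_smul_measure, avg, ENNReal.div_eq_inv_mul, smul_eq_mul]

theorem avg_mul_le {q q' : ℝ} (hq : q.HolderConjugate q') {f g : Z → ℝ≥0∞} (hf : Measurable f)
    (hg : Measurable g) (x : X) : F.avg μ (fun ξ => f ξ * g ξ) x ≤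
      F.avg μ (fun ξ => f ξ ^ q) x ^ (1 / q) * F.avg μ (fun ξ => g ξ ^ q') x ^ (1 / q') := by
  simp only [avg_eq_lintegral]
  exact ENNReal.lintegral_mul_le_Lp_mul_Lq _ hq hf.aemeasurable hg.aemeasurable

/-- Jensen's inequality, obtained from Hölder's against the constant 1, whose average is 1. -/
theorem avg_rpow_le (hμ : IsDoublingWith μ Q) {q : ℝ} (hq : 1 < q) {f : Z → ℝ≥0∞}
    (hf : Measurable f) (x : X) : F.avg μ f x ^ q ≤ F.avg μ (fun ξ => f ξ ^ q) x := by
  have hq0 : 0 < q := by linarith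
  have h := avg_mul_le (F := F) (μ := μ) (Real.HolderConjugate.conjExponent hq) hf
    (measurable_const (a := (1 : ℝ≥0∞))) x
  simp only [mul_one, ENNReal.one_rpow, avg_const hμ] at h
  calc _ ≤ (F.avg μ (fun ξ => f ξ ^ q) x ^ (1 / q)) ^ q := by gcongr
    _ = _ := by rw [← ENNReal.rpow_mul, one_div_mul_cancel hq0.ne', ENNReal.rpow_one]

theorem levelMax_rpow_le (hμ : IsDoublingWith μ Q) {q : ℝ} (hq : 1 < q) {f : Z → ℝ≥0∞}
    (hf : Measurable f) (n : ℤ) (ξ : Z) :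
    F.levelMax μ n f ξ ^ q ≤ F.levelMax μ n (fun ξ => f ξ ^ q) ξ := by
  have hq0 : 0 < q := by linarith
  rw [← ENNReal.le_rpow_inv_iff hq0]
  refine levelMax_le fun x hx hξ => ?_
  rw [ENNReal.le_rpow_inv_iff hq0]
  exact (avg_rpow_le hμ hq hf x).trans (hx ▸ avg_le_levelMax hξ _)

variable (F)

/-- The operators `levelMax` are essentially self-adjoint. -/
theorem lintegral_levelMax_mul_le (hμ : IsDoublingWith μ Q) :
    ∃ C : ℝ≥0∞, C ≠ ∞ ∧ ∀ (n : ℤ) (f w : Z → ℝ≥0∞), Measurable f → Measurable w →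
      ∫⁻ ξ, F.levelMax μ n f ξ * w ξ ∂μ ≤ C * ∫⁻ ξ, f ξ * F.levelMax μ n w ξ ∂μ := by
  have := F.countable hμ
  obtain ⟨N, hN⟩ := F.encard_ballAt_le hμ (K := 32) (by norm_num)
  refine ⟨N, by simp, fun n f w hf hw => ?_⟩
  have hB : ∀ x, MeasurableSet (F.ballAt 32 x) := fun x => (F.isOpen_ballAt _ x).measurableSet
  -- Replacing the supremum over the vertices with a sum gives an operator whose kernel, the sum
  -- over `x` of `1_x(ξ) 1_x(η) / μ(ballAt 32 x)` with `1_x` the indicator of `ballAt 32 x`, is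
  -- symmetric. Bounded overlap makes both operators comparable.
  set T : (Z → ℝ≥0∞) → Z → ℝ≥0∞ := fun h ξ => ∑' x : {x // F.level x = n},
    (F.ballAt 32 x.1).indicator (fun _ => F.avg μ h x) ξ with hT
  have h1 : ∀ h ξ, F.levelMax μ n h ξ ≤ T h ξ := by
    intro h ξ
    refine iSup₂_le fun x hx => ?_
    exact ENNReal.le_tsum (f := fun x : {x // F.level x = n} =>
      (F.ballAt 32 x.1).indicator (fun _ => F.avg μ h x) ξ) ⟨x, hx⟩
  have h2 : ∀ h ξ, T h ξ ≤ N * F.levelMax μ n h ξ := by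
    intro h ξ
    set s : Set {x // F.level x = n} := {x | ξ ∈ F.ballAt 32 x.1} with hs
    have hsN : s.encard ≤ N := by
      refine le_trans ?_ (hN n ξ)
      refine encard_le_encard_of_injOn (f := Subtype.val) ?_ Subtype.val_injective.injOn
      intro x hx
      exact ⟨x.2, hx⟩
    calc T h ξ ≤ ∑' x, s.indicator (fun _ => F.levelMax μ n h ξ) x := by
          refine ENNReal.tsum_le_tsum fun x => ?_
          by_cases hx : ξ ∈ F.ballAt 32 x.1
          · rw [indicator_of_mem hx, indicator_of_mem (by exact hx)]
            have := avg_le_levelMax (μ := μ) hx h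
            rwa [x.2] at this
          · rw [indicator_of_notMem hx]; exact zero_le
      _ = s.encard * F.levelMax μ n h ξ := by rw [← tsum_subtype, ENNReal.tsum_set_const]
      _ ≤ _ := by
          gcongr
          have : ((s.encard : ℕ∞) : ℝ≥0∞) ≤ ((N : ℕ∞) : ℝ≥0∞) := by exact_mod_cast hsN
          simpa using this
  have h3 : ∀ h v : Z → ℝ≥0∞, Measurable v → ∫⁻ ξ, T h ξ * v ξ ∂μ =
      ∑' x : {x // F.level x = n}, F.avg μ h x * (F.avg μ v x * μ (F.ballAt 32 x.1)) := by
    intro h v hv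
    simp_rw [hT, ← ENNReal.tsum_mul_right]
    have hm : ∀ x : {x // F.level x = n}, Measurable fun ξ =>
        (F.ballAt 32 x.1).indicator (fun _ => F.avg μ h x) ξ * v ξ := fun x =>
      (measurable_const.indicator (hB _)).mul hv
    rw [lintegral_tsum fun x => (hm x).aemeasurable]
    congr 1; funext x
    rw [avg_mul_measure hμ, ← lintegral_const_mul _ hv, ← lintegral_indicator (hB _)]
    congr 1; funext ξ
    by_cases hξ : ξ ∈ F.ballAt 32 x.1
    · simp [hξ]
    · simp [hξ]
  calc ∫⁻ ξ, F.levelMax μ n f ξ * w ξ ∂μ ≤ ∫⁻ ξ, T f ξ * w ξ ∂μ := by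
        gcongr with ξ; exact h1 f ξ
    _ = ∫⁻ ξ, T w ξ * f ξ ∂μ := by
        rw [h3 f w hw, h3 w f hf]
        congr 1; funext x; ring
    _ ≤ ∫⁻ ξ, N * (f ξ * F.levelMax μ n w ξ) ∂μ := by
        refine lintegral_mono fun ξ => ?_
        calc T w ξ * f ξ ≤ N * F.levelMax μ n w ξ * f ξ := by gcongr; exact h2 w ξ
          _ = _ := by ring
    _ = _ := lintegral_const_mul _ (hf.mul (measurable_levelMax hμ n w))

/-- For a fixed level the operator is bounded even on `L¹`: moved onto the constant weight 1, it
gives at most 1. -/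
theorem lintegral_tsum_levelMax_le (hμ : IsDoublingWith μ Q) :
    ∃ C : ℝ≥0∞, C ≠ ∞ ∧ ∀ f : ℤ → Z → ℝ≥0∞, (∀ n, Measurable (f n)) →
      ∫⁻ ξ, ∑' n, F.levelMax μ n (f n) ξ ∂μ ≤ C * ∫⁻ ξ, ∑' n, f n ξ ∂μ := by
  obtain ⟨C, hC, h⟩ := F.lintegral_levelMax_mul_le hμ
  refine ⟨C, hC, fun f hf => ?_⟩
  rw [lintegral_tsum fun n => (measurable_levelMax hμ n _).aemeasurable,
    lintegral_tsum fun n => (hf n).aemeasurable, ← ENNReal.tsum_mul_left]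
  refine ENNReal.tsum_le_tsum fun n => ?_
  have := h n (f n) (fun _ => 1) (hf n) measurable_const
  simp only [mul_one] at this
  refine this.trans ?_
  gcongr with ξ
  refine mul_le_of_le_one_right' (levelMax_le fun x _ _ => ?_)
  rw [avg_const hμ]

/-- Duality: each operator is moved onto the test function `w`, where `maxFun` of `w` dominates all
levels simultaneously and is bounded on `L^{t'}`. For `t = 1` the previous lemma applies. -/
theorem lintegral_tsum_levelMax_rpow_le (hμ : IsDoublingWith μ Q) {t : ℝ} (ht : 1 ≤ t) :
    ∃ C : ℝ≥0∞, C ≠ ∞ ∧ ∀ f : ℤ → Z → ℝ≥0∞, (∀ n, Measurable (f n)) →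
      ∫⁻ ξ, (∑' n, F.levelMax μ n (f n) ξ) ^ t ∂μ ≤ C * ∫⁻ ξ, (∑' n, f n ξ) ^ t ∂μ := by
  rcases ht.eq_or_lt with rfl | ht
  · simpa using F.lintegral_tsum_levelMax_le hμ
  have := hμ.sigmaFinite
  set t' := t.conjExponent
  have htt' : t.HolderConjugate t' := Real.HolderConjugate.conjExponent ht
  obtain ⟨C, hC, h⟩ := F.lintegral_levelMax_mul_le hμ
  obtain ⟨C', hC', h'⟩ := F.lintegral_maxFun_rpow_le hμ htt'.symm.lt
  have h0 : 0 < t := htt'.pos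
  have h0' : 0 < t' := htt'.symm.pos
  refine ⟨(C * C' ^ (1 / t')) ^ t, ENNReal.rpow_ne_top_of_nonneg h0.le (ENNReal.mul_ne_top hC
    (ENNReal.rpow_ne_top_of_nonneg (by positivity) hC')), fun f hf => ?_⟩
  have hA : Measurable fun ξ => ∑' n, F.levelMax μ n (f n) ξ :=
    Measurable.tsum fun n => measurable_levelMax hμ n _
  have hφ : Measurable fun ξ => ∑' n, f n ξ := Measurable.tsum hf
  calc _ ≤ (C * C' ^ (1 / t') * (∫⁻ ξ, (∑' n, f n ξ) ^ t ∂μ) ^ (1 / t)) ^ t := by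
        refine lintegral_rpow_le_of_forall_lintegral_mul_le htt' hA fun w hw => ?_
        calc ∫⁻ ξ, (∑' n, F.levelMax μ n (f n) ξ) * w ξ ∂μ
            = ∑' n, ∫⁻ ξ, F.levelMax μ n (f n) ξ * w ξ ∂μ := by
              simp_rw [← ENNReal.tsum_mul_right]
              have hm : ∀ n, Measurable fun ξ => F.levelMax μ n (f n) ξ * w ξ := fun n =>
                (measurable_levelMax hμ n _).mul hw
              rw [lintegral_tsum fun n => (hm n).aemeasurable]
          _ ≤ ∑' n, C * ∫⁻ ξ, f n ξ * F.levelMax μ n w ξ ∂μ :=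
              ENNReal.tsum_le_tsum fun n => h n _ _ (hf n) hw
          _ ≤ ∑' n, C * ∫⁻ ξ, f n ξ * F.maxFun μ w ξ ∂μ := by
              gcongr with n ξ
              exact levelMax_le_maxFun n w ξ
          _ = C * ∫⁻ ξ, (∑' n, f n ξ) * F.maxFun μ w ξ ∂μ := by
              rw [ENNReal.tsum_mul_left]
              simp_rw [← ENNReal.tsum_mul_right]
              have hm : ∀ n, Measurable fun ξ => f n ξ * F.maxFun μ w ξ := fun n =>
                (hf n).mul (measurable_maxFun hμ w)
              rw [lintegral_tsum fun n => (hm n).aemeasurable]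
          _ ≤ C * ((∫⁻ ξ, (∑' n, f n ξ) ^ t ∂μ) ^ (1 / t) *
                (∫⁻ ξ, F.maxFun μ w ξ ^ t' ∂μ) ^ (1 / t')) := by
              gcongr
              exact ENNReal.lintegral_mul_le_Lp_mul_Lq μ htt' hφ.aemeasurable
                (measurable_maxFun hμ w).aemeasurable
          _ ≤ C * ((∫⁻ ξ, (∑' n, f n ξ) ^ t ∂μ) ^ (1 / t) *
                (C' * ∫⁻ ξ, w ξ ^ t' ∂μ) ^ (1 / t')) := by
              gcongr
              exact h' w hw
          _ = _ := by
              rw [ENNReal.mul_rpow_of_nonneg _ _ (by positivity)]; ring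
    _ = _ := by
        rw [ENNReal.mul_rpow_of_nonneg _ _ h0.le, ← ENNReal.rpow_mul _ (1 / t),
          one_div_mul_cancel h0.ne', ENNReal.rpow_one]

/-- The vector-valued maximal inequality below the diagonal. -/
theorem lintegral_tsum_levelMax_rpow_rpow_le (hμ : IsDoublingWith μ Q) {P q : ℝ} (hP : 1 < P)
    (hPq : P < q) :
    ∃ C : ℝ≥0∞, C ≠ ∞ ∧ ∀ c : ℤ → Z → ℝ≥0∞, (∀ n, Measurable (c n)) →
      ∫⁻ ξ, (∑' n, F.levelMax μ n (c n) ξ ^ q) ^ (P / q) ∂μ ≤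
        C * ∫⁻ ξ, (∑' n, c n ξ ^ q) ^ (P / q) ∂μ := by
  have hq : 1 < q := hP.trans hPq
  have hP0 : 0 < P := by linarith
  have hq0 : 0 < q := by linarith
  have hqP : 0 < q - P := by linarith
  have hq1 : 0 < q - 1 := by linarith
  -- With `α = 1 - P/q` and `φ = ∑ c_n^q`, both `∑ d_n ≤ φ^(P/q)` and `ψ^τ = φ^(P/q)` hold for the
  -- functions `d`, `ψ` introduced below. The condition `τ > 1` amounts to `P > 1`.
  set α : ℝ := (q - P) / q with hα
  set τ : ℝ := (q - 1) * P / (q - P) with hτ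
  have hτ1 : 1 < τ := by rw [hτ, one_lt_div hqP]; nlinarith
  obtain ⟨C₁, hC₁, h₁⟩ := F.lintegral_tsum_levelMax_le hμ
  obtain ⟨C₂, hC₂, h₂⟩ := F.lintegral_maxFun_rpow_le hμ hτ1
  -- The summand 1 makes the constant positive, so the case of an infinite right-hand side is
  -- trivial.
  refine ⟨C₁ ^ (P / q) * C₂ ^ α + 1, ?_, fun c hc => ?_⟩
  · exact ENNReal.add_ne_top.2 ⟨ENNReal.mul_ne_top (ENNReal.rpow_ne_top_of_nonneg (by positivity)
      hC₁) (ENNReal.rpow_ne_top_of_nonneg (by positivity) hC₂), by simp⟩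
  set φ : Z → ℝ≥0∞ := fun ξ => ∑' n, c n ξ ^ q with hφ
  have hφm : Measurable φ := Measurable.tsum fun n => (hc n).pow_const _
  set I := ∫⁻ ξ, φ ξ ^ (P / q) ∂μ with hI
  rcases eq_or_ne I ∞ with hItop | hItop
  · have : (C₁ ^ (P / q) * C₂ ^ α + 1) * I = ∞ := by
      rw [hItop]; exact ENNReal.mul_top (lt_of_lt_of_le one_pos le_add_self).ne'
    exact this ▸ le_top
  have hφtop : ∀ᵐ ξ ∂μ, φ ξ < ∞ := by
    filter_upwards [ae_lt_top (hφm.pow_const _) hItop] with ξ hξ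
    exact (ENNReal.rpow_lt_top_iff_of_pos (by positivity)).1 hξ
  set d : ℤ → Z → ℝ≥0∞ := fun n ξ => c n ξ ^ q * φ ξ ^ (-α) with hd
  have hdm : ∀ n, Measurable (d n) := fun n => ((hc n).pow_const _).mul (hφm.pow_const _)
  set ψ : Z → ℝ≥0∞ := fun ξ => φ ξ ^ (α / (q - 1)) with hψ
  have hψm : Measurable ψ := hφm.pow_const _
  set q' := q.conjExponent with hq'
  have hqq' : q.HolderConjugate q' := Real.HolderConjugate.conjExponent hq
  have hq'e : q' = q / (q - 1) := rfl
  have hq'0 : 0 < q' := hqq'.symm.pos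
  have hpt : ∀ n ξ, F.levelMax μ n (c n) ξ ^ q ≤
      F.levelMax μ n (d n) ξ * F.maxFun μ ψ ξ ^ (q - 1) := by
    intro n ξ
    have hle : F.levelMax μ n (c n) ξ ≤
        F.levelMax μ n (d n) ξ ^ (1 / q) * F.maxFun μ ψ ξ ^ (1 / q') := by
      refine levelMax_le fun x hx hξ => ?_
      -- The factorization that is fed into Hölder's inequality. Where `φ = 0`, `c_n` vanishes as
      -- well, and `φ = ∞` occurs only on a null set.
      have h1 : c n ≤ᵐ[μ] fun ξ => (c n ξ * φ ξ ^ (-α / q)) * φ ξ ^ (α / q) := by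
        filter_upwards [hφtop] with η hη
        rcases eq_or_ne (φ η) 0 with h0 | h0
        · have : c n η ^ q = 0 := by
            have := ENNReal.tsum_eq_zero.1 (show ∑' n, c n η ^ q = 0 from h0) n
            exact this
          rw [ENNReal.rpow_eq_zero_iff_of_pos hq0] at this
          rw [this]; exact zero_le
        · rw [mul_assoc, ← ENNReal.rpow_add _ _ h0 hη.ne]
          simp [neg_div]
      have h2 : ∀ ξ, (c n ξ * φ ξ ^ (-α / q)) ^ q = d n ξ := fun ξ => by
        rw [ENNReal.mul_rpow_of_nonneg _ _ hq0.le, ← ENNReal.rpow_mul,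
          div_mul_cancel₀ _ hq0.ne']
      have h3 : ∀ ξ, (φ ξ ^ (α / q)) ^ q' = ψ ξ := fun ξ => by
        rw [← ENNReal.rpow_mul]
        simp only [hψ, hq'e]
        congr 1; field_simp
      have h4 := avg_mul_le (F := F) (μ := μ) hqq' ((hc n).mul (hφm.pow_const (-α / q)))
        (hφm.pow_const (α / q)) x
      simp only [Pi.mul_apply, h2, h3] at h4
      refine (avg_mono_ae h1 x).trans (h4.trans ?_)
      gcongr
      · exact hx ▸ avg_le_levelMax hξ _
      · exact avg_le_maxFun hξ _
    calc _ ≤ (F.levelMax μ n (d n) ξ ^ (1 / q) * F.maxFun μ ψ ξ ^ (1 / q')) ^ q := by gcongr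
      _ = _ := by
          rw [ENNReal.mul_rpow_of_nonneg _ _ hq0.le, ← ENNReal.rpow_mul, ← ENNReal.rpow_mul,
            one_div_mul_cancel hq0.ne', ENNReal.rpow_one, hq'e]
          congr 2; field_simp
  have hdφ : ∀ ξ, ∑' n, d n ξ ≤ φ ξ ^ (P / q) := by
    intro ξ
    simp only [hd]
    rw [ENNReal.tsum_mul_right]
    change φ ξ * φ ξ ^ (-α) ≤ _
    rcases eq_or_ne (φ ξ) 0 with h0 | h0
    · simp [h0]
    rcases eq_or_ne (φ ξ) ∞ with htop | htop
    · rw [htop, ENNReal.top_rpow_of_pos (y := P / q) (by positivity)]; exact le_top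
    · nth_rewrite 1 [← ENNReal.rpow_one (φ ξ)]
      rw [← ENNReal.rpow_add _ _ h0 htop]
      refine le_of_eq ?_
      congr 1; rw [hα]; field_simp; ring
  -- With these exponents Hölder separates the `L¹` norm of `∑ M_n d_n` from the `L^τ` norm of the
  -- maximal function of `ψ`. Each is bounded in terms of `I`, with total power `P/q + α = 1`.
  have hconj : (q / P).HolderConjugate (1 / α) := by
    rw [Real.holderConjugate_iff]
    refine ⟨(one_lt_div hP0).2 hPq, ?_⟩
    rw [hα]; field_simp; ring
  have hψτ : ∀ ξ, ψ ξ ^ τ = φ ξ ^ (P / q) := fun ξ => by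
    simp only [hψ]
    rw [← ENNReal.rpow_mul, hα, hτ]
    congr 1; field_simp
  calc ∫⁻ ξ, (∑' n, F.levelMax μ n (c n) ξ ^ q) ^ (P / q) ∂μ
      ≤ ∫⁻ ξ, (∑' n, F.levelMax μ n (d n) ξ) ^ (P / q) *
          F.maxFun μ ψ ξ ^ ((q - 1) * (P / q)) ∂μ := by
        refine lintegral_mono fun ξ => ?_
        rw [ENNReal.rpow_mul, ← ENNReal.mul_rpow_of_nonneg _ _ (by positivity),
          ← ENNReal.tsum_mul_right]
        gcongr with n
        exact hpt n ξ
    _ ≤ (∫⁻ ξ, ((∑' n, F.levelMax μ n (d n) ξ) ^ (P / q)) ^ (q / P) ∂μ) ^ (1 / (q / P)) *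
          (∫⁻ ξ, (F.maxFun μ ψ ξ ^ ((q - 1) * (P / q))) ^ (1 / α) ∂μ) ^ (1 / (1 / α)) :=
        ENNReal.lintegral_mul_le_Lp_mul_Lq μ hconj
          ((Measurable.tsum fun n => measurable_levelMax hμ n _).pow_const _).aemeasurable
          ((measurable_maxFun hμ ψ).pow_const _).aemeasurable
    _ = (∫⁻ ξ, ∑' n, F.levelMax μ n (d n) ξ ∂μ) ^ (P / q) *
          (∫⁻ ξ, F.maxFun μ ψ ξ ^ τ ∂μ) ^ α := by
        simp_rw [← ENNReal.rpow_mul]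
        have e1 : P / q * (q / P) = 1 := by field_simp
        have e2 : (q - 1) * (P / q) * (1 / α) = τ := by rw [hα, hτ]; field_simp
        simp only [e1, e2, ENNReal.rpow_one, one_div_div, div_one]
    _ ≤ (C₁ * I) ^ (P / q) * (C₂ * I) ^ α := by
        gcongr
        · refine (h₁ d hdm).trans ?_
          exact mul_le_mul_right (lintegral_mono hdφ) _
        · refine (h₂ ψ hψm).trans ?_
          simp_rw [hψτ]
          exact le_rfl
    _ = C₁ ^ (P / q) * C₂ ^ α * I := by
        rw [ENNReal.mul_rpow_of_nonneg _ _ (by positivity),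
          ENNReal.mul_rpow_of_nonneg _ _ (by positivity)]
        have : I = I ^ (P / q) * I ^ α := by
          rw [← ENNReal.rpow_add_of_nonneg _ _ (by positivity) (by positivity)]
          have : P / q + α = 1 := by rw [hα]; field_simp; ring
          rw [this, ENNReal.rpow_one]
        nth_rewrite 3 [this]
        ring
    _ ≤ _ := by gcongr; exact le_self_add

/-- The vector-valued maximal inequality. -/
theorem lintegral_lqNorm_levelMax_le (hμ : IsDoublingWith μ Q) {P : ℝ} {q : ℝ≥0∞} (hP : 1 < P)
    (hq : 1 < q) :
    ∃ C : ℝ≥0∞, C ≠ ∞ ∧ ∀ c : ℤ → Z → ℝ≥0∞, (∀ n, Measurable (c n)) →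
      ∫⁻ ξ, lqNorm q (fun n => F.levelMax μ n (c n) ξ) ^ P ∂μ ≤
        C * ∫⁻ ξ, lqNorm q (fun n => c n ξ) ^ P ∂μ := by
  by_cases hqtop : q = ∞
  · obtain ⟨C, hC, h⟩ := F.lintegral_maxFun_rpow_le hμ hP
    refine ⟨C, hC, fun c hc => ?_⟩
    simp only [lqNorm, hqtop, if_true]
    refine le_trans ?_ (h (fun ξ => ⨆ n, c n ξ) (Measurable.iSup hc))
    gcongr with ξ
    refine iSup_le fun n => (levelMax_le_maxFun _ _ _).trans (maxFun_mono (fun η => ?_) ξ)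
    exact le_iSup (fun n => c n η) n
  set ρ := q.toReal with hρ
  have hρ1 : 1 < ρ := by
    rw [hρ, ← ENNReal.toReal_one]
    exact (ENNReal.toReal_lt_toReal (by simp) hqtop).2 hq
  have hρ0 : 0 < ρ := by linarith
  have key : ∃ C : ℝ≥0∞, C ≠ ∞ ∧ ∀ c : ℤ → Z → ℝ≥0∞, (∀ n, Measurable (c n)) →
      ∫⁻ ξ, (∑' n, F.levelMax μ n (c n) ξ ^ ρ) ^ (P / ρ) ∂μ ≤
        C * ∫⁻ ξ, (∑' n, c n ξ ^ ρ) ^ (P / ρ) ∂μ := by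
    rcases lt_or_ge P ρ with hPρ | hPρ
    · exact F.lintegral_tsum_levelMax_rpow_rpow_le hμ hP hPρ
    -- Jensen's inequality moves the power `ρ` inside the averages, leaving the outer exponent `P /
    -- ρ ≥ 1`.
    · obtain ⟨C, hC, h⟩ := F.lintegral_tsum_levelMax_rpow_le hμ ((one_le_div hρ0).2 hPρ)
      refine ⟨C, hC, fun c hc => le_trans ?_ (h (fun n ξ => c n ξ ^ ρ) fun n => (hc n).pow_const _)⟩
      gcongr with ξ n
      exact levelMax_rpow_le hμ hρ1 (hc n) n ξ
  have e : ∀ a : ℤ → ℝ≥0∞, lqNorm q a ^ P = (∑' n, a n ^ ρ) ^ (P / ρ) := fun a => by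
    unfold lqNorm
    rw [if_neg hqtop, ← ENNReal.rpow_mul, ← hρ, one_div_mul_eq_div]
  simpa only [e] using key

end HyperbolicFilling

end Measure

/-! ### Boundedness of the discrete derivative -/

theorem jNorm_le_mul {Z : Type*} [MeasurableSpace Z] {ι κ : Type*} {μ : Measure Z} {i : Indices}
    {lev : ι → ℤ} {A : ι → Set Z} {w : ι → ℝ≥0∞} {lev' : κ → ℤ} {A' : κ → Set Z} {w' : κ → ℝ≥0∞}
    {K : ℝ≥0∞} (hK : K ≠ ∞)
    (h : ∀ ξ, lqNorm i.q (fun k => (A k).indicator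
      (fun _ => (2 : ℝ≥0∞) ^ ((lev k : ℝ) * i.s) * w k) ξ) ≤
      K * lqNorm i.q (fun k => (A' k).indicator
      (fun _ => (2 : ℝ≥0∞) ^ ((lev' k : ℝ) * i.s) * w' k) ξ)) :
    jNorm μ i lev A w ≤ K * jNorm μ i lev' A' w' := by
  have hp := i.p_pos
  unfold jNorm
  calc _ ≤ (∫⁻ ξ, K ^ i.p * lqNorm i.q (fun k => (A' k).indicator
      (fun _ => (2 : ℝ≥0∞) ^ ((lev' k : ℝ) * i.s) * w' k) ξ) ^ i.p ∂μ) ^ (1 / i.p) := by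
        gcongr with ξ
        rw [← ENNReal.mul_rpow_of_nonneg _ _ hp.le]
        gcongr
        exact h ξ
    _ = _ := by
        rw [lintegral_const_mul' _ _ (ENNReal.rpow_ne_top_of_nonneg hp.le hK),
          ENNReal.mul_rpow_of_nonneg _ _ (by positivity), ← ENNReal.rpow_mul,
          mul_one_div_cancel hp.ne', ENNReal.rpow_one]

section Measure

variable {Z : Type*} [MetricSpace Z] [MeasurableSpace Z] [BorelSpace Z]
  {μ : Measure Z} {Q : ℝ} {X : Type*}

namespace HyperbolicFilling

variable {F : HyperbolicFilling Z X}

theorem enorm_sub_le_dAbs (v : X → ℂ) {x y : X} (h : F.graph.Adj x y) :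
    ‖v y - v x‖ₑ ≤ F.dAbs v x := by
  unfold dAbs
  rw [one_div, ENNReal.le_rpow_inv_iff (by norm_num)]
  exact ENNReal.le_tsum (f := fun y : {y : X // F.graph.Adj x y} => ‖v y - v x‖ₑ ^ (2 : ℝ)) ⟨y, h⟩

theorem dAbs_le (hμ : IsDoublingWith μ Q) : ∃ C : ℝ≥0∞, C ≠ ∞ ∧ ∀ (v : X → ℂ) (x : X) (b : ℝ≥0∞),
    (∀ y, F.graph.Adj x y → ‖v y - v x‖ₑ ≤ b) → F.dAbs v x ≤ C * b := by
  obtain ⟨N, hN⟩ := F.encard_adj_le hμ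
  refine ⟨(N : ℝ≥0∞) ^ (1 / 2 : ℝ), ENNReal.rpow_ne_top_of_nonneg (by norm_num) (by simp),
    fun v x b h => ?_⟩
  unfold dAbs
  calc _ ≤ (∑' _ : {y | F.graph.Adj x y}, b ^ (2 : ℝ)) ^ (1 / 2 : ℝ) := by
        refine ENNReal.rpow_le_rpow ?_ (by norm_num)
        refine ENNReal.tsum_le_tsum fun y => ?_
        gcongr
        exact h y y.2
    _ ≤ (N * b ^ (2 : ℝ)) ^ (1 / 2 : ℝ) := by
        rw [ENNReal.tsum_set_const]
        gcongr
        have : (({y | F.graph.Adj x y}.encard : ℕ∞) : ℝ≥0∞) ≤ ((N : ℕ∞) : ℝ≥0∞) := by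
          exact_mod_cast hN x
        simpa using this
    _ = _ := by
        rw [ENNReal.mul_rpow_of_nonneg _ _ (by norm_num), ← ENNReal.rpow_mul]
        norm_num

/-- The bound for `S`. A point of `B(e)` lies in the ball of an endpoint, whose level is at least
`|e|` and whose `|dv|` dominates the value on `e`. The edge is charged to this endpoint. -/
theorem edgeNorm_d_le (hμ : IsDoublingWith μ Q) (o : F.Orientation) (i : Indices) :
    ∃ C : ℝ≥0∞, C ≠ ∞ ∧ ∀ v : X → ℂ,
      o.edgeNorm μ i (o.d v) ≤ C * jNorm μ i F.level F.B (F.dAbs v) := by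
  obtain ⟨N, hN⟩ := F.encard_edge_le hμ o
  refine ⟨(N : ℝ≥0∞) ^ (1 / i.q.toReal), ENNReal.rpow_ne_top_of_nonneg (by positivity) (by simp),
    fun v => jNorm_le_mul (ENNReal.rpow_ne_top_of_nonneg (by positivity) (by simp)) fun ξ => ?_⟩
  refine lqNorm_le_of_rel i.q_pos (fun (e : o.Edge) x => e.1.1 = x ∨ e.1.2 = x) (fun e he => ?_) hN
  have hs := i.s_pos
  have hξ : ξ ∈ o.edgeB e := by
    by_contra h
    exact he (indicator_of_notMem h _)
  rw [indicator_of_mem hξ]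
  rcases hξ with hξ | hξ
  · refine ⟨e.1.1, Or.inl rfl, ?_⟩
    rw [indicator_of_mem hξ]
    gcongr
    · norm_num
    · exact min_le_left _ _
    · exact enorm_sub_le_dAbs v (o.adj e.2)
  · refine ⟨e.1.2, Or.inr rfl, ?_⟩
    rw [indicator_of_mem hξ]
    gcongr
    · norm_num
    · exact min_le_right _ _
    · have := enorm_sub_le_dAbs v (o.adj e.2).symm
      rwa [enorm_sub_rev] at this

end HyperbolicFilling

end Measure

/-! ### The level sums -/

theorem ofReal_two_zpow (n : ℤ) : ENNReal.ofReal ((2 : ℝ) ^ n) = (2 : ℝ≥0∞) ^ (n : ℝ) := by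
  rw [← Real.rpow_intCast, ← ENNReal.ofReal_rpow_of_pos (by norm_num)]; simp

theorem encard_coe_le {ι : Type*} {s : Set ι} {N : ℕ} (h : s.encard ≤ N) :
    ((s.encard : ℕ∞) : ℝ≥0∞) ≤ N := by
  have : ((s.encard : ℕ∞) : ℝ≥0∞) ≤ ((N : ℕ∞) : ℝ≥0∞) := by exact_mod_cast h
  simpa using this

/-- In the applications `f` and `g` are values of the partition functions at two points, and `S`,
`T` are the indices active there. A coefficient is controlled only at a point where its index is
active, which is why `a` and `b` are separate. -/
theorem enorm_tsum_mul_sub_tsum_mul_le {ι : Type*} {c f g : ι → ℂ} {S T : Set ι} {N : ℕ}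
    (hS : S.encard ≤ N) (hT : T.encard ≤ N) (hf : ∀ k ∉ S, f k = 0) (hg : ∀ k ∉ T, g k = 0)
    {D a b : ℝ≥0∞} (hD : ∀ k, ‖f k - g k‖ₑ ≤ D) (ha : ∀ k ∈ S, ‖c k‖ₑ ≤ a)
    (hb : ∀ k ∈ T, ‖c k‖ₑ ≤ b) :
    ‖∑' k, c k * f k - ∑' k, c k * g k‖ₑ ≤ N * D * (a + b) := by
  have hsf : Summable fun k => c k * f k := summable_of_hasFiniteSupport
    ((finite_of_encard_le_coe hS).subset fun k hk => by
      by_contra h; exact hk (by simp [hf k h]))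
  have hsg : Summable fun k => c k * g k := summable_of_hasFiniteSupport
    ((finite_of_encard_le_coe hT).subset fun k hk => by
      by_contra h; exact hk (by simp [hg k h]))
  rw [← hsf.tsum_sub hsg]
  calc _ ≤ ∑' k, ‖c k * f k - c k * g k‖ₑ := enorm_tsum_le_tsum_enorm
    _ ≤ ∑' k, (S.indicator (fun _ => a * D) k + T.indicator (fun _ => b * D) k) := by
        refine ENNReal.tsum_le_tsum fun k => ?_
        rw [← mul_sub, enorm_mul]
        by_cases h : k ∈ S
        · rw [indicator_of_mem h]
          refine le_trans ?_ le_self_add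
          gcongr
          · exact ha k h
          · exact hD k
        by_cases h' : k ∈ T
        · rw [indicator_of_mem h']
          refine le_trans ?_ le_add_self
          gcongr
          · exact hb k h'
          · exact hD k
        · simp [hf k h, hg k h']
    _ = S.encard * (a * D) + T.encard * (b * D) := by
        rw [ENNReal.tsum_add, ← tsum_subtype, ← tsum_subtype, ENNReal.tsum_set_const,
          ENNReal.tsum_set_const]
    _ ≤ N * (a * D) + N * (b * D) := by
        gcongr
        · exact encard_coe_le hS
        · exact encard_coe_le hT
    _ = _ := by ring

namespace HyperbolicFilling

variable {Z : Type*} [MetricSpace Z] {X : Type*} {F : HyperbolicFilling Z X}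

/-- The largest weight of a vertex of level `n` at a point. -/
def levelSup (F : HyperbolicFilling Z X) (a : X → ℝ≥0∞) (n : ℤ) (ξ : Z) : ℝ≥0∞ :=
  ⨆ (x : X) (_ : F.level x = n), (F.B x).indicator (fun _ => a x) ξ

theorem le_levelSup {x : X} {ξ : Z} (h : ξ ∈ F.B x) (a : X → ℝ≥0∞) :
    a x ≤ F.levelSup a (F.level x) ξ := by
  unfold levelSup
  refine le_trans ?_ (le_iSup₂ (f := fun (y : X) (_ : F.level y = F.level x) =>
    (F.B y).indicator (fun _ => a y) ξ) x rfl)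
  rw [indicator_of_mem h]

theorem levelSup_le {a : X → ℝ≥0∞} {n : ℤ} {ξ : Z} {c : ℝ≥0∞}
    (h : ∀ x, F.level x = n → ξ ∈ F.B x → a x ≤ c) : F.levelSup a n ξ ≤ c :=
  iSup₂_le fun x hx => by
    by_cases hξ : ξ ∈ F.B x
    · rw [indicator_of_mem hξ]; exact h x hx hξ
    · rw [indicator_of_notMem hξ]; exact zero_le

theorem levelSup_eq_zero {a : X → ℝ≥0∞} {n : ℤ} (h : ¬ F.Admissible n) (ξ : Z) :
    F.levelSup a n ξ = 0 :=
  nonpos_iff_eq_zero.1 (levelSup_le fun x hx _ => absurd (hx ▸ F.admissible_level x) h)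

namespace Orientation

variable (o : F.Orientation)

/-- The largest value of an edge function on the edges from `x` to the next level. -/
def upWeight (u : o.Edge → ℂ) (x : X) : ℝ≥0∞ :=
  ⨆ (e : o.Edge) (_ : e.1.1 = x ∧ F.level e.1.2 = F.level x + 1), ‖u e‖ₑ

/-- The edges from the level `n` to the next one. -/
abbrev UpEdge (n : ℤ) : Type _ := {e : o.Edge // F.level e.1.1 = n ∧ F.level e.1.2 = n + 1}

variable {o}

theorem enorm_le_upWeight (u : o.Edge → ℂ) {n : ℤ} (e : o.UpEdge n) :
    ‖u e.1‖ₑ ≤ o.upWeight u e.1.1.1 := by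
  unfold upWeight
  exact le_iSup₂ (f := fun (e' : o.Edge)
    (_ : e'.1.1 = e.1.1.1 ∧ F.level e'.1.2 = F.level e.1.1.1 + 1) => ‖u e'‖ₑ) e.1
    ⟨rfl, by rw [e.2.1, e.2.2]⟩

theorem enorm_le_levelSup (u : o.Edge → ℂ) {n : ℤ} (e : o.UpEdge n) {ξ : Z}
    (h : ξ ∈ F.B e.1.1.1) : ‖u e.1‖ₑ ≤ F.levelSup (o.upWeight u) n ξ :=
  (enorm_le_upWeight u e).trans ((le_levelSup h _).trans_eq (by rw [e.2.1]))

/-- An edge from a vertex `x` of level `n` to the next level has `|e| = n` and `B(x) ⊆ B(e)`, so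
`levelSup` is a supremum over part of the fibre of `edgeLevel` over `n`. -/
theorem lqNorm_levelSup_le (i : Indices) (u : o.Edge → ℂ) (ξ : Z) :
    lqNorm i.q (fun n : ℤ => (2 : ℝ≥0∞) ^ ((n : ℝ) * i.s) * F.levelSup (o.upWeight u) n ξ) ≤
      lqNorm i.q (fun e : o.Edge => (o.edgeB e).indicator
        (fun _ => (2 : ℝ≥0∞) ^ ((o.edgeLevel e : ℝ) * i.s) * ‖u e‖ₑ) ξ) := by
  refine lqNorm_iSup_fiber_le i.q_pos o.edgeLevel fun n => ?_
  unfold levelSup upWeight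
  simp_rw [ENNReal.mul_iSup]
  refine iSup₂_le fun x hx => ?_
  by_cases hξ : ξ ∈ F.B x
  · rw [indicator_of_mem hξ]
    simp_rw [ENNReal.mul_iSup]
    refine iSup₂_le fun e he => ?_
    have hlev : o.edgeLevel e = n := by
      unfold edgeLevel
      rw [he.1, he.2, hx]; omega
    refine le_trans ?_ (le_iSup₂ (f := fun (e : o.Edge) (_ : o.edgeLevel e = n) =>
      (o.edgeB e).indicator (fun _ => (2 : ℝ≥0∞) ^ ((o.edgeLevel e : ℝ) * i.s) * ‖u e‖ₑ) ξ) e hlev)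
    rw [indicator_of_mem (by exact Or.inl (he.1 ▸ hξ)), hlev]
  · rw [indicator_of_notMem hξ]; simp

end Orientation

namespace PartitionOfUnity

variable (ψ : F.PartitionOfUnity)

theorem mem_B_of_ne_zero {x : X} {ξ : Z} (h : ψ.toFun x ξ ≠ 0) : ξ ∈ F.B x :=
  ψ.support_subset x h

theorem le_one (x : X) (ξ : Z) : ψ.toFun x ξ ≤ 1 :=
  le_hasSum (ψ.hasSum_one (F.level x) (F.admissible_level x) ξ) ⟨x, rfl⟩ fun y _ => ψ.nonneg y ξ

theorem enorm_eq (x : X) (ξ : Z) : ‖(ψ.toFun x ξ : ℂ)‖ₑ = ENNReal.ofReal (ψ.toFun x ξ) := by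
  rw [← ofReal_norm, Complex.norm_real, Real.norm_of_nonneg (ψ.nonneg x ξ)]

theorem tsum_enorm_le_one (n : ℤ) (ξ : Z) :
    ∑' x : {x : X // F.level x = n}, ‖(ψ.toFun x ξ : ℂ)‖ₑ ≤ 1 := by
  by_cases h : F.Admissible n
  · have h1 := ψ.hasSum_one n h ξ
    simp_rw [enorm_eq]
    rw [← ENNReal.ofReal_tsum_of_nonneg (fun x : {x : X // F.level x = n} => ψ.nonneg x ξ)
      h1.summable, h1.tsum_eq]
    simp
  · have : IsEmpty {x : X // F.level x = n} := ⟨fun x => h (x.2 ▸ F.admissible_level x.1)⟩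
    simp

theorem continuous (x : X) : Continuous (ψ.toFun x) := by
  obtain ⟨L, hL, h⟩ := ψ.lipschitz
  refine (LipschitzWith.of_dist_le_mul (K := (L * (2 : ℝ) ^ F.level x).toNNReal)
    fun ξ η => ?_).continuous
  rw [Real.dist_eq, Real.coe_toNNReal _ (by positivity)]
  exact h x ξ η

theorem exists_enorm_sub_le : ∃ L : ℝ≥0∞, L ≠ ∞ ∧ ∀ (x : X) (ξ η : Z),
    ‖(ψ.toFun x ξ : ℂ) - (ψ.toFun x η : ℂ)‖ₑ ≤ L * (2 : ℝ≥0∞) ^ (F.level x : ℝ) * edist ξ η := by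
  obtain ⟨L, hL, h⟩ := ψ.lipschitz
  refine ⟨ENNReal.ofReal L, by simp, fun x ξ η => ?_⟩
  rw [← ofReal_two_zpow, edist_dist, ← ENNReal.ofReal_mul hL, ← ENNReal.ofReal_mul (by positivity),
    ← ofReal_norm, ← Complex.ofReal_sub, Complex.norm_real, Real.norm_eq_abs]
  exact ENNReal.ofReal_le_ofReal (h x ξ η)

theorem exists_enorm_mul_sub_le : ∃ L : ℝ≥0∞, L ≠ ∞ ∧ ∀ (x y : X) (ξ η : Z),
    F.level y = F.level x + 1 →
    ‖(ψ.toFun x ξ : ℂ) * (ψ.toFun y ξ : ℂ) - (ψ.toFun x η : ℂ) * (ψ.toFun y η : ℂ)‖ₑ ≤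
      L * ((2 : ℝ≥0∞) ^ (F.level x : ℝ) * edist ξ η) := by
  obtain ⟨L, hL, h⟩ := ψ.exists_enorm_sub_le
  -- By the product rule, `3 = 1 + 2`: the factor of the finer level has twice the Lipschitz bound.
  refine ⟨3 * L, ENNReal.mul_ne_top (by simp) hL, fun x y ξ η hxy => ?_⟩
  have h1 : ∀ z ζ, ‖(ψ.toFun z ζ : ℂ)‖ₑ ≤ 1 := fun z ζ => by
    rw [enorm_eq]; exact ENNReal.ofReal_le_one.2 (ψ.le_one z ζ)
  have h2 : (2 : ℝ≥0∞) ^ (F.level y : ℝ) = 2 * (2 : ℝ≥0∞) ^ (F.level x : ℝ) := by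
    rw [hxy]; push_cast
    rw [ENNReal.rpow_add _ _ (by simp) (by simp), ENNReal.rpow_one, mul_comm]
  calc _ = ‖((ψ.toFun x ξ : ℂ) - ψ.toFun x η) * ψ.toFun y ξ +
        ψ.toFun x η * ((ψ.toFun y ξ : ℂ) - ψ.toFun y η)‖ₑ := by congr 1; ring
    _ ≤ ‖(ψ.toFun x ξ : ℂ) - ψ.toFun x η‖ₑ * ‖(ψ.toFun y ξ : ℂ)‖ₑ +
        ‖(ψ.toFun x η : ℂ)‖ₑ * ‖(ψ.toFun y ξ : ℂ) - ψ.toFun y η‖ₑ := by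
        rw [← enorm_mul, ← enorm_mul]; exact enorm_add_le _ _
    _ ≤ L * (2 : ℝ≥0∞) ^ (F.level x : ℝ) * edist ξ η * 1 +
        1 * (L * (2 : ℝ≥0∞) ^ (F.level y : ℝ) * edist ξ η) := by
        gcongr
        · exact h _ _ _
        · exact h1 _ _
        · exact h1 _ _
        · exact h _ _ _
    _ = _ := by rw [h2]; ring

end PartitionOfUnity

section Sums

variable {o : F.Orientation} (ψ : F.PartitionOfUnity) (u : o.Edge → ℂ)

/-- The products `ψ_y ψ_{y'}` over all pairs sum to at most `1 * 1`, and a coefficient matters only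
when `ξ ∈ B(y)`. -/
theorem enorm_levelSum_le (n : ℤ) (ξ : Z) :
    ‖levelSum o ψ u n ξ‖ₑ ≤ F.levelSup (o.upWeight u) n ξ := by
  unfold levelSum
  set b := F.levelSup (o.upWeight u) n ξ
  set P : {x : X // F.level x = n} → {x : X // F.level x = n + 1} → ℝ≥0∞ := fun x y =>
    ‖(ψ.toFun x ξ : ℂ)‖ₑ * ‖(ψ.toFun y ξ : ℂ)‖ₑ with hP
  have hinj : Function.Injective fun e : o.UpEdge n =>
      ((⟨e.1.1.1, e.2.1⟩, ⟨e.1.1.2, e.2.2⟩) :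
        {x : X // F.level x = n} × {x : X // F.level x = n + 1}) := by
    intro e e' h
    simp only [Prod.mk.injEq, Subtype.mk.injEq] at h
    exact Subtype.ext (Subtype.ext (Prod.ext h.1 h.2))
  calc _ ≤ ∑' e : o.UpEdge n, ‖u e.1 * (ψ.toFun e.1.1.1 ξ : ℂ) * (ψ.toFun e.1.1.2 ξ : ℂ)‖ₑ :=
        enorm_tsum_le_tsum_enorm
    _ ≤ ∑' e : o.UpEdge n, b * P ⟨e.1.1.1, e.2.1⟩ ⟨e.1.1.2, e.2.2⟩ := by
        refine ENNReal.tsum_le_tsum fun e => ?_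
        rw [enorm_mul, enorm_mul, mul_assoc]
        by_cases h : ψ.toFun e.1.1.1 ξ = 0
        · simp [h]
        · gcongr
          exact o.enorm_le_levelSup u e (ψ.mem_B_of_ne_zero h)
    _ ≤ b * ∑' p : {x : X // F.level x = n} × {x : X // F.level x = n + 1}, P p.1 p.2 := by
        rw [ENNReal.tsum_mul_left]
        gcongr
        exact ENNReal.tsum_comp_le_tsum_of_injective hinj fun p => P p.1 p.2
    _ ≤ b * 1 := by
        gcongr
        rw [ENNReal.tsum_prod]
        simp_rw [hP, ENNReal.tsum_mul_left, ENNReal.tsum_mul_right]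
        exact mul_le_one' (ψ.tsum_enorm_le_one n ξ) (ψ.tsum_enorm_le_one (n + 1) ξ)
    _ = b := mul_one _

theorem levelSum_smul (c : ℂ) (n : ℤ) (ξ : Z) :
    levelSum o ψ (c • u) n ξ = c * levelSum o ψ u n ξ := by
  unfold levelSum
  rw [← tsum_mul_left]
  congr 1; funext e
  simp only [Pi.smul_apply, smul_eq_mul]; ring

end Sums

/-! ### Measurability and continuity estimates for the level sums -/

section Measure

variable [MeasurableSpace Z] [BorelSpace Z] {μ : Measure Z} {Q : ℝ}

theorem measurable_levelSup (hμ : IsDoublingWith μ Q) (a : X → ℝ≥0∞) (n : ℤ) :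
    Measurable (F.levelSup a n) := by
  have := F.countable hμ
  exact Measurable.iSup fun x => Measurable.iSup fun _ =>
    measurable_const.indicator (F.measurableSet_B x)

theorem encard_upEdge_le (hμ : IsDoublingWith μ Q) (o : F.Orientation) :
    ∃ N : ℕ, ∀ (n : ℤ) (ξ : Z),
      {e : o.UpEdge n | ξ ∈ F.B e.1.1.1 ∧ ξ ∈ F.B e.1.1.2}.encard ≤ N := by
  obtain ⟨N, hN⟩ := F.encard_mem_B_le hμ
  refine ⟨N * N, fun n ξ => ?_⟩
  calc _ ≤ ({x : X | F.level x = n ∧ ξ ∈ F.B x} ×ˢ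
        {x : X | F.level x = n + 1 ∧ ξ ∈ F.B x}).encard := by
        refine encard_le_encard_of_injOn (f := fun e : o.UpEdge n => e.1.1) ?_ ?_
        · rintro e ⟨h, h'⟩
          exact ⟨⟨e.2.1, h⟩, ⟨e.2.2, h'⟩⟩
        · intro e _ e' _ h
          exact Subtype.ext (Subtype.ext h)
    _ ≤ _ := by
        rw [encard_prod]
        push_cast
        exact mul_le_mul' (hN _ _) (hN _ _)

theorem finite_support_upEdge (hμ : IsDoublingWith μ Q) {o : F.Orientation}
    (ψ : F.PartitionOfUnity) (n : ℤ) (ξ : Z) : (Function.support fun e : o.UpEdge n =>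
      (ψ.toFun e.1.1.1 ξ : ℂ) * (ψ.toFun e.1.1.2 ξ : ℂ)).Finite := by
  obtain ⟨N, hN⟩ := encard_upEdge_le hμ o
  refine (finite_of_encard_le_coe (hN n ξ)).subset fun e he => ?_
  have h1 := left_ne_zero_of_mul he
  have h2 := right_ne_zero_of_mul he
  exact ⟨ψ.mem_B_of_ne_zero (by exact_mod_cast h1), ψ.mem_B_of_ne_zero (by exact_mod_cast h2)⟩

theorem summable_levelSum (hμ : IsDoublingWith μ Q) {o : F.Orientation}
    (ψ : F.PartitionOfUnity) (u : o.Edge → ℂ) (n : ℤ) (ξ : Z) : Summable fun e : o.UpEdge n =>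
      u e.1 * (ψ.toFun e.1.1.1 ξ : ℂ) * (ψ.toFun e.1.1.2 ξ : ℂ) :=
  summable_of_hasFiniteSupport ((finite_support_upEdge hμ ψ n ξ).subset fun _ he h =>
    he ((mul_assoc _ _ _).trans ((congrArg _ h).trans (mul_zero _))))

theorem levelSum_add (hμ : IsDoublingWith μ Q) {o : F.Orientation} (ψ : F.PartitionOfUnity)
    (u v : o.Edge → ℂ) (n : ℤ) (ξ : Z) :
    levelSum o ψ (u + v) n ξ = levelSum o ψ u n ξ + levelSum o ψ v n ξ := by
  unfold levelSum
  rw [← (summable_levelSum hμ ψ u n ξ).tsum_add (summable_levelSum hμ ψ v n ξ)]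
  congr 1; funext e
  simp only [Pi.add_apply]; ring

theorem enorm_levelSum_sub_le (hμ : IsDoublingWith μ Q) (o : F.Orientation)
    (ψ : F.PartitionOfUnity) : ∃ C : ℝ≥0∞, C ≠ ∞ ∧ ∀ (u : o.Edge → ℂ) (n : ℤ) (ξ η : Z),
      ‖levelSum o ψ u n ξ - levelSum o ψ u n η‖ₑ ≤ C * ((2 : ℝ≥0∞) ^ (n : ℝ) * edist ξ η) *
        (F.levelSup (o.upWeight u) n ξ + F.levelSup (o.upWeight u) n η) := by
  obtain ⟨N, hN⟩ := encard_upEdge_le hμ o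
  obtain ⟨L, hL, h⟩ := ψ.exists_enorm_mul_sub_le
  refine ⟨N * L, ENNReal.mul_ne_top (by simp) hL, fun u n ξ η => ?_⟩
  unfold levelSum
  simp_rw [mul_assoc (u _)]
  rw [mul_assoc (N : ℝ≥0∞)]
  have hz : ∀ ζ, ∀ e ∉ {e : o.UpEdge n | ζ ∈ F.B e.1.1.1 ∧ ζ ∈ F.B e.1.1.2},
      (ψ.toFun e.1.1.1 ζ : ℂ) * (ψ.toFun e.1.1.2 ζ : ℂ) = 0 := by
    intro ζ e he
    by_contra hne
    have h1 := left_ne_zero_of_mul hne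
    have h2 := right_ne_zero_of_mul hne
    exact he ⟨ψ.mem_B_of_ne_zero (by exact_mod_cast h1), ψ.mem_B_of_ne_zero (by exact_mod_cast h2)⟩
  refine enorm_tsum_mul_sub_tsum_mul_le (hN n ξ) (hN n η) (hz ξ) (hz η) (fun e => ?_)
    (fun e he => o.enorm_le_levelSup u e he.1) (fun e he => o.enorm_le_levelSup u e he.1)
  have := h e.1.1.1 e.1.1.2 ξ η (by rw [e.2.1, e.2.2])
  rwa [e.2.1] at this

theorem measurable_levelSum (hμ : IsDoublingWith μ Q) {o : F.Orientation}
    (ψ : F.PartitionOfUnity) (u : o.Edge → ℂ) (n : ℤ) : Measurable (levelSum o ψ u n) := by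
  have : Countable X := F.countable hμ
  have : Countable o.Edge := Subtype.countable
  have hm : ∀ x, Measurable fun ξ => (ψ.toFun x ξ : ℂ) := fun x =>
    Complex.measurable_ofReal.comp (ψ.continuous x).measurable
  refine measurable_of_tendsto_metrizable' (atTop : Filter (Finset (o.UpEdge n)))
    (f := fun s ξ => ∑ e ∈ s, u e.1 * (ψ.toFun e.1.1.1 ξ : ℂ) * (ψ.toFun e.1.1.2 ξ : ℂ))
    (fun s => Finset.measurable_sum _ fun e _ =>
      (measurable_const.mul (hm _)).mul (hm _)) (tendsto_pi_nhds.2 fun ξ => ?_)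
  exact (summable_levelSum hμ ψ u n ξ).hasSum

end Measure

end HyperbolicFilling

/-! ### Local estimates for sequences of weights -/

namespace HyperbolicFilling

variable {Z : Type*} [MetricSpace Z] [MeasurableSpace Z] [BorelSpace Z]
  {μ : Measure Z} {Q : ℝ} {X : Type*} (F : HyperbolicFilling Z X)

/-- The normalized power `(2 ^ (n s) b_n) ^ r` of the largest weight of level `n`. -/
def scaledSup (a : X → ℝ≥0∞) (s r : ℝ) (n : ℤ) (ξ : Z) : ℝ≥0∞ :=
  ((2 : ℝ≥0∞) ^ ((n : ℝ) * s) * F.levelSup a n ξ) ^ r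

/-- The summand of `oscSum`. -/
def oscTerm (μ : Measure Z) (a : X → ℝ≥0∞) (s r : ℝ) (m n : ℤ) (ξ : Z) : ℝ≥0∞ :=
  F.levelMax μ (min m n) (F.scaledSup a s r n) ξ ^ (1 / r)

/-- The quantity that controls oscillations at the scale `2 ^ (-m)`. -/
def oscSum (μ : Measure Z) (a : X → ℝ≥0∞) (s r ε : ℝ) (m : ℤ) (ξ : Z) : ℝ≥0∞ :=
  ∑' n : ℤ, geomWeight ε (n - m) * F.oscTerm μ a s r m n ξ

variable {F}

theorem geomWeight_mul_oscTerm_le (a : X → ℝ≥0∞) (s r ε : ℝ) (m n : ℤ) (ξ : Z) :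
    geomWeight ε (n - m) * F.oscTerm μ a s r m n ξ ≤ F.oscSum μ a s r ε m ξ :=
  ENNReal.le_tsum (f := fun n => geomWeight ε (n - m) * F.oscTerm μ a s r m n ξ) n

theorem measurable_scaledSup (hμ : IsDoublingWith μ Q) (a : X → ℝ≥0∞) (s r : ℝ) (n : ℤ) :
    Measurable (F.scaledSup a s r n) :=
  ((measurable_levelSup hμ a n).const_mul _).pow_const _

variable (F)

/-- On `B(y)` the function `levelSup` is at least `a y`. So the left-hand side is bounded by an
average over `B(y)`, and enlarging the domain to `ballAt 32 x` costs the ratio of the measures. -/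
theorem rpow_le_avg_scaledSup (hμ : IsDoublingWith μ Q) {r : ℝ} (hr : 0 < r) :
    ∃ C : ℝ≥0∞, C ≠ ∞ ∧ ∀ (a : X → ℝ≥0∞) (s : ℝ) (x y : X), F.level x ≤ F.level y →
      F.B y ⊆ F.ballAt 32 x → ((2 : ℝ≥0∞) ^ ((F.level y : ℝ) * s) * a y) ^ r ≤
        C * (2 : ℝ≥0∞) ^ (((F.level y : ℝ) - F.level x) * Q) *
          F.avg μ (F.scaledSup a s r (F.level y)) x := by
  obtain ⟨C, hC, h⟩ := F.measure_ballAt_le hμ (K := 32) (by norm_num)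
  refine ⟨C, hC, fun a s x y hl hsub => ?_⟩
  have h1 := h x y hl (by rw [dist_comm]; exact hsub (F.center_mem_B y))
  set v := ((2 : ℝ≥0∞) ^ ((F.level y : ℝ) * s) * a y) ^ r
  set c := F.scaledSup a s r (F.level y)
  set D := C * (2 : ℝ≥0∞) ^ (((F.level y : ℝ) - F.level x) * Q)
  have h2 : v * μ (F.B y) ≤ D * F.avg μ c x * μ (F.B y) := by
    calc v * μ (F.B y) = ∫⁻ _ in F.B y, v ∂μ := (setLIntegral_const _ _).symm
      _ ≤ ∫⁻ η in F.B y, c η ∂μ := by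
          refine setLIntegral_mono' (F.measurableSet_B y) fun η hη => ?_
          refine ENNReal.rpow_le_rpow ?_ hr.le
          gcongr
          exact le_levelSup hη a
      _ ≤ ∫⁻ η in F.ballAt 32 x, c η ∂μ := lintegral_mono_set hsub
      _ = F.avg μ c x * μ (F.ballAt 32 x) := (avg_mul_measure hμ c x).symm
      _ ≤ F.avg μ c x * (D * μ (F.B y)) := by gcongr
      _ = _ := by ring
  exact (ENNReal.mul_le_mul_iff_left (F.measure_B_pos hμ y).ne' (F.measure_B_lt_top hμ y).ne).1 h2

/-- The weights of coarse levels are controlled near a vertex. -/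
theorem levelSup_le_oscTerm (hμ : IsDoublingWith μ Q) {r : ℝ} (hr : 0 < r) :
    ∃ C : ℝ≥0∞, C ≠ ∞ ∧ ∀ (a : X → ℝ≥0∞) (s : ℝ) (x : X) (n : ℤ) (ξ η : Z), n ≤ F.level x →
      ξ ∈ F.B x → η ∈ F.ballAt 16 x →
      (2 : ℝ≥0∞) ^ ((n : ℝ) * s) * F.levelSup a n η ≤ C * F.oscTerm μ a s r (F.level x) n ξ := by
  obtain ⟨C, hC, h⟩ := F.rpow_le_avg_scaledSup hμ hr
  refine ⟨C ^ (1 / r), ENNReal.rpow_ne_top_of_nonneg (by positivity) hC,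
    fun a s x n ξ η hn hξ hη => ?_⟩
  by_cases hadm : F.Admissible n
  -- The average is taken around a vertex `z` of the same level `n` that contains `ξ`, so the
  -- comparison of measures costs no power of 2.
  · obtain ⟨z, hz, hξz⟩ := hadm.exists_mem_B ξ
    unfold levelSup
    simp_rw [ENNReal.mul_iSup]
    refine iSup₂_le fun y hy => ?_
    by_cases hηy : η ∈ F.B y
    · rw [indicator_of_mem hηy]
      have hηz : η ∈ F.ballAt 28 z := mem_ballAt_of_level_le (by omega) hξz hξ hη
      have hsub := B_subset_ballAt_of_level_le (by omega) hηz hηy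
      have h1 := h a s z y (by omega) hsub
      rw [hy, hz, sub_self, zero_mul, ENNReal.rpow_zero, mul_one] at h1
      unfold oscTerm
      rw [min_eq_right hn, ← ENNReal.mul_rpow_of_nonneg _ _ (by positivity), one_div,
        ENNReal.le_rpow_inv_iff hr]
      refine h1.trans ?_
      gcongr
      have := avg_le_levelMax (μ := μ) (F.ballAt_mono (by norm_num) z
        (F.B_subset_ballAt_two z hξz)) (F.scaledSup a s r n)
      rwa [hz] at this
    · rw [indicator_of_notMem hηy]; simp
  · rw [levelSup_eq_zero hadm]; simp

/-- The averages of weights of fine levels are controlled near a vertex. -/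
theorem lintegral_levelSup_le_oscTerm (hμ : IsDoublingWith μ Q) {r : ℝ} (hr : 0 < r)
    (hr1 : r ≤ 1) :
    ∃ C : ℝ≥0∞, C ≠ ∞ ∧ ∀ (a : X → ℝ≥0∞) (s : ℝ) (x : X) (n : ℤ) (ξ : Z), F.level x ≤ n →
      ξ ∈ F.B x → (2 : ℝ≥0∞) ^ ((n : ℝ) * s) * ∫⁻ η in F.ballAt 16 x, F.levelSup a n η ∂μ ≤
        C * μ (F.ballAt 32 x) * (2 : ℝ≥0∞) ^ (((n : ℝ) - F.level x) * (Q * (1 / r - 1))) *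
          F.oscTerm μ a s r (F.level x) n ξ := by
  obtain ⟨C, hC, h⟩ := F.rpow_le_avg_scaledSup hμ hr
  have ht : 0 ≤ 1 / r - 1 := by rw [sub_nonneg, one_le_div hr]; exact hr1
  refine ⟨C ^ (1 / r - 1), ENNReal.rpow_ne_top_of_nonneg ht hC, fun a s x n ξ hn hξ => ?_⟩
  set c := F.scaledSup a s r n with hc
  set K := C * (2 : ℝ≥0∞) ^ (((n : ℝ) - F.level x) * Q) * F.avg μ c x with hK
  have hcK : ∀ η ∈ F.ballAt 16 x, c η ≤ K := by
    intro η hη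
    rw [hc, scaledSup, ← ENNReal.le_rpow_inv_iff hr]
    unfold levelSup
    simp_rw [ENNReal.mul_iSup]
    refine iSup₂_le fun y hy => ?_
    by_cases hηy : η ∈ F.B y
    · rw [indicator_of_mem hηy, ENNReal.le_rpow_inv_iff hr]
      have hsub := B_subset_ballAt_of_level_le (by omega)
        (F.ballAt_mono (show (16 : ℝ) ≤ 28 by norm_num) x hη) hηy
      have h1 := h a s x y (by omega) hsub
      rwa [hy] at h1
    · rw [indicator_of_notMem hηy]; simp
  -- Only the factor `c^(1/r-1)` is replaced with its supremum, while `c` itself is integrated. The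
  -- loss is then `2^((n-m)Q(1/r-1))` rather than `2^((n-m)Q/r)`, with `m` the level of `x`.
  have hsplit : ∀ η, (2 : ℝ≥0∞) ^ ((n : ℝ) * s) * F.levelSup a n η = c η ^ (1 / r - 1) * c η := by
    intro η
    nth_rewrite 2 [← ENNReal.rpow_one (c η)]
    rw [← ENNReal.rpow_add_of_nonneg _ _ ht zero_le_one, hc, scaledSup, ← ENNReal.rpow_mul]
    rw [show r * (1 / r - 1 + 1) = 1 by field_simp; ring, ENNReal.rpow_one]
  calc _ = ∫⁻ η in F.ballAt 16 x, c η ^ (1 / r - 1) * c η ∂μ := by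
        rw [← lintegral_const_mul _ (measurable_levelSup hμ a n)]
        simp_rw [hsplit]
    _ ≤ ∫⁻ η in F.ballAt 16 x, K ^ (1 / r - 1) * c η ∂μ := by
        refine setLIntegral_mono' (F.isOpen_ballAt _ x).measurableSet fun η hη => ?_
        gcongr
        exact hcK η hη
    _ = K ^ (1 / r - 1) * ∫⁻ η in F.ballAt 16 x, c η ∂μ :=
        lintegral_const_mul _ (measurable_scaledSup hμ a s r n)
    _ ≤ K ^ (1 / r - 1) * (F.avg μ c x * μ (F.ballAt 32 x)) := by
        rw [avg_mul_measure hμ]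
        gcongr
        exact F.ballAt_mono (by norm_num) x
    _ = C ^ (1 / r - 1) * μ (F.ballAt 32 x) *
          (2 : ℝ≥0∞) ^ (((n : ℝ) - F.level x) * (Q * (1 / r - 1))) * F.avg μ c x ^ (1 / r) := by
        rw [hK, ENNReal.mul_rpow_of_nonneg _ _ ht, ENNReal.mul_rpow_of_nonneg _ _ ht,
          ← ENNReal.rpow_mul]
        have : F.avg μ c x ^ (1 / r) = F.avg μ c x ^ (1 / r - 1) * F.avg μ c x := by
          nth_rewrite 3 [← ENNReal.rpow_one (F.avg μ c x)]
          rw [← ENNReal.rpow_add_of_nonneg _ _ ht zero_le_one]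
          congr 1; ring
        rw [this]; ring_nf
    _ ≤ _ := by
        unfold oscTerm
        rw [min_eq_left hn]
        gcongr
        exact avg_le_levelMax (F.ballAt_mono (by norm_num) x (F.B_subset_ballAt_two x hξ)) _

/-- The local oscillation estimate: coarse levels. -/
theorem tsum_coarse_le_oscSum (hμ : IsDoublingWith μ Q) {r s ε : ℝ} (hr : 0 < r)
    (hε : ε ≤ 1 - s) :
    ∃ C : ℝ≥0∞, C ≠ ∞ ∧ ∀ (a : X → ℝ≥0∞) (x : X) (ξ η : Z), ξ ∈ F.B x → η ∈ F.ballAt 16 x →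
      (2 : ℝ≥0∞) ^ ((F.level x : ℝ) * s) * ∑' n : ℤ, (Iio (F.level x)).indicator
        (fun n : ℤ => (2 : ℝ≥0∞) ^ ((n : ℝ) - F.level x) * F.levelSup a n η) n ≤
        C * F.oscSum μ a s r ε (F.level x) ξ := by
  obtain ⟨C, hC, h⟩ := F.levelSup_le_oscTerm hμ hr
  refine ⟨C, hC, fun a x ξ η hξ hη => ?_⟩
  unfold oscSum
  rw [← ENNReal.tsum_mul_left, ← ENNReal.tsum_mul_left]
  refine ENNReal.tsum_le_tsum fun n => ?_
  by_cases hn : n < F.level x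
  · rw [indicator_of_mem (by exact hn)]
    have h1 := h a s x n ξ η hn.le hξ hη
    have hn' : (n : ℝ) < F.level x := by exact_mod_cast hn
    -- With `m` the level of `x`, `ms + (n - m) = ns + (n - m)(1 - s)`, and `1 - s ≥ ε` while `n <
    -- m`.
    have h2 : (2 : ℝ≥0∞) ^ ((F.level x : ℝ) * s) * (2 : ℝ≥0∞) ^ ((n : ℝ) - F.level x) ≤
        geomWeight ε (n - F.level x) * (2 : ℝ≥0∞) ^ ((n : ℝ) * s) := by
      unfold geomWeight
      rw [← ENNReal.rpow_add _ _ (by simp) (by simp), ← ENNReal.rpow_add _ _ (by simp) (by simp)]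
      refine ENNReal.rpow_le_rpow_of_exponent_le (by norm_num) ?_
      push_cast
      rw [abs_of_neg (by linarith)]
      nlinarith
    calc _ = ((2 : ℝ≥0∞) ^ ((F.level x : ℝ) * s) * (2 : ℝ≥0∞) ^ ((n : ℝ) - F.level x)) *
          F.levelSup a n η := by ring
      _ ≤ (geomWeight ε (n - F.level x) * (2 : ℝ≥0∞) ^ ((n : ℝ) * s)) * F.levelSup a n η := by
          gcongr
      _ = geomWeight ε (n - F.level x) * ((2 : ℝ≥0∞) ^ ((n : ℝ) * s) * F.levelSup a n η) := by ring
      _ ≤ geomWeight ε (n - F.level x) * (C * F.oscTerm μ a s r (F.level x) n ξ) := by gcongr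
      _ = _ := by ring
  · rw [indicator_of_notMem (by exact hn)]; simp

/-- The local oscillation estimate: fine levels. -/
theorem lintegral_fine_le_oscSum (hμ : IsDoublingWith μ Q) {r s ε : ℝ} (hr : 0 < r) (hr1 : r ≤ 1)
    (hε : ε ≤ s - Q * (1 / r - 1)) :
    ∃ C : ℝ≥0∞, C ≠ ∞ ∧ ∀ (a : X → ℝ≥0∞) (x : X) (ξ : Z), ξ ∈ F.B x →
      (2 : ℝ≥0∞) ^ ((F.level x : ℝ) * s) * ∫⁻ η in F.ballAt 16 x, ∑' n : ℤ,
        (Ici (F.level x)).indicator (fun n : ℤ => F.levelSup a n η) n ∂μ ≤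
        C * μ (F.ballAt 32 x) * F.oscSum μ a s r ε (F.level x) ξ := by
  obtain ⟨C, hC, h⟩ := F.lintegral_levelSup_le_oscTerm hμ hr hr1
  refine ⟨C, hC, fun a x ξ hξ => ?_⟩
  have hm : ∀ n : ℤ, Measurable fun η =>
      (Ici (F.level x)).indicator (fun n : ℤ => F.levelSup a n η) n := by
    intro n
    by_cases hn : n ∈ Ici (F.level x)
    · simp only [indicator_of_mem hn]; exact measurable_levelSup hμ a n
    · simp only [indicator_of_notMem hn]; exact measurable_const
  unfold oscSum
  rw [lintegral_tsum fun n => (hm n).aemeasurable, ← ENNReal.tsum_mul_left,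
    ← ENNReal.tsum_mul_left]
  refine ENNReal.tsum_le_tsum fun n => ?_
  by_cases hn : F.level x ≤ n
  · have hn2 : n ∈ Ici (F.level x) := hn
    simp only [indicator_of_mem hn2]
    have h1 := h a s x n ξ hn hξ
    have hn' : (F.level x : ℝ) ≤ n := by exact_mod_cast hn
    set σ := Q * (1 / r - 1) with hσ
    have h2 : (2 : ℝ≥0∞) ^ ((F.level x : ℝ) * s) =
        (2 : ℝ≥0∞) ^ (-((n : ℝ) - F.level x) * s) * (2 : ℝ≥0∞) ^ ((n : ℝ) * s) := by
      rw [← ENNReal.rpow_add _ _ (by simp) (by simp)]; congr 1; ring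
    -- The smoothness gain `s` outweighs the loss `σ` from the passage to `r`-averages.
    have h3 : (2 : ℝ≥0∞) ^ (-((n : ℝ) - F.level x) * s) *
        (2 : ℝ≥0∞) ^ (((n : ℝ) - F.level x) * σ) ≤ geomWeight ε (n - F.level x) := by
      unfold geomWeight
      rw [← ENNReal.rpow_add _ _ (by simp) (by simp)]
      refine ENNReal.rpow_le_rpow_of_exponent_le (by norm_num) ?_
      push_cast
      rw [abs_of_nonneg (by linarith)]
      nlinarith
    rw [h2, mul_assoc]
    calc _ ≤ (2 : ℝ≥0∞) ^ (-((n : ℝ) - F.level x) * s) * (C * μ (F.ballAt 32 x) *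
          (2 : ℝ≥0∞) ^ (((n : ℝ) - F.level x) * σ) * F.oscTerm μ a s r (F.level x) n ξ) := by
          gcongr
      _ = C * μ (F.ballAt 32 x) * (((2 : ℝ≥0∞) ^ (-((n : ℝ) - F.level x) * s) *
          (2 : ℝ≥0∞) ^ (((n : ℝ) - F.level x) * σ)) * F.oscTerm μ a s r (F.level x) n ξ) := by ring
      _ ≤ _ := by gcongr
  · have hn2 : n ∉ Ici (F.level x) := hn
    simp only [indicator_of_notMem hn2, lintegral_zero, mul_zero]
    exact zero_le

/-- The averages involve only balls of level at most `m` that contain `ξ`, whose measures are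
bounded below, and `V^r ≤ 1 + V^p`. All terms are thus bounded uniformly in `n`. Finiteness at every
point, not just almost every one, is needed because arbitrary base points and centers of vertices
are inserted later. -/
theorem oscSum_ne_top (hμ : IsDoublingWith μ Q) {r s ε p : ℝ} (hr : 0 < r) (hε : 0 < ε)
    (hrp : r < p) {a : X → ℝ≥0∞}
    (ha : ∫⁻ ξ, (⨆ n : ℤ, (2 : ℝ≥0∞) ^ ((n : ℝ) * s) * F.levelSup a n ξ) ^ p ∂μ ≠ ∞)
    (m : ℤ) (ξ : Z) : F.oscSum μ a s r ε m ξ ≠ ∞ := by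
  obtain ⟨C, hC, hball⟩ := hμ.measure_ball_le
  set V : Z → ℝ≥0∞ := fun ξ => ⨆ n : ℤ, (2 : ℝ≥0∞) ^ ((n : ℝ) * s) * F.levelSup a n ξ with hV
  have hVm : Measurable V := Measurable.iSup fun n => (measurable_levelSup hμ a n).const_mul _
  set I := ∫⁻ ξ, V ξ ^ p ∂μ with hI
  set D := C * ENNReal.ofReal (1 ^ Q) with hD
  set b := μ (Metric.ball ξ (32 * (2 : ℝ) ^ (-m))) with hb
  have hb0 : b ≠ 0 := (hμ.ball_pos _ _ (by positivity)).ne'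
  set M := 1 + I / (b / D) with hM
  have hDtop : D ≠ ∞ := ENNReal.mul_ne_top hC (by simp)
  have hMtop : M ≠ ∞ := by
    refine ENNReal.add_ne_top.2 ⟨by simp, ENNReal.div_ne_top ha ?_⟩
    exact (ENNReal.div_pos hb0 hDtop).ne'
  have hterm : ∀ n, F.oscTerm μ a s r m n ξ ≤ M ^ (1 / r) := by
    intro n
    refine ENNReal.rpow_le_rpow (levelMax_le fun x hx hξ => ?_) (by positivity)
    have h1 : ∀ η, F.scaledSup a s r n η ≤ 1 + V η ^ p := by
      intro η
      have h2 : F.scaledSup a s r n η ≤ V η ^ r := by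
        refine ENNReal.rpow_le_rpow ?_ hr.le
        exact le_iSup (fun n : ℤ => (2 : ℝ≥0∞) ^ ((n : ℝ) * s) * F.levelSup a n η) n
      refine h2.trans ?_
      rcases le_total (V η) 1 with h3 | h3
      · exact (ENNReal.rpow_le_one h3 hr.le).trans le_self_add
      · exact (ENNReal.rpow_le_rpow_of_exponent_le h3 hrp.le).trans le_add_self
    calc F.avg μ (F.scaledSup a s r n) x ≤ F.avg μ (fun η => 1 + V η ^ p) x := avg_mono h1 x
      _ = 1 + (∫⁻ η in F.ballAt 32 x, V η ^ p ∂μ) / μ (F.ballAt 32 x) := by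
          have := avg_const (F := F) hμ 1 x
          unfold avg at this ⊢
          rw [lintegral_add_left measurable_const, ENNReal.add_div, this]
      _ ≤ M := by
          rw [hM]
          gcongr
          · exact setLIntegral_le_lintegral _ _
          · refine ENNReal.div_le_of_le_mul' ?_
            have hxm : F.level x ≤ m := hx ▸ min_le_left _ _
            have h4 := hball ξ (F.center x) (32 * (2 : ℝ) ^ (-F.level x))
              (32 * (2 : ℝ) ^ (-F.level x)) (by positivity) le_rfl hξ
            rw [div_self (by positivity)] at h4
            refine le_trans (measure_mono (Metric.ball_subset_ball ?_)) h4
            have := two_zpow_mono (show -m ≤ -F.level x by omega)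
            linarith
  refine ne_top_of_le_ne_top (b := (∑' n : ℤ, geomWeight ε (n - m)) * M ^ (1 / r)) ?_ ?_
  · exact ENNReal.mul_ne_top (tsum_geomWeight_sub_ne_top hε m)
      (ENNReal.rpow_ne_top_of_nonneg (by positivity) hMtop)
  · rw [← ENNReal.tsum_mul_right]
    unfold oscSum
    gcongr with n
    exact hterm n

end HyperbolicFilling

/-! ### Convergence of the level sums -/

theorem summable_of_tsum_enorm_ne_top {ι : Type*} {f : ι → ℂ} (h : ∑' k, ‖f k‖ₑ ≠ ∞) :
    Summable f :=
  Summable.of_nnnorm (ENNReal.tsum_coe_ne_top_iff_summable.1 h)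

namespace HyperbolicFilling

variable {Z : Type*} [MetricSpace Z] {X : Type*} {F : HyperbolicFilling Z X}

/-- The level sum, normalized at `ξ₀` if the level is negative. -/
def levelDiff (o : F.Orientation) (ψ : F.PartitionOfUnity) (ξ₀ : Z) (u : o.Edge → ℂ) (n : ℤ)
    (ξ : Z) : ℂ :=
  levelSum o ψ u n ξ - if n < 0 then levelSum o ψ u n ξ₀ else 0

/-- The limit of `integralApprox`. -/
def edgeIntegral (o : F.Orientation) (ψ : F.PartitionOfUnity) (ξ₀ : Z) (u : o.Edge → ℂ)
    (ξ : Z) : ℂ := ∑' n : ℤ, levelDiff o ψ ξ₀ u n ξ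

theorem integralApprox_eq_sum (o : F.Orientation) (ψ : F.PartitionOfUnity) (ξ₀ : Z)
    (u : o.Edge → ℂ) (N : ℕ) (ξ : Z) :
    integralApprox o ψ ξ₀ u N ξ = ∑ n ∈ Finset.Icc (-N : ℤ) N, levelDiff o ψ ξ₀ u n ξ := by
  unfold integralApprox levelDiff
  rw [Finset.sum_sub_distrib, ← Finset.sum_filter]
  congr 2
  ext n
  simp only [Finset.mem_Icc, Finset.mem_filter]
  omega

/-- The level must be at most 0: all coarser levels are then negative, so their sums are among those
normalized at `ξ₀`. -/
theorem exists_ballAt_superset (F : HyperbolicFilling Z X) {A : Set Z} (hA : Bornology.IsBounded A)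
    (ξ₀ : Z) : ∃ x, F.level x ≤ 0 ∧ A ⊆ F.ballAt 16 x ∧ ξ₀ ∈ F.ballAt 16 x := by
  by_cases hr : F.rooted
  · obtain ⟨x, hx, -⟩ := F.root_unique hr
    have h : ∀ ξ, ξ ∈ F.ballAt 16 x := fun ξ => by
      rw [mem_ballAt, hx]
      have := F.dist_le_one_of_rooted hr ξ (F.center x)
      norm_num; linarith
    exact ⟨x, hx.le, fun ξ _ => h ξ, h ξ₀⟩
  · obtain ⟨R, hR⟩ := hA.subset_ball ξ₀
    obtain ⟨n, hn⟩ := pow_unbounded_of_one_lt R (one_lt_two (α := ℝ))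
    obtain ⟨x, hx, hd⟩ := F.maximal (-n) (fun h => absurd h hr) ξ₀
    have h1 : (2 : ℝ) ^ (-F.level x) = 2 ^ n := by rw [hx, neg_neg, zpow_natCast]
    have h2 : (2 : ℝ) ^ (-(-(n : ℤ)) - 1) ≤ 2 ^ n := by
      rw [← zpow_natCast]; exact two_zpow_mono (by omega)
    have h3 : (0 : ℝ) < 2 ^ n := by positivity
    refine ⟨x, by omega, fun ξ hξ => ?_, ?_⟩
    · rw [mem_ballAt, h1]
      have h4 : dist ξ ξ₀ < R := hR hξ
      have := dist_triangle ξ ξ₀ (F.center x)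
      linarith
    · rw [mem_ballAt, h1]; linarith

variable [MeasurableSpace Z] [BorelSpace Z] {μ : Measure Z} {Q : ℝ}

theorem ae_of_forall_ballAt (F : HyperbolicFilling Z X) {P : Z → Prop}
    (h : ∀ x, F.level x ≤ 0 → ∀ᵐ ξ ∂μ.restrict (F.ballAt 16 x), P ξ) : ∀ᵐ ξ ∂μ, P ξ := by
  rcases isEmpty_or_nonempty Z with hZ | ⟨⟨z⟩⟩
  · exact Eventually.of_forall fun ξ => hZ.elim ξ
  have h1 : ∀ k : ℕ, ∀ᵐ ξ ∂μ, ξ ∈ Metric.ball z k → P ξ := by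
    intro k
    obtain ⟨x, hx, hsub, -⟩ := F.exists_ballAt_superset (Metric.isBounded_ball (x := z) (r := k)) z
    have := (ae_restrict_iff' (F.isOpen_ballAt 16 x).measurableSet).1 (h x hx)
    filter_upwards [this] with ξ hξ hk using hξ (hsub hk)
  filter_upwards [ae_all_iff.2 h1] with ξ hξ
  obtain ⟨k, hk⟩ := exists_nat_gt (dist ξ z)
  exact hξ k hk

theorem lintegral_iSup_levelSup_ne_top (o : F.Orientation) (i : Indices) {u : o.Edge → ℂ}
    (hu : o.edgeNorm μ i u < ∞) : ∫⁻ ξ, (⨆ n : ℤ, (2 : ℝ≥0∞) ^ ((n : ℝ) * i.s) *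
      F.levelSup (o.upWeight u) n ξ) ^ i.p ∂μ ≠ ∞ := by
  have hp := i.p_pos
  refine ne_top_of_le_ne_top (jNorm_lt_top_iff.1 hu).ne ?_
  gcongr with ξ
  exact (iSup_le_lqNorm i.q_pos _).trans (o.lqNorm_levelSup_le i u ξ)

section Convergence

variable (hμ : IsDoublingWith μ Q) (o : F.Orientation) (ψ : F.PartitionOfUnity) {i : Indices}
  {r : ℝ} (hs : i.s < 1) (hr : 0 < r) (hr1 : r ≤ 1) (hrp : r < i.p)
  (hσ : Q * (1 / r - 1) < i.s)

include hμ hr hrp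

/-- In `oscSum` at scale `m = n` the term of index `n` has weight 1, so finiteness of `oscSum` is
inherited. -/
theorem levelSup_ne_top {u : o.Edge → ℂ} (hu : o.edgeNorm μ i u < ∞) (n : ℤ) (ξ : Z) :
    F.levelSup (o.upWeight u) n ξ ≠ ∞ := by
  by_cases hadm : F.Admissible n
  · obtain ⟨x, hx, hξ⟩ := hadm.exists_mem_B ξ
    obtain ⟨C, hC, h⟩ := F.levelSup_le_oscTerm hμ hr
    have h1 := h (o.upWeight u) i.s x n ξ ξ hx.ge hξ
      (F.ballAt_mono (by norm_num) x (F.B_subset_ballAt_two x hξ))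
    have h2 := geomWeight_mul_oscTerm_le (F := F) (μ := μ) (o.upWeight u) i.s r 1 (F.level x) n ξ
    rw [hx, sub_self, geomWeight] at h2
    simp only [Int.cast_zero, abs_zero, neg_zero, zero_mul, ENNReal.rpow_zero, one_mul] at h2
    have h3 := F.oscSum_ne_top hμ hr one_pos hrp (lintegral_iSup_levelSup_ne_top o i hu) n ξ
    rw [hx] at h1
    intro h4
    rw [h4, ENNReal.mul_top (ENNReal.rpow_pos (by norm_num) (by norm_num)).ne'] at h1
    exact ENNReal.mul_ne_top hC (ne_top_of_le_ne_top h3 h2) (top_unique h1)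
  · rw [levelSup_eq_zero hadm]; simp

include hs in
/-- The differences of the level sums of coarse levels. -/
theorem tsum_enorm_coarse_sub_le : ∃ C : ℝ≥0∞, C ≠ ∞ ∧ ∀ ε ≤ 1 - i.s, ∀ (u : o.Edge → ℂ) (x : X)
    (ξ η ζ : Z), ξ ∈ F.B x → η ∈ F.ballAt 16 x → ζ ∈ F.ballAt 16 x →
      (2 : ℝ≥0∞) ^ ((F.level x : ℝ) * i.s) * ∑' n : ℤ, (Iio (F.level x)).indicator
        (fun n : ℤ => ‖levelSum o ψ u n η - levelSum o ψ u n ζ‖ₑ) n ≤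
        C * F.oscSum μ (o.upWeight u) i.s r ε (F.level x) ξ := by
  obtain ⟨C₁, hC₁, h₁⟩ := enorm_levelSum_sub_le hμ o ψ
  obtain ⟨C₂, hC₂, h₂⟩ := F.tsum_coarse_le_oscSum (s := i.s) hμ hr (le_refl (1 - i.s))
  refine ⟨C₁ * 32 * (2 * C₂), by finiteness, fun ε hε u x ξ η ζ hξ hη hζ => ?_⟩
  set a := o.upWeight u
  set m := F.level x
  -- Proving the estimate with the largest exponent `1 - s` makes the constant independent of `ε`.
  have hmono : F.oscSum μ a i.s r (1 - i.s) m ξ ≤ F.oscSum μ a i.s r ε m ξ := by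
    unfold oscSum
    gcongr with n
    exact geomWeight_anti hε _
  have hd : edist η ζ ≤ 32 * (2 : ℝ≥0∞) ^ (-(m : ℝ)) := by
    rw [mem_ballAt] at hη hζ
    have h3 := dist_triangle_right η ζ (F.center x)
    have h4 : dist η ζ ≤ 32 * (2 : ℝ) ^ (-m) := by linarith
    rw [edist_dist]
    refine (ENNReal.ofReal_le_ofReal h4).trans_eq ?_
    rw [ENNReal.ofReal_mul (by norm_num), ofReal_two_zpow]
    simp
  set K : Z → ℝ≥0∞ := fun η => ∑' n : ℤ, (Iio m).indicator
        (fun n : ℤ => (2 : ℝ≥0∞) ^ ((n : ℝ) - m) * F.levelSup a n η) n with hK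
  calc _ ≤ (2 : ℝ≥0∞) ^ ((m : ℝ) * i.s) * (C₁ * 32 * (K η + K ζ)) := by
        rw [hK, ← ENNReal.tsum_add, ← ENNReal.tsum_mul_left (a := C₁ * 32)]
        refine mul_le_mul_right (ENNReal.tsum_le_tsum fun n => ?_) _
        by_cases hn : n ∈ Iio m
        · simp only [indicator_of_mem hn]
          calc _ ≤ C₁ * ((2 : ℝ≥0∞) ^ (n : ℝ) * edist η ζ) *
                (F.levelSup a n η + F.levelSup a n ζ) := h₁ u n η ζ
            _ ≤ C₁ * ((2 : ℝ≥0∞) ^ (n : ℝ) * (32 * (2 : ℝ≥0∞) ^ (-(m : ℝ)))) *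
                (F.levelSup a n η + F.levelSup a n ζ) := by gcongr
            _ = _ := by
                rw [sub_eq_add_neg, ENNReal.rpow_add _ _ (by simp) (by simp)]; ring
        · simp only [indicator_of_notMem hn]; exact zero_le
    _ = C₁ * 32 * ((2 : ℝ≥0∞) ^ ((m : ℝ) * i.s) * K η + (2 : ℝ≥0∞) ^ ((m : ℝ) * i.s) * K ζ) := by
        ring
    _ ≤ C₁ * 32 * (C₂ * F.oscSum μ a i.s r ε m ξ + C₂ * F.oscSum μ a i.s r ε m ξ) := by
        refine mul_le_mul_right (add_le_add ?_ ?_) _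
        · exact (h₂ a x ξ η hξ hη).trans (mul_le_mul_right hmono _)
        · exact (h₂ a x ξ ζ hξ hζ).trans (mul_le_mul_right hmono _)
    _ = _ := by ring

theorem measurable_levelDiff (ξ₀ : Z) (u : o.Edge → ℂ) (n : ℤ) :
    Measurable (levelDiff o ψ ξ₀ u n) :=
  (measurable_levelSum hμ ψ u n).sub measurable_const

include hs hr1 hσ

/-- With `m` the level of `x`, the levels `n < m` are differences controlled by the Lipschitz bound,
uniformly on the ball. The levels `n ≥ m` are integrated, and the values at `ξ₀` subtracted for `m ≤
n < 0` are finitely many constants. -/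
theorem lintegral_tsum_enorm_levelDiff_ne_top {u : o.Edge → ℂ} (hu : o.edgeNorm μ i u < ∞)
    {ξ₀ : Z} {x : X} (hξ₀ : ξ₀ ∈ F.ballAt 16 x) (hx : F.level x ≤ 0) :
    ∫⁻ ξ in F.ballAt 16 x, ∑' n : ℤ, ‖levelDiff o ψ ξ₀ u n ξ‖ₑ ∂μ ≠ ∞ := by
  set ε := min (1 - i.s) (i.s - Q * (1 / r - 1)) with hε
  have hε0 : 0 < ε := lt_min (by linarith) (by linarith)
  obtain ⟨C₁, hC₁, h₁⟩ := tsum_enorm_coarse_sub_le hμ o ψ hs hr hrp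
  obtain ⟨C₂, hC₂, h₂⟩ :=
    F.lintegral_fine_le_oscSum (s := i.s) (ε := ε) hμ hr hr1 (min_le_right _ _)
  set a := o.upWeight u with ha
  set m := F.level x with hm
  set H := F.oscSum μ a i.s r ε m (F.center x) with hH
  have hHtop : H ≠ ∞ :=
    F.oscSum_ne_top hμ hr hε0 hrp (lintegral_iSup_levelSup_ne_top o i hu) m _
  set t := (2 : ℝ≥0∞) ^ ((m : ℝ) * i.s) with ht
  have ht0 : t ≠ 0 := (ENNReal.rpow_pos (by norm_num) (by norm_num)).ne'
  have httop : t ≠ ∞ := ENNReal.rpow_ne_top_of_ne_zero (by norm_num) (by norm_num)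
  have hdiv : ∀ {A B : ℝ≥0∞}, t * A ≤ B → B ≠ ∞ → A ≠ ∞ := by
    intro A B h hB hA
    rw [hA, ENNReal.mul_top ht0] at h
    exact hB (top_unique h)
  -- This bounds the subtracted constants of the levels that are negative but not coarser than the
  -- ball.
  set T := ∑ n ∈ Finset.Ico m 0, F.levelSup a n ξ₀ with hT
  have hTtop : T ≠ ∞ := ENNReal.sum_ne_top.2 fun n _ => levelSup_ne_top hμ o hr hrp hu n ξ₀
  set K := t⁻¹ * (C₁ * H) + T with hK
  have hKtop : K ≠ ∞ := by
    refine ENNReal.add_ne_top.2 ⟨?_, hTtop⟩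
    exact ENNReal.mul_ne_top (ENNReal.inv_ne_top.2 ht0) (ENNReal.mul_ne_top hC₁ hHtop)
  have hpt : ∀ η ∈ F.ballAt 16 x, ∑' n : ℤ, ‖levelDiff o ψ ξ₀ u n η‖ₑ ≤
      K + ∑' n : ℤ, (Ici m).indicator (fun n : ℤ => F.levelSup a n η) n := by
    intro η hη
    have h3 := h₁ ε (min_le_left _ _) u x _ η ξ₀ (F.center_mem_B x) hη hξ₀
    set A := ∑' n : ℤ, (Iio m).indicator
        (fun n : ℤ => ‖levelSum o ψ u n η - levelSum o ψ u n ξ₀‖ₑ) n with hA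
    have h4 : A ≤ t⁻¹ * (C₁ * H) := by
      calc A = t⁻¹ * (t * A) := by
            rw [← mul_assoc, ENNReal.inv_mul_cancel ht0 httop, one_mul]
        _ ≤ _ := by gcongr
    have hTs : T = ∑' n : ℤ, (Finset.Ico m 0 : Set ℤ).indicator (fun n => F.levelSup a n ξ₀) n := by
      rw [← tsum_subtype, hT]
      exact (Finset.tsum_subtype' (Finset.Ico m 0) fun n => F.levelSup a n ξ₀).symm
    calc _ ≤ ∑' n : ℤ, ((Iio m).indicator
            (fun n : ℤ => ‖levelSum o ψ u n η - levelSum o ψ u n ξ₀‖ₑ) n +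
          (Finset.Ico m 0 : Set ℤ).indicator (fun n => F.levelSup a n ξ₀) n +
          (Ici m).indicator (fun n : ℤ => F.levelSup a n η) n) := by
          refine ENNReal.tsum_le_tsum fun n => ?_
          unfold levelDiff
          by_cases hn : n < m
          · rw [indicator_of_mem (by exact hn), if_pos (by omega), add_assoc]
            exact le_self_add
          · rw [indicator_of_mem (show n ∈ Ici m from not_lt.1 hn)]
            by_cases hn0 : n < 0
            · rw [indicator_of_mem (show n ∈ (Finset.Ico m 0 : Set ℤ) by
                simp only [Finset.coe_Ico, mem_Ico]; omega), if_pos hn0]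
              calc _ ≤ ‖levelSum o ψ u n η‖ₑ + ‖levelSum o ψ u n ξ₀‖ₑ := enorm_sub_le
                _ ≤ F.levelSup a n η + F.levelSup a n ξ₀ :=
                    add_le_add (enorm_levelSum_le ψ u n η) (enorm_levelSum_le ψ u n ξ₀)
                _ ≤ _ := by
                    rw [add_comm]; gcongr; exact le_add_self
            · rw [if_neg hn0, sub_zero]
              exact (enorm_levelSum_le ψ u n η).trans le_add_self
      _ = A + T + ∑' n : ℤ, (Ici m).indicator (fun n : ℤ => F.levelSup a n η) n := by
          rw [ENNReal.tsum_add, ENNReal.tsum_add, hTs]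
      _ ≤ _ := add_le_add_left (add_le_add_left h4 _) _
  refine ne_top_of_le_ne_top ?_ (setLIntegral_mono' (F.isOpen_ballAt _ x).measurableSet hpt)
  rw [lintegral_add_left measurable_const, setLIntegral_const]
  refine ENNReal.add_ne_top.2 ⟨ENNReal.mul_ne_top hKtop (F.measure_ballAt_lt_top hμ _ x).ne, ?_⟩
  refine hdiv (h₂ a x _ (F.center_mem_B x)) ?_
  exact ENNReal.mul_ne_top (ENNReal.mul_ne_top hC₂ (F.measure_ballAt_lt_top hμ _ x).ne) hHtop

theorem setLIntegral_tsum_enorm_levelDiff_ne_top {u : o.Edge → ℂ} (hu : o.edgeNorm μ i u < ∞)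
    (ξ₀ : Z) {A : Set Z} (hA : Bornology.IsBounded A) :
    ∫⁻ ξ in A, ∑' n : ℤ, ‖levelDiff o ψ ξ₀ u n ξ‖ₑ ∂μ ≠ ∞ := by
  obtain ⟨x, hx, hsub, hξ₀⟩ := F.exists_ballAt_superset hA ξ₀
  exact ne_top_of_le_ne_top
    (lintegral_tsum_enorm_levelDiff_ne_top hμ o ψ hs hr hr1 hrp hσ hu hξ₀ hx)
    (lintegral_mono_set hsub)

theorem ae_tsum_enorm_levelDiff_ne_top {u : o.Edge → ℂ} (hu : o.edgeNorm μ i u < ∞) (ξ₀ : Z) :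
    ∀ᵐ ξ ∂μ, ∑' n : ℤ, ‖levelDiff o ψ ξ₀ u n ξ‖ₑ ≠ ∞ := by
  refine F.ae_of_forall_ballAt fun x _ => ?_
  have hm : Measurable fun ξ => ∑' n : ℤ, ‖levelDiff o ψ ξ₀ u n ξ‖ₑ :=
    Measurable.tsum fun n => (measurable_levelDiff hμ o ψ hr hrp ξ₀ u n).enorm
  filter_upwards [ae_lt_top hm (setLIntegral_tsum_enorm_levelDiff_ne_top hμ o ψ hs hr hr1 hrp hσ hu
    ξ₀ (F.isBounded_ballAt 16 x))] with ξ hξ using hξ.ne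

omit hs hr hr1 hrp hσ hμ in
theorem tendsto_integralApprox {u : o.Edge → ℂ} {ξ₀ ξ : Z}
    (h : ∑' n : ℤ, ‖levelDiff o ψ ξ₀ u n ξ‖ₑ ≠ ∞) :
    Tendsto (fun N : ℕ => integralApprox o ψ ξ₀ u N ξ) atTop (𝓝 (edgeIntegral o ψ ξ₀ u ξ)) := by
  simp_rw [integralApprox_eq_sum]
  refine (summable_of_tsum_enorm_ne_top h).hasSum.comp
    (tendsto_atTop_finset_of_monotone (fun N M hNM => Finset.Icc_subset_Icc (by omega) (by omega))
      fun n => ⟨n.natAbs, ?_⟩)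
  simp only [Finset.mem_Icc]; omega

omit hs hr hr1 hrp hσ hμ in
theorem enorm_edgeIntegral_le (u : o.Edge → ℂ) (ξ₀ ξ : Z) :
    ‖edgeIntegral o ψ ξ₀ u ξ‖ₑ ≤ ∑' n : ℤ, ‖levelDiff o ψ ξ₀ u n ξ‖ₑ := enorm_tsum_le_tsum_enorm

theorem aestronglyMeasurable_edgeIntegral {u : o.Edge → ℂ} (hu : o.edgeNorm μ i u < ∞) (ξ₀ : Z) :
    AEStronglyMeasurable (edgeIntegral o ψ ξ₀ u) μ := by
  refine aestronglyMeasurable_of_tendsto_ae atTop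
    (f := fun (N : ℕ) ξ => integralApprox o ψ ξ₀ u N ξ) (fun N => ?_) ?_
  · simp_rw [integralApprox_eq_sum]
    exact (Finset.measurable_sum _ fun n _ =>
      measurable_levelDiff hμ o ψ hr hrp ξ₀ u n).aestronglyMeasurable
  · filter_upwards [ae_tsum_enorm_levelDiff_ne_top hμ o ψ hs hr hr1 hrp hσ hu ξ₀] with ξ hξ
      using tendsto_integralApprox o ψ hξ

theorem edgeIntegral_mem_L1loc {u : o.Edge → ℂ} (hu : o.edgeNorm μ i u < ∞) (ξ₀ : Z) :
    edgeIntegral o ψ ξ₀ u ∈ L1loc μ := by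
  intro A hA _
  refine ⟨(aestronglyMeasurable_edgeIntegral hμ o ψ hs hr hr1 hrp hσ hu ξ₀).restrict, ?_⟩
  exact (lintegral_mono fun ξ => enorm_edgeIntegral_le o ψ u ξ₀ ξ).trans_lt
    (setLIntegral_tsum_enorm_levelDiff_ne_top hμ o ψ hs hr hr1 hrp hσ hu ξ₀ hA).lt_top

theorem tendsto_lintegral_integralApprox {u : o.Edge → ℂ} (hu : o.edgeNorm μ i u < ∞) (ξ₀ : Z)
    {A : Set Z} (hA : Bornology.IsBounded A) :
    Tendsto (fun N : ℕ => ∫⁻ ξ in A,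
      ‖integralApprox o ψ ξ₀ u N ξ - edgeIntegral o ψ ξ₀ u ξ‖ₑ ∂μ) atTop (𝓝 0) := by
  have hfin := setLIntegral_tsum_enorm_levelDiff_ne_top hμ o ψ hs hr hr1 hrp hσ hu ξ₀ hA
  have hm : Measurable fun ξ => ∑' n : ℤ, ‖levelDiff o ψ ξ₀ u n ξ‖ₑ :=
    Measurable.tsum fun n => (measurable_levelDiff hμ o ψ hr hrp ξ₀ u n).enorm
  rw [← lintegral_zero (μ := μ.restrict A)]
  refine tendsto_lintegral_of_dominated_convergence'
    (fun ξ => 2 * ∑' n : ℤ, ‖levelDiff o ψ ξ₀ u n ξ‖ₑ) (fun N => ?_) (fun N => ?_) ?_ ?_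
  · refine (AEStronglyMeasurable.sub (f := fun ξ => integralApprox o ψ ξ₀ u N ξ) ?_
      (aestronglyMeasurable_edgeIntegral hμ o ψ hs hr hr1 hrp hσ hu ξ₀).restrict).enorm
    simp only [integralApprox_eq_sum]
    exact (Finset.measurable_sum _ fun n _ =>
      measurable_levelDiff hμ o ψ hr hrp ξ₀ u n).aestronglyMeasurable
  · refine Eventually.of_forall fun ξ => ?_
    refine enorm_sub_le.trans ?_
    simp only [two_mul]
    refine add_le_add ?_ (enorm_edgeIntegral_le o ψ u ξ₀ ξ)
    rw [integralApprox_eq_sum]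
    exact (enorm_sum_le _ _).trans (ENNReal.sum_le_tsum _)
  · rw [lintegral_const_mul _ hm]
    exact ENNReal.mul_ne_top (by simp) hfin
  · filter_upwards [ae_restrict_of_ae
      (ae_tsum_enorm_levelDiff_ne_top hμ o ψ hs hr hr1 hrp hσ hu ξ₀)] with ξ hξ
    have h1 := ((tendsto_integralApprox o ψ hξ).sub_const (edgeIntegral o ψ ξ₀ u ξ)).enorm
    simpa using h1

omit hs hr hr1 hrp hσ hμ in
theorem enorm_edgeIntegral_sub_le {u : o.Edge → ℂ} {ξ₀ η ζ : Z}
    (hη : ∑' n : ℤ, ‖levelDiff o ψ ξ₀ u n η‖ₑ ≠ ∞)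
    (hζ : ∑' n : ℤ, ‖levelDiff o ψ ξ₀ u n ζ‖ₑ ≠ ∞) :
    ‖edgeIntegral o ψ ξ₀ u η - edgeIntegral o ψ ξ₀ u ζ‖ₑ ≤
      ∑' n : ℤ, ‖levelSum o ψ u n η - levelSum o ψ u n ζ‖ₑ := by
  unfold edgeIntegral
  rw [← (summable_of_tsum_enorm_ne_top hη).tsum_sub (summable_of_tsum_enorm_ne_top hζ)]
  refine enorm_tsum_le_tsum_enorm.trans (le_of_eq ?_)
  congr 1; funext n
  unfold levelDiff
  congr 1; ring

/-- The choice of the base point only changes `edgeIntegral` by a constant. -/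
theorem exists_edgeIntegral_sub_eq {u : o.Edge → ℂ} (hu : o.edgeNorm μ i u < ∞) (ξ₀ ξ₁ : Z) :
    ∃ c : ℂ, ∀ᵐ ξ ∂μ, edgeIntegral o ψ ξ₁ u ξ = edgeIntegral o ψ ξ₀ u ξ + c := by
  -- Nonnegative levels are not normalized, so only negative ones feel the change of base point.
  refine ⟨∑' n : ℤ, if n < 0 then levelSum o ψ u n ξ₀ - levelSum o ψ u n ξ₁ else 0, ?_⟩
  filter_upwards [ae_tsum_enorm_levelDiff_ne_top hμ o ψ hs hr hr1 hrp hσ hu ξ₀,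
    ae_tsum_enorm_levelDiff_ne_top hμ o ψ hs hr hr1 hrp hσ hu ξ₁] with ξ h₀ h₁
  rw [← sub_eq_iff_eq_add']
  unfold edgeIntegral
  rw [← (summable_of_tsum_enorm_ne_top h₁).tsum_sub (summable_of_tsum_enorm_ne_top h₀)]
  congr 1; funext n
  unfold levelDiff
  split_ifs <;> ring

end Convergence

end HyperbolicFilling

/-! ### Boundedness of the integration operator -/

theorem enorm_setAverage_sub_le {α : Type*} [MeasurableSpace α] {μ : Measure α} {s : Set α}
    (h0 : μ s ≠ 0) (htop : μ s ≠ ∞) {f : α → ℂ} (hf : IntegrableOn f s μ) (c : ℂ) :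
    ‖(⨍ a in s, f a ∂μ) - c‖ₑ ≤ (μ s)⁻¹ * ∫⁻ a in s, ‖f a - c‖ₑ ∂μ := by
  have h1 : (⨍ a in s, f a ∂μ) - c = ⨍ a in s, (f a - c) ∂μ := by
    have hc : ⨍ _ in s, c ∂μ = c := setAverage_const h0 htop c
    simp only [setAverage_eq] at hc ⊢
    rw [integral_sub hf (integrableOn_const htop), smul_sub, hc]
  rw [h1, average_eq', Measure.restrict_apply_univ]
  refine (enorm_integral_le_lintegral_enorm _).trans_eq ?_
  rw [lintegral_smul_measure, smul_eq_mul]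

namespace HyperbolicFilling

variable {Z : Type*} [MetricSpace Z] [MeasurableSpace Z] [BorelSpace Z] {X : Type*}
  {F : HyperbolicFilling Z X} {μ : Measure Z} {Q : ℝ}

theorem measure_ballAt_le_of_adj (hμ : IsDoublingWith μ Q) : ∃ C : ℝ≥0∞, C ≠ ∞ ∧ ∀ x y : X,
    F.level y ≤ F.level x + 1 → F.center y ∈ F.ballAt 16 x →
      μ (F.ballAt 32 x) ≤ C * μ (F.B y) := by
  obtain ⟨C, hC, h⟩ := hμ.measure_ball_le
  refine ⟨C * ENNReal.ofReal (64 ^ Q), ENNReal.mul_ne_top hC (by simp), fun x y hl hc => ?_⟩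
  have hp := two_zpow_pos (-F.level x)
  rw [mem_ballAt] at hc
  have h1 := h (F.center x) (F.center y) ((2 : ℝ) ^ (-F.level x) / 2) (32 * (2 : ℝ) ^ (-F.level x))
    (by positivity) (by linarith) (by rw [dist_comm]; linarith)
  rw [show 32 * (2 : ℝ) ^ (-F.level x) / ((2 : ℝ) ^ (-F.level x) / 2) = 64 by
    field_simp; norm_num] at h1
  refine h1.trans ?_
  gcongr
  refine (Metric.ball_subset_ball ?_).trans (F.ballAt_one_subset_B y)
  have h2 : (2 : ℝ) ^ (-F.level x) ≤ 2 * 2 ^ (-F.level y) := two_zpow_neg_le (by omega)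
  linarith

/-- Both averages are compared with one constant `c` over the common ball `ballAt 16 x`. Leaving `c`
free allows the choice `c = g ζ`, followed by an average over `ζ`. -/
theorem measure_mul_enorm_poisson_sub_le (hμ : IsDoublingWith μ Q) : ∃ C : ℝ≥0∞, C ≠ ∞ ∧
    ∀ g ∈ L1loc μ, ∀ (x y : X) (c : ℂ), F.graph.Adj x y →
      μ (F.ballAt 32 x) * ‖F.poisson μ g y - F.poisson μ g x‖ₑ ≤
        C * ∫⁻ η in F.ballAt 16 x, ‖g η - c‖ₑ ∂μ := by
  obtain ⟨C, hC, h⟩ := measure_ballAt_le_of_adj (F := F) hμ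
  refine ⟨2 * C, ENNReal.mul_ne_top (by simp) hC, fun g hg x y c hxy => ?_⟩
  have key : ∀ z, F.level z ≤ F.level x + 1 → F.B z ⊆ F.ballAt 16 x →
      μ (F.ballAt 32 x) * ‖F.poisson μ g z - c‖ₑ ≤ C * ∫⁻ η in F.ballAt 16 x, ‖g η - c‖ₑ ∂μ := by
    intro z hl hsub
    have h0 := (F.measure_B_pos hμ z).ne'
    have htop := (F.measure_B_lt_top hμ z).ne
    calc _ ≤ (C * μ (F.B z)) * ((μ (F.B z))⁻¹ * ∫⁻ η in F.B z, ‖g η - c‖ₑ ∂μ) := by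
          gcongr
          · exact h x z hl (hsub (F.center_mem_B z))
          · exact enorm_setAverage_sub_le h0 htop (hg _ (F.isBounded_B z) (F.measurableSet_B z)) c
      _ = C * ((μ (F.B z) * (μ (F.B z))⁻¹) * ∫⁻ η in F.B z, ‖g η - c‖ₑ ∂μ) := by ring
      _ ≤ _ := by
          rw [ENNReal.mul_inv_cancel h0 htop, one_mul]
          gcongr
  have hxy' := abs_le.1 hxy.2.1
  calc _ ≤ μ (F.ballAt 32 x) * (‖F.poisson μ g y - c‖ₑ + ‖F.poisson μ g x - c‖ₑ) := by
        gcongr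
        rw [show F.poisson μ g y - F.poisson μ g x =
          (F.poisson μ g y - c) - (F.poisson μ g x - c) by ring]
        exact enorm_sub_le
    _ = μ (F.ballAt 32 x) * ‖F.poisson μ g y - c‖ₑ +
        μ (F.ballAt 32 x) * ‖F.poisson μ g x - c‖ₑ := mul_add _ _ _
    _ ≤ _ := add_le_add (key y (by omega) (B_subset_ballAt_of_adj hxy))
        (key x (by omega) ((F.B_subset_ballAt_two x).trans (F.ballAt_mono (by norm_num) x)))
    _ = _ := by ring

section Bound

variable (hμ : IsDoublingWith μ Q) (o : F.Orientation) (ψ : F.PartitionOfUnity) {i : Indices}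
  {r : ℝ} (hs : i.s < 1) (hr : 0 < r) (hr1 : r ≤ 1) (hrp : r < i.p)
  (hσ : Q * (1 / r - 1) < i.s)

include hμ hr hrp hs hr1 hσ

/-- The central pointwise estimate. A difference of Poisson averages is bounded by a double average
of `|g η - g ζ|`. In it the coarse levels enter through their Lipschitz bound and the fine levels
through `β η + β ζ`, whose mean is controlled by `oscSum`. -/
theorem dAbs_poisson_edgeIntegral_le : ∃ ε : ℝ, 0 < ε ∧ ∃ C : ℝ≥0∞, C ≠ ∞ ∧
    ∀ (u : o.Edge → ℂ), o.edgeNorm μ i u < ∞ → ∀ (ξ₀ : Z) (x : X) (ξ : Z), ξ ∈ F.B x →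
      (2 : ℝ≥0∞) ^ ((F.level x : ℝ) * i.s) *
        F.dAbs (F.poisson μ (edgeIntegral o ψ ξ₀ u)) x ≤
        C * F.oscSum μ (o.upWeight u) i.s r ε (F.level x) ξ := by
  obtain ⟨C₀, hC₀, h₀⟩ := measure_mul_enorm_poisson_sub_le (F := F) hμ
  obtain ⟨C₁, hC₁, h₁⟩ := tsum_enorm_coarse_sub_le hμ o ψ hs hr hrp
  set ε := min (1 - i.s) (i.s - Q * (1 / r - 1)) with hε
  have hε0 : 0 < ε := lt_min (by linarith) (by linarith)
  obtain ⟨C₂, hC₂, h₂⟩ :=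
    F.lintegral_fine_le_oscSum (s := i.s) (ε := ε) hμ hr hr1 (min_le_right _ _)
  obtain ⟨C₃, hC₃, h₃⟩ := dAbs_le (F := F) hμ
  refine ⟨ε, hε0, C₃ * (C₀ * (C₁ + 2 * C₂)), by finiteness, fun u hu ξ₀ x ξ hξ => ?_⟩
  set a := o.upWeight u with ha
  set m := F.level x with hm
  set H := F.oscSum μ a i.s r ε m ξ with hH
  set t := (2 : ℝ≥0∞) ^ ((m : ℝ) * i.s) with ht
  have ht0 : t ≠ 0 := (ENNReal.rpow_pos (by norm_num) (by norm_num)).ne'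
  have httop : t ≠ ∞ := ENNReal.rpow_ne_top_of_ne_zero (by norm_num) (by norm_num)
  set g := edgeIntegral o ψ ξ₀ u with hg
  have hgL : g ∈ L1loc μ := edgeIntegral_mem_L1loc hμ o ψ hs hr hr1 hrp hσ hu ξ₀
  set b₁ := μ (F.ballAt 16 x) with hb₁
  set b₂ := μ (F.ballAt 32 x) with hb₂
  have hb₁0 : b₁ ≠ 0 := (F.measure_ballAt_pos hμ (by norm_num) x).ne'
  have hb₁t : b₁ ≠ ∞ := (F.measure_ballAt_lt_top hμ _ x).ne
  have hb₂0 : b₂ ≠ 0 := (F.measure_ballAt_pos hμ (by norm_num) x).ne'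
  have hb₂t : b₂ ≠ ∞ := (F.measure_ballAt_lt_top hμ _ x).ne
  have hb₁₂ : b₁ ≤ b₂ := measure_mono (F.ballAt_mono (by norm_num) x)
  set β : Z → ℝ≥0∞ := fun η => ∑' n : ℤ, (Ici m).indicator (fun n : ℤ => F.levelSup a n η) n with hβ
  have hβm : Measurable β := by
    refine Measurable.tsum fun n => ?_
    by_cases hn : n ∈ Ici m
    · simp only [indicator_of_mem hn]; exact measurable_levelSup hμ a n
    · simp only [indicator_of_notMem hn]; exact measurable_const
  set J := ∫⁻ η in F.ballAt 16 x, β η ∂μ with hJ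
  have hJle : t * J ≤ C₂ * b₂ * H := h₂ a x ξ hξ
  have hgood : ∀ᵐ ζ ∂μ, ∑' n : ℤ, ‖levelDiff o ψ ξ₀ u n ζ‖ₑ ≠ ∞ :=
    ae_tsum_enorm_levelDiff_ne_top hμ o ψ hs hr hr1 hrp hσ hu ξ₀
  have hdiff : ∀ η ∈ F.ballAt 16 x, ∀ ζ ∈ F.ballAt 16 x,
      t * ∑' n : ℤ, ‖levelSum o ψ u n η - levelSum o ψ u n ζ‖ₑ ≤ C₁ * H + t * β η + t * β ζ := by
    intro η hη ζ hζ
    refine le_trans ?_ (add_le_add_left (add_le_add_left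
      (h₁ ε (min_le_left _ _) u x ξ η ζ hξ hη hζ) (t * β η)) (t * β ζ))
    rw [← mul_add, ← mul_add, ← ENNReal.tsum_add, ← ENNReal.tsum_add]
    gcongr with n
    by_cases hn : n < m
    · rw [indicator_of_mem (by exact hn), add_assoc]
      exact le_self_add
    · have hn' : n ∈ Ici m := not_lt.1 hn
      simp only [indicator_of_mem hn', indicator_of_notMem (show n ∉ Iio (F.level x) from hn),
        zero_add]
      exact enorm_sub_le.trans
        (add_le_add (enorm_levelSum_le ψ u n η) (enorm_levelSum_le ψ u n ζ))
  have hadj : ∀ y, F.graph.Adj x y →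
      t * ‖F.poisson μ g y - F.poisson μ g x‖ₑ ≤ C₀ * (C₁ + 2 * C₂) * H := by
    intro y hxy
    set D := ‖F.poisson μ g y - F.poisson μ g x‖ₑ with hD
    -- The free constant is `g ζ`, and the average over `η` is carried out here.
    have hζ : ∀ᵐ ζ ∂μ.restrict (F.ballAt 16 x),
        t * (b₂ * D) ≤ C₀ * (b₁ * (C₁ * H) + t * J + b₁ * (t * β ζ)) := by
      filter_upwards [ae_restrict_of_ae hgood,
        ae_restrict_mem (F.isOpen_ballAt 16 x).measurableSet] with ζ hζ hζmem
      calc t * (b₂ * D) ≤ t * (C₀ * ∫⁻ η in F.ballAt 16 x, ‖g η - g ζ‖ₑ ∂μ) := by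
            exact mul_le_mul_right (h₀ g hgL x y (g ζ) hxy) _
        _ = C₀ * ∫⁻ η in F.ballAt 16 x, t * ‖g η - g ζ‖ₑ ∂μ := by
            rw [lintegral_const_mul' _ _ httop]; ring
        _ ≤ C₀ * ∫⁻ η in F.ballAt 16 x, (C₁ * H + t * β η + t * β ζ) ∂μ := by
            refine mul_le_mul_right (lintegral_mono_ae ?_) _
            filter_upwards [ae_restrict_of_ae hgood,
              ae_restrict_mem (F.isOpen_ballAt 16 x).measurableSet] with η hη hηmem
            refine le_trans ?_ (hdiff η hηmem ζ hζmem)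
            gcongr
            exact enorm_edgeIntegral_sub_le o ψ hη hζ
        _ = _ := by
            rw [lintegral_add_right _ measurable_const, lintegral_add_left measurable_const,
              setLIntegral_const, setLIntegral_const, lintegral_const_mul _ hβm]
            ring
    -- Integration in `ζ` turns `β ζ` into `J` and multiplies the left-hand side by `b₁`; afterwards
    -- `b₁` and `b₂` are cancelled.
    have hint := lintegral_mono_ae hζ
    rw [setLIntegral_const, lintegral_const_mul _ (by fun_prop),
      lintegral_add_left measurable_const, setLIntegral_const, lintegral_const_mul _ (by fun_prop),
      lintegral_const_mul _ hβm] at hint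
    have h5 : (t * D) * b₂ * b₁ ≤ (C₀ * (C₁ + 2 * C₂) * H) * b₂ * b₁ := by
      calc (t * D) * b₂ * b₁ = t * (b₂ * D) * b₁ := by ring
        _ ≤ C₀ * ((b₁ * (C₁ * H) + t * J) * b₁ + b₁ * (t * J)) := hint
        _ = C₀ * (b₁ * (C₁ * H) + 2 * (t * J)) * b₁ := by ring
        _ ≤ C₀ * (b₂ * (C₁ * H) + 2 * (C₂ * b₂ * H)) * b₁ := by gcongr
        _ = _ := by ring
    exact (ENNReal.mul_le_mul_iff_left hb₂0 hb₂t).1 ((ENNReal.mul_le_mul_iff_left hb₁0 hb₁t).1 h5)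
  have h6 := h₃ (F.poisson μ g) x (t⁻¹ * (C₀ * (C₁ + 2 * C₂) * H)) fun y hxy => by
    calc ‖F.poisson μ g y - F.poisson μ g x‖ₑ
        = t⁻¹ * (t * ‖F.poisson μ g y - F.poisson μ g x‖ₑ) := by
          rw [← mul_assoc, ENNReal.inv_mul_cancel ht0 httop, one_mul]
      _ ≤ _ := mul_le_mul_right (hadj y hxy) _
  calc t * F.dAbs (F.poisson μ g) x ≤ t * (C₃ * (t⁻¹ * (C₀ * (C₁ + 2 * C₂) * H))) := by gcongr
    _ = (t * t⁻¹) * (C₃ * (C₀ * (C₁ + 2 * C₂)) * H) := by ring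
    _ = _ := by rw [ENNReal.mul_inv_cancel ht0 httop, one_mul]

omit hs hr1 hσ in
-- With `n = m + k`, the sum is a geometric combination over `k` of sequences in `m`. For each `k`
-- the maximal inequality with exponents `p/r` and `q/r` applies, with a constant independent of
-- `k`.
theorem lintegral_lqNorm_oscSum_le (hrq : ENNReal.ofReal r < i.q) {ε : ℝ} (hε : 0 < ε) :
    ∃ C : ℝ≥0∞, C ≠ ∞ ∧ ∀ a : X → ℝ≥0∞,
      ∫⁻ ξ, lqNorm i.q (fun m => F.oscSum μ a i.s r ε m ξ) ^ i.p ∂μ ≤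
        C * ∫⁻ ξ, lqNorm i.q (fun n : ℤ => (2 : ℝ≥0∞) ^ ((n : ℝ) * i.s) *
          F.levelSup a n ξ) ^ i.p ∂μ := by
  have hp := i.p_pos
  have hrofr : ENNReal.ofReal r ≠ 0 := by simpa using hr
  obtain ⟨C₁, hC₁, δ, hδ, h₁⟩ := lqNorm_tsum_geomWeight_rpow_le (ι := ℤ) i.q_pos hε hp
  obtain ⟨C₂, hC₂, h₂⟩ := F.lintegral_lqNorm_levelMax_le hμ (P := i.p / r)
    (q := i.q / ENNReal.ofReal r) ((one_lt_div hr).2 hrp)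
    ((ENNReal.lt_div_iff_mul_lt (Or.inl hrofr) (Or.inl ENNReal.ofReal_ne_top)).2 (by rwa [one_mul]))
  refine ⟨C₁ * ((∑' k : ℤ, geomWeight δ k) * C₂), ENNReal.mul_ne_top hC₁ (ENNReal.mul_ne_top
    (tsum_geomWeight_ne_top hδ) hC₂), fun a => ?_⟩
  set c := F.scaledSup a i.s r with hc
  have hcm : ∀ n, Measurable (c n) := measurable_scaledSup hμ a i.s r
  have hconv : ∀ v : ℤ → ℝ≥0∞, lqNorm i.q (fun m => v m ^ (1 / r)) ^ i.p =
      lqNorm (i.q / ENNReal.ofReal r) v ^ (i.p / r) := fun v => by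
    rw [lqNorm_rpow hr, ← ENNReal.rpow_mul, one_div_mul_eq_div]
  set I := ∫⁻ ξ, lqNorm i.q (fun n : ℤ => (2 : ℝ≥0∞) ^ ((n : ℝ) * i.s) *
          F.levelSup a n ξ) ^ i.p ∂μ with hI
  have hIc : I = ∫⁻ ξ, lqNorm (i.q / ENNReal.ofReal r) (fun n => c n ξ) ^ (i.p / r) ∂μ := by
    rw [hI]
    congr 1; funext ξ
    rw [← hconv]
    congr 2; funext n
    rw [hc, scaledSup, ← ENNReal.rpow_mul, mul_one_div_cancel hr.ne', ENNReal.rpow_one]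
  set v : Z → ℤ → ℤ → ℝ≥0∞ := fun ξ k m => F.oscTerm μ a i.s r m (m + k) ξ with hv
  have hvm : ∀ k m, Measurable fun ξ => v ξ k m := fun k m =>
    (measurable_levelMax hμ _ _).pow_const _
  have hosc : ∀ ξ m, F.oscSum μ a i.s r ε m ξ = ∑' k, geomWeight ε k * v ξ k m := by
    intro ξ m
    unfold oscSum
    rw [← (Equiv.addLeft m).tsum_eq]
    simp [hv]
  have hk : ∀ k, ∫⁻ ξ, lqNorm i.q (v ξ k) ^ i.p ∂μ ≤ C₂ * I := by
    intro k
    have e1 : ∀ ξ, lqNorm i.q (v ξ k) ^ i.p = lqNorm (i.q / ENNReal.ofReal r)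
        (fun m => F.levelMax μ (min m (m + k)) (c (m + k)) ξ) ^ (i.p / r) := fun ξ => by
      rw [← hconv]; rfl
    simp_rw [e1]
    -- For `k ≥ 0` the operator of level `m` acts on the function of index `m + k`, so the functions
    -- are shifted beforehand. For `k ≤ 0` both indices are `m + k`, and the outputs are shifted
    -- instead. Shifts preserve the `ℓ^q` norm.
    rcases le_total 0 k with h0 | h0
    · have e2 : ∀ m : ℤ, min m (m + k) = m := fun m => min_eq_left (by omega)
      simp_rw [e2]
      refine (h₂ (fun m => c (m + k)) fun m => hcm _).trans_eq ?_
      rw [hIc]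
      congr 2; funext ξ
      exact congrArg (· ^ (i.p / r)) (lqNorm_equiv (Equiv.addRight k) fun n => c n ξ)
    · have e2 : ∀ m : ℤ, min m (m + k) = m + k := fun m => min_eq_right (by omega)
      simp_rw [e2]
      rw [hIc]
      refine le_of_eq_of_le ?_ (h₂ c hcm)
      congr 1; funext ξ
      exact congrArg (· ^ (i.p / r))
        (lqNorm_equiv (Equiv.addRight k) fun n => F.levelMax μ n (c n) ξ)
  calc _ ≤ ∫⁻ ξ, C₁ * ∑' k, geomWeight δ k * lqNorm i.q (v ξ k) ^ i.p ∂μ := by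
        refine lintegral_mono fun ξ => ?_
        simp_rw [hosc]
        exact h₁ (v ξ)
    _ = C₁ * ∑' k, geomWeight δ k * ∫⁻ ξ, lqNorm i.q (v ξ k) ^ i.p ∂μ := by
        have hm : ∀ k, Measurable fun ξ => lqNorm i.q (v ξ k) ^ i.p := fun k =>
          (measurable_lqNorm (hvm k)).pow_const _
        rw [lintegral_const_mul' _ _ hC₁,
          lintegral_tsum fun k => ((hm k).const_mul _).aemeasurable]
        congr 2; funext k
        rw [lintegral_const_mul _ (hm k)]
    _ ≤ C₁ * ∑' k, geomWeight δ k * (C₂ * I) := by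
        gcongr with k
        exact hk k
    _ = _ := by rw [ENNReal.tsum_mul_right]; ring

/-- The integration operator is bounded. -/
theorem tlNorm_edgeIntegral_le (hrq : ENNReal.ofReal r < i.q) : ∃ C : ℝ≥0∞, C ≠ ∞ ∧
    ∀ (u : o.Edge → ℂ), o.edgeNorm μ i u < ∞ → ∀ ξ₀ : Z,
      F.tlNorm μ i (edgeIntegral o ψ ξ₀ u) ≤ C * o.edgeNorm μ i u := by
  have hp := i.p_pos
  obtain ⟨ε, hε, C₁, hC₁, h₁⟩ := dAbs_poisson_edgeIntegral_le hμ o ψ hs hr hr1 hrp hσ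
  obtain ⟨C₂, hC₂, h₂⟩ := lintegral_lqNorm_oscSum_le (F := F) hμ hr hrp hrq hε
  obtain ⟨N, hN⟩ := F.encard_mem_B_le hμ
  set K := (N : ℝ≥0∞) ^ (1 / i.q.toReal) * C₁ with hK
  have hKtop : K ≠ ∞ := ENNReal.mul_ne_top
    (ENNReal.rpow_ne_top_of_nonneg (by positivity) (by simp)) hC₁
  refine ⟨(K ^ i.p * C₂) ^ (1 / i.p), ENNReal.rpow_ne_top_of_nonneg (by positivity)
    (ENNReal.mul_ne_top (ENNReal.rpow_ne_top_of_nonneg hp.le hKtop) hC₂), fun u hu ξ₀ => ?_⟩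
  unfold tlNorm Orientation.edgeNorm jNorm
  rw [← ENNReal.mul_rpow_of_nonneg _ _ (by positivity)]
  gcongr
  calc _ ≤ ∫⁻ ξ, K ^ i.p *
        lqNorm i.q (fun m => F.oscSum μ (o.upWeight u) i.s r ε m ξ) ^ i.p ∂μ := by
        refine lintegral_mono fun ξ => ?_
        rw [← ENNReal.mul_rpow_of_nonneg _ _ hp.le]
        refine ENNReal.rpow_le_rpow ?_ hp.le
        rw [hK, mul_assoc, ← lqNorm_const_mul i.q_pos]
        -- Each vertex is charged to its level, at most `N` vertices of a level having `ξ` in their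
        -- ball.
        refine lqNorm_le_of_rel i.q_pos (fun (x : X) (n : ℤ) => F.level x = n ∧ ξ ∈ F.B x)
          (fun x hx => ?_) fun n => hN n ξ
        have hξ : ξ ∈ F.B x := by
          by_contra h
          exact hx (indicator_of_notMem h _)
        refine ⟨F.level x, ⟨rfl, hξ⟩, ?_⟩
        rw [indicator_of_mem hξ]
        exact h₁ u hu ξ₀ x ξ hξ
    _ = K ^ i.p * ∫⁻ ξ, lqNorm i.q (fun m => F.oscSum μ (o.upWeight u) i.s r ε m ξ) ^ i.p ∂μ :=
        lintegral_const_mul' _ _ (ENNReal.rpow_ne_top_of_nonneg hp.le hKtop)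
    _ ≤ K ^ i.p * (C₂ * ∫⁻ ξ, lqNorm i.q (fun n : ℤ => (2 : ℝ≥0∞) ^ ((n : ℝ) * i.s) *
          F.levelSup (o.upWeight u) n ξ) ^ i.p ∂μ) := by
        gcongr
        exact h₂ _
    _ ≤ _ := by
        rw [← mul_assoc]
        gcongr with ξ
        exact o.lqNorm_levelSup_le i u ξ

end Bound

end HyperbolicFilling

/-! ### Integration of derivatives -/

theorem IsDoublingWith.isUnifLocDoublingMeasure {Z : Type*} [MetricSpace Z] [MeasurableSpace Z]
    [BorelSpace Z] {μ : Measure Z} {Q : ℝ} (hμ : IsDoublingWith μ Q) :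
    IsUnifLocDoublingMeasure μ := by
  obtain ⟨C, hC, h⟩ := hμ.measure_ball_le
  refine ⟨(C * ENNReal.ofReal (3 ^ Q)).toNNReal, ?_⟩
  filter_upwards [self_mem_nhdsWithin] with ε hε x
  have hε : 0 < ε := hε
  rw [ENNReal.coe_toNNReal (ENNReal.mul_ne_top hC (by simp))]
  calc _ ≤ μ (Metric.ball x (3 * ε)) :=
        measure_mono (Metric.closedBall_subset_ball (by linarith))
    _ ≤ C * ENNReal.ofReal ((3 * ε / ε) ^ Q) * μ (Metric.ball x ε) :=
        h x x ε (3 * ε) hε (by linarith) (by rw [dist_self]; linarith)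
    _ ≤ _ := by
        rw [mul_div_assoc, div_self hε.ne', mul_one]
        gcongr
        exact Metric.ball_subset_closedBall

namespace HyperbolicFilling

variable {Z : Type*} [MetricSpace Z] {X : Type*} {F : HyperbolicFilling Z X}

/-- The interpolation of the values of a vertex function on the level `n`. -/
def levelMean (ψ : F.PartitionOfUnity) (v : X → ℂ) (n : ℤ) (ξ : Z) : ℂ :=
  ∑' x : {x : X // F.level x = n}, v x * (ψ.toFun x ξ : ℂ)

open Classical in
/-- The interpolation on the level `n`, replaced with the one on the level `0` if there is no
level `n`. -/
def levelApprox (ψ : F.PartitionOfUnity) (v : X → ℂ) (n : ℤ) (ξ : Z) : ℂ :=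
  levelMean ψ v (if F.Admissible n then n else 0) ξ

variable [MeasurableSpace Z] [BorelSpace Z] {μ : Measure Z} {Q : ℝ}

theorem encard_level_le (F : HyperbolicFilling Z X) (hμ : IsDoublingWith μ Q) :
    ∃ N : ℕ, ∀ (n : ℤ) (ξ : Z), {x : {x : X // F.level x = n} | ξ ∈ F.B x}.encard ≤ N := by
  obtain ⟨N, hN⟩ := F.encard_mem_B_le hμ
  refine ⟨N, fun n ξ => le_trans ?_ (hN n ξ)⟩
  exact encard_le_encard_of_injOn (f := Subtype.val) (fun x hx => ⟨x.2, hx⟩)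
    Subtype.val_injective.injOn

theorem finite_support_level (hμ : IsDoublingWith μ Q) (ψ : F.PartitionOfUnity) (v : X → ℂ)
    (n : ℤ) (ξ : Z) : (Function.support fun x : {x : X // F.level x = n} =>
      v x * (ψ.toFun x ξ : ℂ)).Finite := by
  obtain ⟨N, hN⟩ := F.encard_level_le hμ
  refine (finite_of_encard_le_coe (hN n ξ)).subset fun x hx => ?_
  exact ψ.mem_B_of_ne_zero (by exact_mod_cast right_ne_zero_of_mul hx)

theorem hasSum_levelMean (hμ : IsDoublingWith μ Q) (ψ : F.PartitionOfUnity) (v : X → ℂ)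
    (n : ℤ) (ξ : Z) : HasSum (fun x : {x : X // F.level x = n} => v x * (ψ.toFun x ξ : ℂ))
      (levelMean ψ v n ξ) :=
  (summable_of_hasFiniteSupport (finite_support_level hμ ψ v n ξ)).hasSum

theorem hasSum_coe_partition (ψ : F.PartitionOfUnity) {n : ℤ} (hn : F.Admissible n) (ξ : Z) :
    HasSum (fun x : {x : X // F.level x = n} => (ψ.toFun x ξ : ℂ)) 1 := by
  have h := Complex.hasSum_ofReal.2 (ψ.hasSum_one n hn ξ)
  rwa [Complex.ofReal_one] at h

theorem levelMean_sub_const (hμ : IsDoublingWith μ Q) (ψ : F.PartitionOfUnity) (v : X → ℂ)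
    {n : ℤ} (hn : F.Admissible n) (ξ : Z) (c : ℂ) :
    levelMean ψ v n ξ - c =
      ∑' x : {x : X // F.level x = n}, (v x - c) * (ψ.toFun x ξ : ℂ) := by
  have h := (hasSum_levelMean hμ ψ v n ξ).sub ((hasSum_coe_partition ψ hn ξ).mul_left c)
  rw [mul_one] at h
  rw [← h.tsum_eq]
  congr 1; funext x; ring

/-- Summed over all pairs of vertices, `(v(y') - v(y)) ψ_y ψ_{y'}` splits, because both partitions
sum to 1. A pair with nonzero product at `ξ` has intersecting balls and consecutive levels, so it is
an upward edge and no pair is missing. -/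
theorem levelSum_d_eq (hμ : IsDoublingWith μ Q) (o : F.Orientation) (ψ : F.PartitionOfUnity)
    (v : X → ℂ) {n : ℤ} (hn : F.Admissible n) (ξ : Z) :
    levelSum o ψ (o.d v) n ξ = levelMean ψ v (n + 1) ξ - levelMean ψ v n ξ := by
  have hn1 : F.Admissible (n + 1) := hn.mono (by omega)
  set f : {x : X // F.level x = n} → ℂ := fun x => (ψ.toFun x ξ : ℂ) with hf
  set g : {x : X // F.level x = n + 1} → ℂ := fun x => (ψ.toFun x ξ : ℂ) with hg
  have hsn : ∀ (w : X → ℂ) (k : ℤ), Summable fun x : {x : X // F.level x = k} =>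
      ‖w x * (ψ.toFun x ξ : ℂ)‖ := fun w k => summable_of_hasFiniteSupport
    ((finite_support_level hμ ψ w k ξ).subset fun x hx => norm_ne_zero_iff.1 hx)
  have hs1 : ∀ k : ℤ, Summable fun x : {x : X // F.level x = k} => ‖(ψ.toFun x ξ : ℂ)‖ :=
    fun k => by simpa only [Pi.one_apply, one_mul] using hsn 1 k
  have hp1 : Summable fun p : {x : X // F.level x = n} × {x : X // F.level x = n + 1} =>
      f p.1 * (v p.2 * g p.2) :=
    summable_mul_of_summable_norm (f := f)
      (g := fun y : {x : X // F.level x = n + 1} => v y * g y) (hs1 n) (hsn v (n + 1))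
  have hp2 : Summable fun p : {x : X // F.level x = n} × {x : X // F.level x = n + 1} =>
      (v p.1 * f p.1) * g p.2 :=
    summable_mul_of_summable_norm (g := g)
      (f := fun x : {x : X // F.level x = n} => v x * f x) (hsn v n) (hs1 (n + 1))
  have h1 := HasSum.mul (f := f) (g := fun y : {x : X // F.level x = n + 1} => v y * g y)
    (hasSum_coe_partition ψ hn ξ) (hasSum_levelMean hμ ψ v (n + 1) ξ) hp1
  have h2 := HasSum.mul (f := fun x : {x : X // F.level x = n} => v x * f x) (g := g)
    (hasSum_levelMean hμ ψ v n ξ) (hasSum_coe_partition ψ hn1 ξ) hp2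
  have h3 := h1.sub h2
  rw [one_mul, mul_one] at h3
  have hinj : Function.Injective fun e : o.UpEdge n =>
      ((⟨e.1.1.1, e.2.1⟩, ⟨e.1.1.2, e.2.2⟩) :
        {x : X // F.level x = n} × {x : X // F.level x = n + 1}) := by
    intro e e' h
    simp only [Prod.mk.injEq, Subtype.mk.injEq] at h
    exact Subtype.ext (Subtype.ext (Prod.ext h.1 h.2))
  have h4 := (hinj.hasSum_iff ?_).2 h3
  · rw [← h4.tsum_eq]
    refine tsum_congr fun e => ?_
    simp only [Function.comp_apply, Orientation.d, hf, hg]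
    ring
  · rintro ⟨x, y⟩ hxy
    by_contra h0
    have hx : ψ.toFun x ξ ≠ 0 := fun h => h0 (by simp [hf, hg, h])
    have hy : ψ.toFun y ξ ≠ 0 := fun h => h0 (by simp [hf, hg, h])
    have hlt : F.level x < F.level y := by rw [x.2, y.2]; omega
    have hadj : F.graph.Adj x y := by
      refine ⟨fun h => hlt.ne (by rw [h]), ?_, ξ, ψ.mem_B_of_ne_zero hx, ψ.mem_B_of_ne_zero hy⟩
      rw [x.2, y.2]; simp
    exact hxy ⟨⟨⟨(x.1, y.1), o.upward hadj hlt⟩, x.2, y.2⟩, rfl⟩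

theorem levelSum_d (hμ : IsDoublingWith μ Q) (o : F.Orientation) (ψ : F.PartitionOfUnity)
    (v : X → ℂ) (n : ℤ) (ξ : Z) :
    levelSum o ψ (o.d v) n ξ = levelApprox ψ v (n + 1) ξ - levelApprox ψ v n ξ := by
  unfold levelApprox
  by_cases hn : F.Admissible n
  · rw [if_pos hn, if_pos (hn.mono (by omega)), levelSum_d_eq hμ o ψ v hn]
  · have h0 : levelSum o ψ (o.d v) n ξ = 0 := by
      have h := enorm_levelSum_le ψ (o.d v) n ξ
      rw [levelSup_eq_zero hn] at h
      exact enorm_eq_zero.1 (nonpos_iff_eq_zero.1 h)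
    rw [h0, if_neg hn]
    split_ifs with h1
    -- Just below the root, at `n = -1`, both interpolations are the one of level 0.
    · have : n + 1 = 0 := by
        unfold Admissible at hn h1
        push Not at hn
        have := h1 hn.1
        omega
      rw [this, sub_self]
    · rw [sub_self]

theorem sum_Ico_succ_sub (t : ℤ → ℂ) (a : ℤ) (k : ℕ) :
    ∑ n ∈ Finset.Ico a (a + k), (t (n + 1) - t n) = t (a + k) - t a := by
  induction k with
  | zero => simp
  | succ k ih =>
    have h : Finset.Ico a (a + (k + 1 : ℕ)) = insert (a + k) (Finset.Ico a (a + k)) := by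
      ext n; simp only [Finset.mem_Ico, Finset.mem_insert]; push_cast; omega
    rw [h, Finset.sum_insert (by simp), ih]
    push_cast
    rw [← add_assoc]; ring

theorem integralApprox_d (hμ : IsDoublingWith μ Q) (o : F.Orientation) (ψ : F.PartitionOfUnity)
    (ξ₀ : Z) (v : X → ℂ) (N : ℕ) (ξ : Z) :
    integralApprox o ψ ξ₀ (o.d v) N ξ = levelApprox ψ v (N + 1) ξ - levelApprox ψ v 0 ξ₀ -
      (levelApprox ψ v (-N) ξ - levelApprox ψ v (-N) ξ₀) := by
  have h1 : Finset.Icc (-N : ℤ) N = Finset.Ico (-N : ℤ) (-N + (2 * N + 1 : ℕ)) := by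
    ext n; simp only [Finset.mem_Icc, Finset.mem_Ico]; push_cast; omega
  have h2 : Finset.Icc (-N : ℤ) (-1) = Finset.Ico (-N : ℤ) (-N + N) := by
    ext n; simp only [Finset.mem_Icc, Finset.mem_Ico]; omega
  unfold integralApprox
  simp_rw [levelSum_d hμ o ψ v]
  rw [h1, h2, sum_Ico_succ_sub fun n => levelApprox ψ v n ξ,
    sum_Ico_succ_sub fun n => levelApprox ψ v n ξ₀, neg_add_cancel,
    show (-N : ℤ) + (2 * N + 1 : ℕ) = N + 1 by push_cast; ring]
  ring

/-- Subtracting `v y` is free, because the partition sums to 1. Since `y` is one level higher and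
its ball contains both points, the coefficients `v x - v y` that matter are, up to sign, values of
`dv` on upward edges. -/
theorem enorm_levelMean_sub_le (hμ : IsDoublingWith μ Q) (o : F.Orientation)
    (ψ : F.PartitionOfUnity) : ∃ C : ℝ≥0∞, C ≠ ∞ ∧ ∀ (v : X → ℂ) (n : ℤ) (ξ η : Z) (y : X),
      F.level y = n + 1 → ξ ∈ F.B y → η ∈ F.B y → F.Admissible n →
      ‖levelMean ψ v n ξ - levelMean ψ v n η‖ₑ ≤ C * ((2 : ℝ≥0∞) ^ (n : ℝ) * edist ξ η) *
        (F.levelSup (o.upWeight (o.d v)) n ξ + F.levelSup (o.upWeight (o.d v)) n η) := by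
  obtain ⟨N, hN⟩ := F.encard_level_le hμ
  obtain ⟨L, hL, h⟩ := ψ.exists_enorm_sub_le
  refine ⟨N * L, ENNReal.mul_ne_top (by simp) hL, fun v n ξ η y hy hξ hη hn => ?_⟩
  rw [← sub_sub_sub_cancel_right _ _ (v y), levelMean_sub_const hμ ψ v hn,
    levelMean_sub_const hμ ψ v hn, mul_assoc (N : ℝ≥0∞)]
  have hz : ∀ ζ, ∀ x ∉ {x : {x : X // F.level x = n} | ζ ∈ F.B x}, (ψ.toFun x ζ : ℂ) = 0 := by
    intro ζ x hx
    by_contra hne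
    exact hx (ψ.mem_B_of_ne_zero (by exact_mod_cast hne))
  have hle : ∀ ζ ∈ F.B y, ∀ x ∈ {x : {x : X // F.level x = n} | ζ ∈ F.B x},
      ‖v x - v y‖ₑ ≤ F.levelSup (o.upWeight (o.d v)) n ζ := by
    intro ζ hζ x hx
    have hlt : F.level x < F.level y := by rw [x.2, hy]; omega
    have hadj : F.graph.Adj x y := by
      refine ⟨fun h => hlt.ne (by rw [h]), ?_, ζ, hx, hζ⟩
      rw [x.2, hy]; simp
    have h1 := o.enorm_le_levelSup (o.d v) (n := n)
      ⟨⟨(x.1, y), o.upward hadj hlt⟩, x.2, hy⟩ hx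
    rwa [Orientation.d, enorm_sub_rev] at h1
  refine enorm_tsum_mul_sub_tsum_mul_le (hN n ξ) (hN n η) (hz ξ) (hz η) (fun x => ?_)
    (hle ξ hξ) (hle η hη)
  have := h x ξ η
  rw [x.2] at this
  rwa [← mul_assoc]

theorem levelMean_zero_of_rooted (hr : F.rooted) (ψ : F.PartitionOfUnity) (v : X → ℂ) (ξ η : Z) :
    levelMean ψ v 0 ξ = levelMean ψ v 0 η := by
  obtain ⟨x₀, hx₀, hu⟩ := F.root_unique hr
  have h : ∀ ζ, levelMean ψ v 0 ζ = v x₀ := by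
    intro ζ
    have h1 := (hasSum_coe_partition ψ (n := 0) (fun _ => le_rfl) ζ).mul_left (v x₀)
    rw [mul_one] at h1
    rw [← h1.tsum_eq]
    unfold levelMean
    congr 1; funext x
    rw [hu x x.2]
  rw [h, h]

/-- The interpolations on coarse levels oscillate little. -/
theorem tendsto_levelApprox_neg_sub (hμ : IsDoublingWith μ Q) (o : F.Orientation)
    (ψ : F.PartitionOfUnity) {i : Indices} {r : ℝ} (hs : i.s < 1) (hr : 0 < r) (hrp : r < i.p)
    {v : X → ℂ} (hv : o.edgeNorm μ i (o.d v) < ∞) (ξ₀ ξ : Z) :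
    Tendsto (fun N : ℕ => levelApprox ψ v (-N) ξ - levelApprox ψ v (-N) ξ₀) atTop (𝓝 0) := by
  by_cases hroot : F.rooted
  · refine tendsto_const_nhds.congr fun N => ?_
    unfold levelApprox
    by_cases hN : F.Admissible (-N)
    · have : (-N : ℤ) = 0 := by have := hN hroot; omega
      rw [this, ite_self, levelMean_zero_of_rooted hroot ψ v ξ ξ₀, sub_self]
    · rw [if_neg hN, levelMean_zero_of_rooted hroot ψ v ξ ξ₀, sub_self]
  have hadm : ∀ n, F.Admissible n := fun n h => absurd h hroot
  set a := o.upWeight (o.d v) with ha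
  obtain ⟨C, hC, h⟩ := enorm_levelMean_sub_le hμ o ψ
  obtain ⟨x, hx, hsub, hξ₀⟩ := F.exists_ballAt_superset (Bornology.isBounded_singleton (x := ξ)) ξ₀
  have hξ : ξ ∈ F.ballAt 16 x := hsub rfl
  -- Up to a fixed factor these are terms of the convergent series of coarse levels.
  have hdecay : ∀ η ∈ F.ballAt 16 x,
      Tendsto (fun N : ℕ => (2 : ℝ≥0∞) ^ (((-N : ℤ) : ℝ)) * F.levelSup a (-N) η) atTop (𝓝 0) := by
    intro η hη
    set m := F.level x with hm
    obtain ⟨C₂, hC₂, h₂⟩ := F.tsum_coarse_le_oscSum (s := i.s) hμ hr (le_refl (1 - i.s))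
    have h3 := h₂ a x _ η (F.center_mem_B x) hη
    have h4 := ENNReal.mul_ne_top hC₂ (F.oscSum_ne_top hμ hr (by linarith : 0 < 1 - i.s) hrp
      (lintegral_iSup_levelSup_ne_top o i hv) m (F.center x))
    have ht0 : (2 : ℝ≥0∞) ^ ((m : ℝ) * i.s) ≠ 0 :=
      (ENNReal.rpow_pos (by norm_num) (by norm_num)).ne'
    have h5 : ∑' n : ℤ, (Set.Iio m).indicator
        (fun n : ℤ => (2 : ℝ≥0∞) ^ ((n : ℝ) - m) * F.levelSup a n η) n ≠ ∞ := by
      intro h6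
      rw [h6, ENNReal.mul_top ht0] at h3
      exact h4 (top_unique h3)
    have hinj : Function.Injective fun N : ℕ => (-N : ℤ) := fun N M hNM => by simpa using hNM
    have h6 := (ENNReal.tendsto_cofinite_zero_of_tsum_ne_top h5).comp
      (Nat.cofinite_eq_atTop ▸ hinj.tendsto_cofinite)
    have hm_top : (2 : ℝ≥0∞) ^ (m : ℝ) ≠ ∞ :=
      ENNReal.rpow_ne_top_of_ne_zero (by norm_num) (by norm_num)
    have h7 := ENNReal.Tendsto.const_mul h6 (Or.inr hm_top)
    rw [mul_zero] at h7
    refine h7.congr' ?_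
    filter_upwards [eventually_gt_atTop (-m).toNat] with N hN
    simp only [Function.comp_apply]
    rw [indicator_of_mem (show (-N : ℤ) ∈ Set.Iio m by simp only [Set.mem_Iio]; omega), ← mul_assoc,
      ← ENNReal.rpow_add _ _ (by simp) (by simp)]
    congr 2; ring
  rw [tendsto_zero_iff_enorm_tendsto_zero]
  have hlim : Tendsto (fun N : ℕ => C * edist ξ ξ₀ *
      ((2 : ℝ≥0∞) ^ (((-N : ℤ) : ℝ)) * F.levelSup a (-N) ξ +
        (2 : ℝ≥0∞) ^ (((-N : ℤ) : ℝ)) * F.levelSup a (-N) ξ₀)) atTop (𝓝 0) := by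
    have := ENNReal.Tendsto.const_mul ((hdecay ξ hξ).add (hdecay ξ₀ hξ₀))
      (Or.inr (ENNReal.mul_ne_top hC (edist_ne_top ξ ξ₀)))
    simpa using this
  refine tendsto_of_tendsto_of_tendsto_of_le_of_le' tendsto_const_nhds hlim
    (Eventually.of_forall fun _ => zero_le) ?_
  -- For `N ≥ k + 2` some vertex of level `-N + 1` has its center within `2^(N-2)` of `ξ₀`. Its
  -- radius is `2^(N-1)` and `dist ξ ξ₀ < 2^k ≤ 2^(N-2)`, so its ball contains both points.
  obtain ⟨k, hk⟩ := pow_unbounded_of_one_lt (dist ξ ξ₀) (one_lt_two (α := ℝ))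
  filter_upwards [eventually_ge_atTop (k + 2)] with N hN
  obtain ⟨y, hy, hd⟩ := F.maximal (-N + 1) (fun h => absurd h hroot) ξ₀
  have h1 : (2 : ℝ) ^ (-F.level y) = 2 * 2 ^ (-(-N + 1 : ℤ) - 1) := by
    rw [hy, ← two_zpow_add_one]; congr 1; ring
  have h2 : (2 : ℝ) ^ k ≤ 2 ^ (-(-N + 1 : ℤ) - 1) := by
    rw [← zpow_natCast]; exact two_zpow_mono (by omega)
  have hy₀ : ξ₀ ∈ F.B y := Or.inr (by rw [h1]; have := two_zpow_pos (-(-N + 1 : ℤ) - 1); linarith)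
  have hy₁ : ξ ∈ F.B y := Or.inr (by
    rw [h1]; have := dist_triangle ξ ξ₀ (F.center y); linarith)
  unfold levelApprox
  rw [if_pos (hadm _)]
  refine (h v (-N) ξ ξ₀ y hy hy₁ hy₀ (hadm _)).trans (le_of_eq ?_)
  push_cast
  ring

/-- The countable set of centers is dense; the differentiation theorem below uses this. -/
theorem secondCountableTopology (F : HyperbolicFilling Z X) (hμ : IsDoublingWith μ Q) :
    SecondCountableTopology Z := by
  have : Countable X := F.countable hμ
  have : TopologicalSpace.SeparableSpace Z := by
    refine ⟨range F.center, countable_range _,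
      fun ζ => Metric.mem_closure_range_iff.2 fun ε hε => ?_⟩
    obtain ⟨k, hk⟩ := exists_pow_lt_of_lt_one hε (by norm_num : (1 / 2 : ℝ) < 1)
    obtain ⟨x, -, hx⟩ := F.maximal (k + 1) (fun _ => by omega) ζ
    refine ⟨x, hx.trans (lt_of_le_of_lt ?_ hk)⟩
    rw [one_div, inv_pow, ← zpow_natCast, ← zpow_neg]
    exact two_zpow_mono (by omega)
  exact UniformSpace.secondCountable_of_separable Z

/-- A form of Lebesgue's differentiation theorem. -/
theorem ae_tendsto_levelMean_poisson (hμ : IsDoublingWith μ Q) (ψ : F.PartitionOfUnity)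
    {f : Z → ℂ} (hf : f ∈ L1loc μ) : ∀ᵐ ξ ∂μ,
      Tendsto (fun N : ℕ => levelApprox ψ (F.poisson μ f) (N + 1) ξ) atTop (𝓝 (f ξ)) := by
  have : SecondCountableTopology Z := F.secondCountableTopology hμ
  have : IsUnifLocDoublingMeasure μ := hμ.isUnifLocDoublingMeasure
  have : IsLocallyFiniteMeasure μ :=
    ⟨fun ξ => ⟨_, Metric.ball_mem_nhds ξ one_pos, hμ.ball_lt_top ξ 1⟩⟩
  have hloc : LocallyIntegrable f μ := fun ξ =>
    ⟨_, Metric.ball_mem_nhds ξ one_pos, hf _ Metric.isBounded_ball measurableSet_ball⟩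
  obtain ⟨C, hC, hball⟩ := hμ.measure_ball_le
  filter_upwards [IsUnifLocDoublingMeasure.ae_tendsto_average_norm_sub μ hloc 1] with ξ hξ
  -- A set `B(x)` of level `N + 1` that contains `ξ` lies in the closed ball of radius `δ N` about
  -- `ξ`. Its measure is comparable, with constant `D`: the factor 8 leaves room for passing to an
  -- open ball. Averages over `B(x)` are thus controlled by averages centered at `ξ`.
  set δ : ℕ → ℝ := fun N => 4 * 2 ^ (-(N + 1) : ℤ) with hδ
  have hδpos : ∀ N, 0 < δ N := fun N => by positivity
  have hδlim : Tendsto δ atTop (𝓝[>] 0) := by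
    refine tendsto_nhdsWithin_iff.2 ⟨?_, Eventually.of_forall hδpos⟩
    have h1 : δ = fun N : ℕ => 2 * (1 / 2 : ℝ) ^ N := by
      funext N
      simp only [hδ]
      rw [neg_add, ← sub_eq_add_neg, zpow_sub_one₀ (by norm_num), zpow_neg, zpow_natCast]
      rw [one_div, inv_pow]; ring
    rw [h1]
    simpa using (tendsto_pow_atTop_nhds_zero_of_lt_one (by norm_num)
      (by norm_num : (1 / 2 : ℝ) < 1)).const_mul 2
  have h1 := hξ (fun _ : ℕ => ξ) δ hδlim
    (Eventually.of_forall fun N => Metric.mem_closedBall_self (by have := hδpos N; linarith))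
  set D := C * ENNReal.ofReal (8 ^ Q) with hD
  have hDtop : D ≠ ∞ := ENNReal.mul_ne_top hC (by simp)
  have h2 := ENNReal.Tendsto.const_mul (ENNReal.tendsto_ofReal h1) (Or.inr hDtop) (a := D)
  rw [ENNReal.ofReal_zero, mul_zero] at h2
  rw [tendsto_iff_enorm_sub_tendsto_zero]
  refine tendsto_of_tendsto_of_tendsto_of_le_of_le tendsto_const_nhds h2
    (fun _ => zero_le) fun N => ?_
  have hadm : F.Admissible (N + 1) := fun _ => by omega
  set I := ENNReal.ofReal (⨍ y in Metric.closedBall ξ (δ N), ‖f y - f ξ‖ ∂μ) with hI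
  have hcb : μ (Metric.closedBall ξ (δ N)) ≠ ∞ := ((measure_mono
    (Metric.closedBall_subset_ball (by linarith [hδpos N] : δ N < 2 * δ N))).trans_lt
    (hμ.ball_lt_top _ _)).ne
  have hcb0 : μ (Metric.closedBall ξ (δ N)) ≠ 0 :=
    ((hμ.ball_pos ξ _ (hδpos N)).trans_le (measure_mono Metric.ball_subset_closedBall)).ne'
  have hIeq : I = (μ (Metric.closedBall ξ (δ N)))⁻¹ *
      ∫⁻ y in Metric.closedBall ξ (δ N), ‖f y - f ξ‖ₑ ∂μ := by
    have hint : IntegrableOn (fun y => f y - f ξ) (Metric.closedBall ξ (δ N)) μ :=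
      (hf _ Metric.isBounded_closedBall measurableSet_closedBall).sub (integrableOn_const hcb)
    rw [hI, setAverage_eq, smul_eq_mul, ENNReal.ofReal_mul (by positivity),
      ofReal_integral_norm_eq_lintegral_enorm hint, Measure.real,
      ENNReal.ofReal_inv_of_pos (ENNReal.toReal_pos hcb0 hcb), ENNReal.ofReal_toReal hcb]
  have hmain : ∀ x : X, F.level x = N + 1 → ξ ∈ F.B x → ‖F.poisson μ f x - f ξ‖ₑ ≤ D * I := by
    intro x hx hξx
    have hδx : δ N = 4 * 2 ^ (-F.level x) := by rw [hx]
    have hpos := two_zpow_pos (-F.level x)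
    have hd : dist ξ (F.center x) < 2 * 2 ^ (-F.level x) := F.B_subset_ballAt_two x hξx
    have hsub : F.B x ⊆ Metric.closedBall ξ (δ N) := fun η hη => by
      have h4 : dist η (F.center x) < 2 * 2 ^ (-F.level x) := F.B_subset_ballAt_two x hη
      rw [Metric.mem_closedBall, hδx]
      linarith [dist_triangle_right η ξ (F.center x)]
    have hmeas : μ (Metric.closedBall ξ (δ N)) ≤ D * μ (F.B x) := by
      calc _ ≤ μ (Metric.ball ξ (8 * 2 ^ (-F.level x))) :=
            measure_mono (Metric.closedBall_subset_ball (by rw [hδx]; linarith))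
        _ ≤ C * ENNReal.ofReal ((8 * 2 ^ (-F.level x) / 2 ^ (-F.level x)) ^ Q) *
              μ (Metric.ball (F.center x) (2 ^ (-F.level x))) :=
            hball _ _ _ _ hpos (by linarith) (by linarith)
        _ ≤ _ := by
            rw [mul_div_assoc, div_self hpos.ne', mul_one]
            gcongr
            exact fun η hη => Or.inr hη
    refine (enorm_setAverage_sub_le (F.measure_B_pos hμ x).ne' (F.measure_B_lt_top hμ x).ne
      (hf _ (F.isBounded_B x) (F.measurableSet_B x)) (f ξ)).trans ?_
    rw [hIeq, ← mul_assoc]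
    gcongr
    rw [← div_eq_mul_inv, ENNReal.le_div_iff_mul_le (Or.inl hcb0) (Or.inl hcb), mul_comm,
      ← div_eq_mul_inv]
    exact ENNReal.div_le_of_le_mul hmeas
  unfold levelApprox
  rw [if_pos hadm, levelMean_sub_const hμ ψ _ hadm]
  calc _ ≤ ∑' x : {x : X // F.level x = N + 1},
        ‖(F.poisson μ f x - f ξ) * (ψ.toFun x ξ : ℂ)‖ₑ := enorm_tsum_le_tsum_enorm
    _ ≤ ∑' x : {x : X // F.level x = N + 1}, D * I * ‖(ψ.toFun x ξ : ℂ)‖ₑ := by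
        refine ENNReal.tsum_le_tsum fun x => ?_
        rw [enorm_mul]
        by_cases hx : ψ.toFun x ξ = 0
        · simp [hx]
        · exact mul_le_mul_left (hmain x x.2 (ψ.mem_B_of_ne_zero hx)) _
    _ ≤ D * I * 1 := by
        rw [ENNReal.tsum_mul_left]
        exact mul_le_mul_right (ψ.tsum_enorm_le_one _ ξ) _
    _ = _ := mul_one _

/-- Integrating the derivative of the Poisson extension of a function gives the function back, up
to a constant. -/
theorem exists_edgeIntegral_d_poisson_eq (hμ : IsDoublingWith μ Q) (o : F.Orientation)
    (ψ : F.PartitionOfUnity) {i : Indices} {r : ℝ} (hs : i.s < 1) (hr : 0 < r) (hr1 : r ≤ 1)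
    (hrp : r < i.p) (hσ : Q * (1 / r - 1) < i.s) {f : Z → ℂ} (hf : f ∈ L1loc μ)
    (hv : o.edgeNorm μ i (o.d (F.poisson μ f)) < ∞) (ξ₀ : Z) :
    ∃ c : ℂ, ∀ᵐ ξ ∂μ, edgeIntegral o ψ ξ₀ (o.d (F.poisson μ f)) ξ = f ξ - c := by
  refine ⟨levelApprox ψ (F.poisson μ f) 0 ξ₀, ?_⟩
  filter_upwards [ae_tsum_enorm_levelDiff_ne_top hμ o ψ hs hr hr1 hrp hσ hv ξ₀,
    ae_tendsto_levelMean_poisson hμ ψ hf] with ξ h1 h2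
  refine tendsto_nhds_unique (tendsto_integralApprox o ψ h1) ?_
  simp_rw [integralApprox_d hμ o ψ]
  simpa using (h2.sub_const (levelApprox ψ (F.poisson μ f) 0 ξ₀)).sub
    (tendsto_levelApprox_neg_sub hμ o ψ hs hr hrp hv ξ₀ ξ)

end HyperbolicFilling

/-! ### The operators -/

namespace HyperbolicFilling

variable {Z : Type*} [MetricSpace Z] [MeasurableSpace Z] [BorelSpace Z]
  {X : Type*} {F : HyperbolicFilling Z X} {μ : Measure Z} {Q : ℝ}

theorem edgeNorm_d_poisson_lt_top (hμ : IsDoublingWith μ Q) (o : F.Orientation) (i : Indices)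
    (f : F.tlSpace hμ i) : o.edgeNorm μ i (o.d (F.poisson μ f)) < ∞ := by
  obtain ⟨C, hC, h⟩ := edgeNorm_d_le hμ o i
  exact (h _).trans_lt (ENNReal.mul_lt_top hC.lt_top f.2.2)

theorem poisson_ae_const (F : HyperbolicFilling Z X) (hμ : IsDoublingWith μ Q) {f : Z → ℂ} {c : ℂ}
    (hf : ∀ᵐ ξ ∂μ, f ξ = c) (x : X) : F.poisson μ f x = c := by
  rw [poisson, setAverage_eq, integral_congr_ae (ae_restrict_of_ae hf), ← setAverage_eq]
  exact setAverage_const (F.measure_B_pos hμ x).ne' (F.measure_B_lt_top hμ x).ne c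

/-- The operator that maps a function to the derivative of its Poisson extension. -/
def derivMap (hμ : IsDoublingWith μ Q) (o : F.Orientation) (i : Indices) :
    F.TL hμ i →ₗ[ℂ] o.edgeSpace hμ i :=
  (F.aeConst hμ i).liftQ
    { toFun := fun f => ⟨o.d (F.poisson μ f), edgeNorm_d_poisson_lt_top hμ o i f⟩
      map_add' := fun f g => by
        refine Subtype.ext (funext fun e => ?_)
        simp only [Orientation.d, Submodule.coe_add, F.poisson_add f.2.1 g.2.1, Pi.add_apply]
        ring
      map_smul' := fun c f => by
        refine Subtype.ext (funext fun e => ?_)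
        simp only [Orientation.d, Submodule.coe_smul, F.poisson_smul, Pi.smul_apply, smul_eq_mul,
          RingHom.id_apply]
        ring }
    fun f hf => by
      obtain ⟨c, hc⟩ := hf
      refine Subtype.ext (funext fun e => ?_)
      simp [Orientation.d, F.poisson_ae_const hμ hc]

theorem tlClass_eq_of_ae_eq_add_const (hμ : IsDoublingWith μ Q) {i : Indices}
    {f g : F.tlSpace hμ i} {c : ℂ} (h : ∀ᵐ ξ ∂μ, (f : Z → ℂ) ξ = (g : Z → ℂ) ξ + c) :
    F.tlClass hμ i f = F.tlClass hμ i g := by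
  refine (Submodule.Quotient.eq _).2 ⟨c, ?_⟩
  filter_upwards [h] with ξ hξ
  simp [hξ]

section

variable (hμ : IsDoublingWith μ Q) (o : F.Orientation) (ψ : F.PartitionOfUnity) {i : Indices}
  {r : ℝ} (hs : i.s < 1) (hr : 0 < r) (hr1 : r ≤ 1) (hrp : r < i.p)
  (hσ : Q * (1 / r - 1) < i.s) (hrq : ENNReal.ofReal r < i.q)

include hs hr hr1 hrp hσ hrq in
theorem edgeIntegral_mem_tlSpace (ξ₀ : Z) (u : o.edgeSpace hμ i) :
    edgeIntegral o ψ ξ₀ u ∈ F.tlSpace hμ i := by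
  obtain ⟨C, hC, h⟩ := tlNorm_edgeIntegral_le hμ o ψ hs hr hr1 hrp hσ hrq
  exact ⟨edgeIntegral_mem_L1loc hμ o ψ hs hr hr1 hrp hσ u.2 ξ₀,
    (h u u.2 ξ₀).trans_lt (ENNReal.mul_lt_top hC.lt_top u.2)⟩

/-- The operator that integrates functions on edges. -/
def integralMap (ξ₀ : Z) : o.edgeSpace hμ i →ₗ[ℂ] F.TL hμ i where
  toFun u := F.tlClass hμ i ⟨edgeIntegral o ψ ξ₀ u,
    edgeIntegral_mem_tlSpace hμ o ψ hs hr hr1 hrp hσ hrq ξ₀ u⟩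
  map_add' u v := by
    rw [← map_add]
    -- Splitting the series requires convergence, so additivity holds only almost everywhere and is
    -- an identity of classes.
    refine tlClass_eq_of_ae_eq_add_const hμ (c := 0) ?_
    filter_upwards [ae_tsum_enorm_levelDiff_ne_top hμ o ψ hs hr hr1 hrp hσ u.2 ξ₀,
      ae_tsum_enorm_levelDiff_ne_top hμ o ψ hs hr hr1 hrp hσ v.2 ξ₀] with ξ hu hv
    simp only [Submodule.coe_add, Pi.add_apply, add_zero, edgeIntegral]
    rw [← (summable_of_tsum_enorm_ne_top hu).tsum_add (summable_of_tsum_enorm_ne_top hv)]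
    refine tsum_congr fun n => ?_
    simp only [levelDiff, levelSum_add hμ]
    split_ifs <;> ring
  map_smul' c u := by
    rw [← map_smul]
    refine tlClass_eq_of_ae_eq_add_const hμ (c := 0) (Eventually.of_forall fun ξ => ?_)
    simp only [Submodule.coe_smul, Pi.smul_apply, add_zero, edgeIntegral, RingHom.id_apply,
      smul_eq_mul]
    -- Scalars leave the series even where it diverges, so no exceptional set occurs.
    rw [← tsum_mul_left]
    refine tsum_congr fun n => ?_
    simp only [levelDiff, levelSum_smul]
    split_ifs <;> ring

end

end HyperbolicFilling

/-! ### Choice of the auxiliary exponent and assembly of the operators -/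

theorem exists_rpow_exponent {Q s p : ℝ} {q : ℝ≥0∞} (hQ : 0 < Q) (hs : 0 < s)
    (hp : Q / (Q + s) < p) (hq : ENNReal.ofReal (Q / (Q + s)) < q) :
    ∃ r : ℝ, 0 < r ∧ r ≤ 1 ∧ r < p ∧ Q * (1 / r - 1) < s ∧ ENNReal.ofReal r < q := by
  have h0 : 0 < Q / (Q + s) := by positivity
  have h1 : Q / (Q + s) < 1 := (div_lt_one (by positivity)).2 (by linarith)
  -- The choice is made in `ℝ≥0∞` because `q` may be infinite. Since `Q/(Q+s) < 1`, there is room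
  -- below `1`, `p` and `q`, and `r > Q/(Q+s)` is equivalent to `Q(1/r - 1) < s`.
  obtain ⟨t, ht, ht'⟩ := exists_between
    (lt_min ((ENNReal.ofReal_lt_ofReal_iff (lt_min one_pos (h0.trans hp))).2 (lt_min h1 hp)) hq)
  have htop : t ≠ ∞ := (ht'.trans_le (min_le_left _ _)).ne_top
  have h2 := (ENNReal.ofReal_lt_iff_lt_toReal h0.le htop).1 ht
  have h3 := ENNReal.toReal_lt_of_lt_ofReal (ht'.trans_le (min_le_left _ _))
  have hr : 0 < t.toReal := h0.trans h2
  refine ⟨t.toReal, hr, (h3.trans_le (min_le_left _ _)).le, h3.trans_le (min_le_right _ _), ?_, ?_⟩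
  · rw [div_lt_iff₀ (by positivity)] at h2
    have : Q * (1 / t.toReal - 1) = (Q - Q * t.toReal) / t.toReal := by field_simp
    rw [this, div_lt_iff₀ hr]
    linarith
  · rw [ENNReal.ofReal_toReal htop]
    exact ht'.trans_le (min_le_right _ _)

end

theorem proposition6p3 {Z : Type*} [MetricSpace Z] [MeasurableSpace Z] [BorelSpace Z]
    {μ : Measure Z} {Q : ℝ} (hμ : IsDoublingWith μ Q)
    {X : Type*} (F : HyperbolicFilling Z X) (o : F.Orientation) (ψ : F.PartitionOfUnity)
    (i : Indices) (hs : i.s < 1) (hp : Q / (Q + i.s) < i.p)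
    (hq : ENNReal.ofReal (Q / (Q + i.s)) < i.q) :
    ∃ (S : F.TL hμ i →ₗ[ℂ] o.edgeSpace hμ i) (R : o.edgeSpace hμ i →ₗ[ℂ] F.TL hμ i),
      (∃ C : ℝ≥0, ∀ a : F.TL hμ i, o.edgeNorm μ i (S a) ≤ C * F.TLnorm hμ i a) ∧
      (∃ C : ℝ≥0, ∀ u : o.edgeSpace hμ i, F.TLnorm hμ i (R u) ≤ C * o.edgeNorm μ i u) ∧
      R ∘ₗ S = LinearMap.id ∧
      (∀ f : F.tlSpace hμ i, (S (F.tlClass hμ i f) : o.Edge → ℂ) = o.d (F.poisson μ f)) ∧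
      (∀ (ξ₀ : Z) (u : o.edgeSpace hμ i), ∃ g : F.tlSpace hμ i, R u = F.tlClass hμ i g ∧
        (∀ᵐ ξ ∂μ, Tendsto (fun N : ℕ => HyperbolicFilling.integralApprox o ψ ξ₀ u N ξ) atTop
          (𝓝 ((g : Z → ℂ) ξ))) ∧
        (∀ A : Set Z, Bornology.IsBounded A → MeasurableSet A →
          Tendsto (fun N : ℕ => ∫⁻ ξ in A,
            ‖HyperbolicFilling.integralApprox o ψ ξ₀ u N ξ - (g : Z → ℂ) ξ‖ₑ ∂μ) atTop (𝓝 0))) := by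
  obtain ⟨r, hr, hr1, hrp, hσ, hrq⟩ := exists_rpow_exponent hμ.Q_pos i.s_pos hp hq
  have hS : ∃ C : ℝ≥0, ∀ a : F.TL hμ i,
      o.edgeNorm μ i (HyperbolicFilling.derivMap hμ o i a) ≤ C * F.TLnorm hμ i a := by
    obtain ⟨C, hC, h⟩ := HyperbolicFilling.edgeNorm_d_le hμ o i
    refine ⟨C.toNNReal, fun a => ?_⟩
    obtain ⟨f, rfl⟩ := Submodule.mkQ_surjective _ a
    rw [ENNReal.coe_toNNReal hC]
    exact h (F.poisson μ f)
  rcases isEmpty_or_nonempty Z with hZ | ⟨⟨z₀⟩⟩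
  -- Without a point of `Z` there is no base point to define the integral, but the target space is
  -- then trivial and `R = 0` will do.
  · have hsub : ∀ a b : F.TL hμ i, a = b := by
      intro a b
      obtain ⟨f, rfl⟩ := Submodule.mkQ_surjective _ a
      obtain ⟨g, rfl⟩ := Submodule.mkQ_surjective _ b
      rw [show f = g from Subtype.ext (funext fun z => hZ.elim z)]
    refine ⟨HyperbolicFilling.derivMap hμ o i, 0, hS, ⟨0, fun u => ?_⟩,
      LinearMap.ext fun a => hsub _ _, fun f => rfl, fun ξ₀ => hZ.elim ξ₀⟩
    rw [hsub ((0 : o.edgeSpace hμ i →ₗ[ℂ] F.TL hμ i) u) (F.tlClass hμ i 0)]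
    have : F.TLnorm hμ i (F.tlClass hμ i 0) = F.tlNorm μ i 0 := rfl
    have h0 : F.tlNorm μ i 0 = 0 := by
      rw [HyperbolicFilling.tlNorm, jNorm, Measure.eq_zero_of_isEmpty μ]
      simp [i.p_pos]
    rw [this, h0]
    exact zero_le
  refine ⟨HyperbolicFilling.derivMap hμ o i,
    HyperbolicFilling.integralMap hμ o ψ hs hr hr1 hrp hσ hrq z₀, hS, ?_,
    LinearMap.ext fun a => ?_, fun f => rfl, fun ξ₀ u => ?_⟩
  · obtain ⟨C, hC, h⟩ := HyperbolicFilling.tlNorm_edgeIntegral_le hμ o ψ hs hr hr1 hrp hσ hrq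
    refine ⟨C.toNNReal, fun u => ?_⟩
    rw [ENNReal.coe_toNNReal hC]
    exact h u u.2 z₀
  · obtain ⟨f, rfl⟩ := Submodule.mkQ_surjective _ a
    obtain ⟨c, hc⟩ := HyperbolicFilling.exists_edgeIntegral_d_poisson_eq hμ o ψ hs hr hr1 hrp hσ
      f.2.1 (HyperbolicFilling.edgeNorm_d_poisson_lt_top hμ o i f) z₀
    refine HyperbolicFilling.tlClass_eq_of_ae_eq_add_const hμ (c := -c) ?_
    filter_upwards [hc] with ξ hξ
    rw [← sub_eq_add_neg]
    exact hξ
  · refine ⟨⟨HyperbolicFilling.edgeIntegral o ψ ξ₀ u,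
      HyperbolicFilling.edgeIntegral_mem_tlSpace hμ o ψ hs hr hr1 hrp hσ hrq ξ₀ u⟩, ?_, ?_,
      fun A hA _ => HyperbolicFilling.tendsto_lintegral_integralApprox hμ o ψ hs hr hr1 hrp hσ
        u.2 ξ₀ hA⟩
    -- The operator is built with the base point `z₀`; any other `ξ₀` changes the function by a
    -- constant and leaves its class unchanged.
    · obtain ⟨c, hc⟩ := HyperbolicFilling.exists_edgeIntegral_sub_eq hμ o ψ hs hr hr1 hrp hσ
        u.2 ξ₀ z₀
      exact HyperbolicFilling.tlClass_eq_of_ae_eq_add_const hμ hc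
    · filter_upwards [HyperbolicFilling.ae_tsum_enorm_levelDiff_ne_top hμ o ψ hs hr hr1 hrp hσ
        u.2 ξ₀] with ξ hξ
      exact HyperbolicFilling.tendsto_integralApprox o ψ hξ
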